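/- **Machine model.** Programs are random access machine programs with integer arithmetic (addition, subtraction, multiplication, integer division and remainder), indirect addressing and fair coin tosses; time is logarithmic cost, i.e. each operation is charged the bit lengths of the integers and addresses it handles. For inputs consisting of $n$ and of integers of absolute value at most $M$, $\tilde O(n^a)$ means $O(n^a\,\mathrm{polylog}(n+M+2))$ (with $n+1$ in place of $n$ in the base of the power, so that the case $n=0$ is covered). Let $\omega$ be the infimum of all real $\tau$ such that some deterministic program multiplies $n\times n$ integer matrices in time $\tilde O(n^{\tau})$. **Problem.** Zero Weight Triangle: given an undirected simple graph $G$ on the vertices $0,\dots,n-1$ with integer edge weights $e(i,j)=e(j,i)$, find pairwise adjacent vertices $i,j,k$ with $e(i,j)+e(i,k)+e(j,k)=0$. Let $M$ be the maximum of $|e(i,j)|$ over the edges (and $0$ if there are none). **Pseudo-deterministic proofs.** A $(t_1,t_2)$ pseudo-deterministic proof for a search problem $R$ with canonical solution function $c$ (so that $R(x,c(x))$ holds whenever $x$ has a solution) is an interactive protocol, with a constant number of rounds, between a coin-tossing verifier program $V$ and a coin-tossing prover program $P$ which both get the input $x$, exchange bit strings, and at the end of which $V$ outputs a solution or $\bot$,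 such that * (canonical completeness) if $x$ has a solution, then, interacting with $P$, $V$ outputs $c(x)$ with probability at least $2/3$; * (canonical soundness) if $x$ has a solution, then, interacting with an arbitrary prover $P'$, $V$ outputs $c(x)$ or $\bot$ with probability at least $2/3$; * (standard soundness) if $x$ has no solution, then, interacting with an arbitrary prover $P'$, $V$ outputs something other than $\bot$ with probability at most $1/3$; * on every input, for all coin tosses and all messages received, $V$ halts in time at most $t_1$ and $P$ halts in time at most $t_2$. **Theorem.** The Zero Weight Triangle problem has a $(\tilde O(n^{2+\omega/3}),\tilde O(n^3))$ pseudo-deterministic proof whose canonical solution $c(G)$ is the lexicographically first triple $(i,j,k)$ that forms a zero-weight triangle. The proof is of $\mathrm{NP}$ type: the prover, which is randomized, sends a single message, and the verifier is deterministic. -/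

import Mathlib

open MeasureTheory

noncomputable section

namespace PsdProof

/-! ## Random access machines with logarithmic cost

A program uses a fixed finite collection of integer arrays of unbounded length, and executes
structured code.  Every operation is charged the bit lengths of the integers (operands, results
and addresses) that it handles. -/

/-- The contents of all arrays: `m a p` is the content of cell `p` of array `a`. -/
abbrev Memory := ℕ → ℕ → ℤ

/-- A machine state: the memory, and the coin tosses that have not been used yet. -/
structure State where
  mem : Memory
  coins : ℕ → Bool

/-- The binary arithmetic operations. Division and remainder are those of Euclidean division, and
`x / 0 = 0`, `x % 0 = x`. -/
inductive BinOp
  | add | sub | mul | div | mod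

def BinOp.eval : BinOp → ℤ → ℤ → ℤ
  | .add, x, y => x + y
  | .sub, x, y => x - y
  | .mul, x, y => x * y
  | .div, x, y => x / y
  | .mod, x, y => x % y

/-- Integer expressions. `read a e` is the content of array `a` at the address `e`
(negative addresses are read as `0`). -/
inductive Expr
  | const (z : ℤ)
  | read (a : ℕ) (e : Expr)
  | bin (o : BinOp) (e₁ e₂ : Expr)

def Expr.eval (m : Memory) : Expr → ℤ
  | .const z => z
  | .read a e => m a (e.eval m).toNat
  | .bin o e₁ e₂ => o.eval (e₁.eval m) (e₂.eval m)

/-- The cost of handling the integer `z`: one more than its number of binary digits. -/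
def intCost (z : ℤ) : ℕ := z.natAbs.size + 1

/-- The cost of evaluating an expression: the bit lengths of the values of all its
subexpressions (these are all operands, addresses and results that occur). -/
def Expr.cost (m : Memory) : Expr → ℕ
  | .const z => intCost z
  | .read a e => e.cost m + intCost (m a (e.eval m).toNat)
  | .bin o e₁ e₂ => e₁.cost m + e₂.cost m + intCost (o.eval (e₁.eval m) (e₂.eval m))

/-- Programs. `write a i e` stores the value of `e` in array `a` at address `i`; `flip a i` stores
there a fresh random bit; conditionals and loops test whether the value of `e` is positive. -/
inductive Prog
  | skip
  | write (a : ℕ) (i e : Expr)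
  | flip (a : ℕ) (i : Expr)
  | seq (c₁ c₂ : Prog)
  | ite (e : Expr) (c₁ c₂ : Prog)
  | while (e : Expr) (c : Prog)

/-- Memory after storing `z` in array `a` at address `p`. -/
def Memory.set (m : Memory) (a p : ℕ) (z : ℤ) : Memory :=
  Function.update m a (Function.update (m a) p z)

/-- `Exec c s s' t`: started in state `s`, the program `c` halts in state `s'`, and the cost of
the run is `t`. -/
inductive Exec : Prog → State → State → ℕ → Prop
  | skip (s : State) : Exec .skip s s 1
  | write (a : ℕ) (i e : Expr) (s : State) :
      Exec (.write a i e) s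
        ⟨s.mem.set a (i.eval s.mem).toNat (e.eval s.mem), s.coins⟩
        (i.cost s.mem + e.cost s.mem + 1)
  | flip (a : ℕ) (i : Expr) (s : State) :
      Exec (.flip a i) s
        ⟨s.mem.set a (i.eval s.mem).toNat (if s.coins 0 then 1 else 0), fun l => s.coins (l + 1)⟩
        (i.cost s.mem + 1)
  | seq {c₁ c₂ : Prog} {s s' s'' : State} {t₁ t₂ : ℕ} :
      Exec c₁ s s' t₁ → Exec c₂ s' s'' t₂ → Exec (.seq c₁ c₂) s s'' (t₁ + t₂)
  | ite_pos {e : Expr} {c₁ c₂ : Prog} {s s' : State} {t : ℕ} :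
      0 < e.eval s.mem → Exec c₁ s s' t → Exec (.ite e c₁ c₂) s s' (e.cost s.mem + 1 + t)
  | ite_neg {e : Expr} {c₁ c₂ : Prog} {s s' : State} {t : ℕ} :
      ¬ 0 < e.eval s.mem → Exec c₂ s s' t → Exec (.ite e c₁ c₂) s s' (e.cost s.mem + 1 + t)
  | while_done {e : Expr} {c : Prog} {s : State} :
      ¬ 0 < e.eval s.mem → Exec (.while e c) s s (e.cost s.mem + 1)
  | while_step {e : Expr} {c : Prog} {s s' s'' : State} {t₁ t₂ : ℕ} :
      0 < e.eval s.mem → Exec c s s' t₁ → Exec (.while e c) s' s'' t₂ →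
      Exec (.while e c) s s'' (e.cost s.mem + 1 + t₁ + t₂)

/-- The program tosses no coins. -/
def Prog.Deterministic : Prog → Prop
  | .skip => True
  | .write _ _ _ => True
  | .flip _ _ => False
  | .seq c₁ c₂ => c₁.Deterministic ∧ c₂.Deterministic
  | .ite _ c₁ c₂ => c₁.Deterministic ∧ c₂.Deterministic
  | .while _ c => c.Deterministic

/-- An infinite sequence of independent fair coin tosses. -/
def coinMeasure : Measure (ℕ → Bool) :=
  Measure.infinitePi fun _ : ℕ => (PMF.uniformOfFintype Bool).toMeasure

/-- The array that holds an `n × n` matrix row by row (and zeros behind it). -/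
def rowMajor {n : ℕ} (A : Matrix (Fin n) (Fin n) ℤ) : ℕ → ℤ := fun p =>
  if h : p < n * n then A (finProdFinEquiv.symm ⟨p, h⟩).1 (finProdFinEquiv.symm ⟨p, h⟩).2 else 0

/-- The array with `z` in cell `0` and zeros behind it. -/
def scalar (z : ℤ) : ℕ → ℤ := fun p => if p = 0 then z else 0

/-- The bound `C * n ^ a * (log (n * M)) ^ k`, with harmless shifts of `n` and of the argument of
the logarithm that make it positive when `n` or `M` is `0`. A function of inputs that consist of
`n` and of integers of absolute value at most `M` is `Õ(n ^ a)` if it has such a bound. -/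
def softBound (C : ℝ) (k : ℕ) (a : ℝ) (n M : ℕ) : ℝ :=
  C * ((n : ℝ) + 1) ^ a * Real.log ((n : ℝ) + M + 2) ^ k

/-! ## The exponent of matrix multiplication -/

/-- The memory in which `n` is in array `0`, and `A` and `B` are in the arrays `1` and `2`. -/
def matMulInput {n : ℕ} (A B : Matrix (Fin n) (Fin n) ℤ) : Memory
  | 0 => scalar n
  | 1 => rowMajor A
  | 2 => rowMajor B
  | _ => fun _ => 0

/-- Two `n × n` integer matrices can be multiplied in time `Õ(n ^ τ)`; the product is to be found
in array `3`. -/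
def MatMulInTime (τ : ℝ) : Prop :=
  ∃ (c : Prog) (C : ℝ) (k : ℕ), c.Deterministic ∧
    ∀ (n M : ℕ) (A B : Matrix (Fin n) (Fin n) ℤ),
      (∀ i j, (A i j).natAbs ≤ M) → (∀ i j, (B i j).natAbs ≤ M) →
      ∃ (s : State) (t : ℕ), Exec c ⟨matMulInput A B, fun _ => false⟩ s t ∧
        (t : ℝ) ≤ softBound C k τ n M ∧
        ∀ i j : Fin n, s.mem 3 (finProdFinEquiv (i, j)) = (A * B) i j

/-- The exponent of matrix multiplication. -/
def omega : ℝ := sInf {τ : ℝ | MatMulInTime τ}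

/-! ## Interactive protocols -/

/-- A message is a sequence of bits. A finite message is padded with zeros; a
machine has to pay for each bit that it writes or looks at. -/
abbrev Message := ℕ → Bool

/-- The array in which a machine finds the last message that was sent to it. -/
def inbox : ℕ := 0
/-- The array in which a machine writes its next message. -/
def outbox : ℕ := 1
/-- The array in which the verifier writes its output. -/
def result : ℕ := 2

/-- The state of a machine after it has been handed the message `b`. -/
def State.receive (s : State) (b : Message) : State :=
  ⟨Function.update s.mem inbox fun p => if b p then 1 else 0, s.coins⟩

/-- The message that a machine has written in its outbox. -/
def State.message (s : State) : Message := fun p => decide (s.mem outbox p ≠ 0)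

/-- An interactive protocol with a constant number of rounds. The verifier runs `verifier 0` and
sends a message; in round `i + 1` the prover runs `prover i` and sends a message, and
then the verifier runs `verifier (i + 1)` and sends a message. Both machines
keep their state from round to round. After the last round the verifier's output is in its array
`result`. -/
structure Protocol where
  rounds : ℕ
  verifier : ℕ → Prog
  prover : ℕ → Prog

/-- An arbitrary prover: its next message, as a function of the verifier's messages so far. -/
abbrev Strategy := List Message → Message

/-- `VerifierRun Q σ s₀ i l s t`: the verifier of `Q`, started in state `s₀` and interacting with
the strategy `σ`, is in state `s` after `i` rounds, has sent the messages `l` and has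
spent the time `t`. -/
inductive VerifierRun (Q : Protocol) (σ : Strategy) (s₀ : State) :
    ℕ → List Message → State → ℕ → Prop
  | start {s : State} {t : ℕ} :
      Exec (Q.verifier 0) s₀ s t → VerifierRun Q σ s₀ 0 [s.message] s t
  | round {i : ℕ} {l : List Message} {s s' : State} {t t' : ℕ} :
      VerifierRun Q σ s₀ i l s t → Exec (Q.verifier (i + 1)) (s.receive (σ l)) s' t' →
      VerifierRun Q σ s₀ (i + 1) (l ++ [s'.message]) s' (t + t')

/-- `ProverRun Q s₀ l s t`: the prover of `Q`, started in state `s₀` and having answered the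
verifier's messages `l`, is in state `s` and has spent the time `t`. -/
inductive ProverRun (Q : Protocol) (s₀ : State) : List Message → State → ℕ → Prop
  | start : ProverRun Q s₀ [] s₀ 0
  | round {l : List Message} {b : Message} {s s' : State} {t t' : ℕ} :
      ProverRun Q s₀ l s t → Exec (Q.prover l.length) (s.receive b) s' t' →
      ProverRun Q s₀ (l ++ [b]) s' (t + t')

/-- `σ` is the strategy that the prover of `Q` plays when it is started in state `s₀`. -/
def Protocol.Plays (Q : Protocol) (s₀ : State) (σ : Strategy) : Prop :=
  ∀ l : List Message, l ≠ [] → l.length ≤ Q.rounds →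
    ∃ (s : State) (t : ℕ), ProverRun Q s₀ l s t ∧ σ l = s.message

/-- A search problem: a relation between instances and solutions, with the representation of
instances in memory, and of outputs in an array (`none` is the output `⊥`). -/
structure SearchProblem where
  Inst : Type
  Sol : Type
  Rel : Inst → Sol → Prop
  encode : Inst → Memory
  decode : (ℕ → ℤ) → Option Sol

/-- `Outputs S Q σ x r y`: on the instance `x`, with the coins `r` of the verifier, the verifier of
`Q` halts with output `y` when interacting with `σ`. -/
def Outputs (S : SearchProblem) (Q : Protocol) (σ : Strategy) (x : S.Inst) (r : ℕ → Bool)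
    (y : Option S.Sol) : Prop :=
  ∃ (l : List Message) (s : State) (t : ℕ),
    VerifierRun Q σ ⟨S.encode x, r⟩ Q.rounds l s t ∧ S.decode (s.mem result) = y

/-- `Q` is a `(tV, tP)` pseudo-deterministic proof for the search problem `S` with canonical
solutions `c`. -/
structure IsPseudoDeterministicProof (S : SearchProblem) (Q : Protocol) (c : S.Inst → S.Sol)
    (tV tP : S.Inst → ℝ) : Prop where
  canonical : ∀ x, (∃ y, S.Rel x y) → S.Rel x (c x)
  /-- The honest prover makes the verifier output the canonical solution. -/
  completeness : ∀ x, (∃ y, S.Rel x y) →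
    2 / 3 ≤ (coinMeasure.prod coinMeasure) {q : (ℕ → Bool) × (ℕ → Bool) |
      ∃ σ : Strategy, Q.Plays ⟨S.encode x, q.2⟩ σ ∧ Outputs S Q σ x q.1 (some (c x))}
  /-- No prover makes the verifier output anything but the canonical solution or `⊥`. -/
  soundness : ∀ x, (∃ y, S.Rel x y) → ∀ σ : Strategy,
    2 / 3 ≤ coinMeasure {r | Outputs S Q σ x r (some (c x)) ∨ Outputs S Q σ x r none}
  /-- If there is no solution, no prover makes the verifier output anything but `⊥`. -/
  standard_soundness : ∀ x, (¬ ∃ y, S.Rel x y) → ∀ σ : Strategy,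
    coinMeasure {r | ∃ y, y ≠ none ∧ Outputs S Q σ x r y} ≤ 1 / 3
  /-- The verifier halts in time `tV` whatever the prover and the coins. -/
  verifier_time : ∀ x (r : ℕ → Bool) (σ : Strategy),
    ∃ (l : List Message) (s : State) (t : ℕ),
      VerifierRun Q σ ⟨S.encode x, r⟩ Q.rounds l s t ∧ (t : ℝ) ≤ tV x
  /-- The honest prover halts in time `tP` whatever the coins and the messages it is sent. -/
  prover_time : ∀ x (r : ℕ → Bool) (l : List Message), l.length ≤ Q.rounds →
    ∃ (s : State) (t : ℕ), ProverRun Q ⟨S.encode x, r⟩ l s t ∧ (t : ℝ) ≤ tP x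

/-- The protocol is of the type of `NP`: one message from the prover, then the check by a
deterministic verifier. -/
def Protocol.IsNP (Q : Protocol) : Prop :=
  Q.rounds = 1 ∧ Q.verifier 0 = .skip ∧ ∀ i, (Q.verifier i).Deterministic

/-! ## The Zero Weight Triangle problem -/

/-- A graph on the vertices `0, …, n - 1` with integer edge weights (the values of `weight` at
pairs that are not edges play no role). -/
structure WeightedGraph where
  n : ℕ
  graph : SimpleGraph (Fin n)
  weight : Sym2 (Fin n) → ℤ

open Classical in
/-- The adjacency matrix. -/
def WeightedGraph.adjMatrix (x : WeightedGraph) : Matrix (Fin x.n) (Fin x.n) ℤ :=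
  Matrix.of fun i j => if x.graph.Adj i j then 1 else 0

open Classical in
/-- The matrix of the edge weights, with `0` at the pairs that are not edges. -/
def WeightedGraph.weightMatrix (x : WeightedGraph) : Matrix (Fin x.n) (Fin x.n) ℤ :=
  Matrix.of fun i j => if x.graph.Adj i j then x.weight s(i, j) else 0

/-- The largest absolute value of an edge weight (`0` if there are no edges). -/
def WeightedGraph.maxWeight (x : WeightedGraph) : ℕ :=
  Finset.univ.sup fun p : Fin x.n × Fin x.n => (x.weightMatrix p.1 p.2).natAbs

/-- The vertices `i`, `j`, `k` form a triangle of weight zero. -/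
def WeightedGraph.IsZeroTriangle (x : WeightedGraph) (i j k : Fin x.n) : Prop :=
  x.graph.Adj i j ∧ x.graph.Adj i k ∧ x.graph.Adj j k ∧
    x.weight s(i, j) + x.weight s(i, k) + x.weight s(j, k) = 0

/-- The memory in which `n` is in array `3`, and the adjacency matrix and the weights are in the
arrays `4` and `5`. -/
def WeightedGraph.encode (x : WeightedGraph) : Memory
  | 3 => scalar x.n
  | 4 => rowMajor x.adjMatrix
  | 5 => rowMajor x.weightMatrix
  | _ => fun _ => 0

/-- The Zero Weight Triangle problem. Solutions are triples of vertices, ordered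
lexicographically. The output is `⊥` if cell `0` of the result array holds `0`, and else the triple
in the cells `1`, `2`, `3`. -/
def zeroWeightTriangle : SearchProblem where
  Inst := WeightedGraph
  Sol := ℕ ×ₗ ℕ ×ₗ ℕ
  Rel x y := ∃ i j k : Fin x.n,
    y = toLex ((i : ℕ), toLex ((j : ℕ), (k : ℕ))) ∧ x.IsZeroTriangle i j k
  encode := WeightedGraph.encode
  decode f := if f 0 = 0 then none
    else some (toLex ((f 1).toNat, toLex ((f 2).toNat, (f 3).toNat)))

end PsdProof

end

open PsdProof

namespace PsdProof

/-! ### Expressions -/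

/-! The honest prover finds the first zero-weight triangle by brute force. The difficulty is to
convince the verifier that no earlier triple is a zero triangle. Triples with the same first vertex
are at most `n ^ 2` many and are simply searched. For the triples with a smaller first vertex, the
prover names a modulus `P` and lists the false positives: the triangles whose weight is divisible by
`P` but not zero. The verifier counts, exactly and on its own, the triangles in this range whose
weight is divisible by `P`. It then checks that the list is strictly increasing, consists of false
positives in the range, and has that many entries. Such a list exhausts all the triangles counted,
so none of them has weight zero (`goodEntries_no_zero`, `Accepts.eq_first`). Soundness is therefore
unconditional; the prover only influences whether the verifier accepts.

Counting. Karatsuba's recursion writes the product of two polynomials with `2 ^ k` coefficients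
through `3 ^ k` products of sums of coefficients. Pairing the result with an indicator function
expresses the condition `P ∣ r + s + t` on residues as a sum of `3 ^ k` terms, each a function of
`r` times a function of `s` times a function of `t` (`sum_kU_mul_kV`). Summing over the middle
vertex turns the count into `3 ^ k` squares of matrices with entries in `{-1, 0, 1}`
(`sum_square_eq_count`). Packing the polynomials into huge integers would not do instead, since the
cost of multiplication is controlled only up to an unspecified power of the bit length. The given
multiplication program is run on interleaved memories, so that each run finds fresh zeros
(`Exec.lift`).

Few false positives. A nonzero weight has at most `2 * len` distinct prime divisors, whereas
Chebyshev's bound gives about `B` primes, up to a small power, below the polylogarithmic bound `B`.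
By averaging, some factor of size at most `B + 1` divides the number of surviving triangles by
nearly `B` (`sum_count_le`, `Sparse.mul`). Multiplying such factors greedily gives a modulus of size
`Q`, up to a factor `B + 1`, with about `n ^ 3 / Q ^ (1 - 1 / g)` false positives. Each greedy round
costs the prover `n ^ 3` up to logarithms, and no coins are needed.

Balance. Put `δ = 1 - ω / 3` and let `Q` be about `n ^ ρ` with `ρ` between `δ` and `1.2 * δ`. The
list then has at most `n ^ (3 - δ) = n ^ (2 + ω / 3)` entries up to logarithms. The matrix products
cost `n ^ (τ + 1.6 * ρ)`, because `3 ^ k ≤ Q ^ 1.6`. Since `ω + 2 * δ = 2 + ω / 3`, there is room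
both for `τ` slightly above the infimum `ω` and for `ρ` slightly above `δ`. If `ω = 3` there is no
room, but then the verifier can solve the problem alone. -/

instance : Add Expr := ⟨.bin .add⟩
instance : Sub Expr := ⟨.bin .sub⟩
instance : Mul Expr := ⟨.bin .mul⟩
instance : Div Expr := ⟨.bin .div⟩
instance : Mod Expr := ⟨.bin .mod⟩
instance (k : ℕ) : OfNat Expr k := ⟨.const k⟩

/-- The scalar variable kept in cell `0` of array `a`. -/
def V (a : ℕ) : Expr := .read a (.const 0)

/-- `e ^ k` for a fixed exponent. -/
def Expr.pow (e : Expr) : ℕ → Expr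
  | 0 => .const 1
  | k + 1 => e.pow k * e

section eval
variable (m : Memory) (e f : Expr)

@[simp] theorem eval_add : (e + f).eval m = e.eval m + f.eval m := rfl
@[simp] theorem eval_sub : (e - f).eval m = e.eval m - f.eval m := rfl
@[simp] theorem eval_mul : (e * f).eval m = e.eval m * f.eval m := rfl
@[simp] theorem eval_div : (e / f).eval m = e.eval m / f.eval m := rfl
@[simp] theorem eval_mod : (e % f).eval m = e.eval m % f.eval m := rfl
@[simp] theorem eval_zero : (0 : Expr).eval m = 0 := rfl
@[simp] theorem eval_one : (1 : Expr).eval m = 1 := rfl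
@[simp] theorem eval_two : (2 : Expr).eval m = 2 := rfl
@[simp] theorem eval_three : (3 : Expr).eval m = 3 := rfl
@[simp] theorem eval_const (z : ℤ) : (Expr.const z).eval m = z := rfl
@[simp] theorem eval_V (a : ℕ) : (V a).eval m = m a 0 := rfl
@[simp] theorem eval_read (a : ℕ) : (Expr.read a e).eval m = m a (e.eval m).toNat := rfl
@[simp] theorem eval_pow (k : ℕ) : (e.pow k).eval m = e.eval m ^ k := by
  induction k with
  | zero => simp [Expr.pow]
  | succ k ih => simp [Expr.pow, ih, pow_succ]

end eval

/-- All arrays that the expression reads are among the first `64`. -/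
def Expr.low : Expr → Bool
  | .const _ => true
  | .read a e => decide (a < 64) && e.low
  | .bin _ e f => e.low && f.low

@[simp] theorem low_pow {e : Expr} (h : e.low = true) (k : ℕ) : (e.pow k).low = true := by
  induction k with
  | zero => rfl
  | succ k ih => simpa [Expr.pow, Expr.low, HMul.hMul, Mul.mul] using ⟨ih, h⟩

theorem low_bin {o : BinOp} {e f : Expr} (h : e.low = true) (h' : f.low = true) :
    (Expr.bin o e f).low = true := by simp [Expr.low, h, h']

theorem low_V {a : ℕ} (h : a < 64) : (V a).low = true := by simp [V, Expr.low, h]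

theorem low_mul {e f : Expr} (h : e.low = true) (h' : f.low = true) :
    (e * f).low = true := low_bin h h'

theorem low_add {e f : Expr} (h : e.low = true) (h' : f.low = true) :
    (e + f).low = true := low_bin h h'

theorem low_sub {e f : Expr} (h : e.low = true) (h' : f.low = true) :
    (e - f).low = true := low_bin h h'

/-- The cells that the evaluation of the expression reads are bounded by `H`. -/
def Expr.ReadsBdd (H : ℕ) (m : Memory) : Expr → Prop
  | .const _ => True
  | .read a e => e.ReadsBdd H m ∧ |m a (e.eval m).toNat| ≤ H
  | .bin _ e f => e.ReadsBdd H m ∧ f.ReadsBdd H m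

/-- The first `64` arrays are bounded by `H`. -/
def Bdd (H : ℕ) (m : Memory) : Prop := ∀ a < 64, ∀ p, |m a p| ≤ H

theorem Bdd.reads {H : ℕ} {m : Memory} (h : Bdd H m) :
    ∀ {e : Expr}, e.low = true → e.ReadsBdd H m
  | .const _, _ => trivial
  | .read a e, he => by
    simp only [Expr.low, Bool.and_eq_true, decide_eq_true_eq] at he
    exact ⟨h.reads he.2, h a he.1 _⟩
  | .bin _ e f, he => by
    simp only [Expr.low, Bool.and_eq_true] at he
    exact ⟨h.reads he.1, h.reads he.2⟩

/-- A structural factor for the bit length of the value of an expression. -/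
def Expr.sz : Expr → ℕ
  | .const z => z.natAbs.size
  | .read _ _ => 1
  | .bin _ e f => e.sz + f.sz + 1

/-- A structural factor for the cost of an expression. -/
def Expr.wt : Expr → ℕ
  | .const z => intCost z
  | .read _ e => e.wt + 2
  | .bin o e f => e.wt + f.wt + (Expr.bin o e f).sz + 1

/-- One product bound serves all five operations, so that bit lengths add up along an expression
whatever the operation is. -/
theorem natAbs_eval_binOp_le (o : BinOp) (x y : ℤ) :
    (o.eval x y).natAbs ≤ (x.natAbs + 1) * (y.natAbs + 1) := by
  cases o with
  | add => exact (Int.natAbs_add_le x y).trans (by nlinarith [Nat.zero_le (x.natAbs * y.natAbs)])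
  | sub => exact (Int.natAbs_sub_le x y).trans (by nlinarith [Nat.zero_le (x.natAbs * y.natAbs)])
  | mul => exact (Int.natAbs_mul x y).le.trans (Nat.mul_le_mul (Nat.le_succ _) (Nat.le_succ _))
  | div =>
    refine (Int.natAbs_ediv_le_natAbs x y).trans ?_
    exact (Nat.le_succ _).trans (Nat.le_mul_of_pos_right _ (Nat.succ_pos _))
  | mod =>
    have : (x % y).natAbs ≤ x.natAbs + y.natAbs := by
      rcases eq_or_ne y 0 with rfl | hy
      · simp
      · have h1 := Int.emod_nonneg x hy
        have h2 := Int.emod_lt_abs x hy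
        rw [Int.abs_eq_natAbs] at h2
        omega
    exact this.trans (by nlinarith [Nat.zero_le (x.natAbs * y.natAbs)])

theorem size_eval_binOp_le (o : BinOp) (x y : ℤ) {a b : ℕ} (hx : x.natAbs.size ≤ a)
    (hy : y.natAbs.size ≤ b) : (o.eval x y).natAbs.size ≤ a + b + 1 := by
  have h1 := natAbs_eval_binOp_le o x y
  rw [Nat.size_le] at *
  have : (x.natAbs + 1) * (y.natAbs + 1) ≤ 2 ^ a * 2 ^ b := Nat.mul_le_mul hx hy
  have h0 : 0 < 2 ^ a * 2 ^ b := by positivity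
  rw [pow_succ, pow_add]; omega

theorem size_le_of_abs_le {H : ℕ} {z : ℤ} (h : |z| ≤ H) : z.natAbs.size ≤ H.size :=
  Nat.size_le_size (by rw [Int.abs_eq_natAbs] at h; exact_mod_cast h)

theorem Expr.size_eval_le {H : ℕ} {m : Memory} :
    ∀ {e : Expr}, e.ReadsBdd H m → (e.eval m).natAbs.size ≤ e.sz * (H.size + 1)
  | .const z, _ => by
    simp only [Expr.eval, Expr.sz]
    exact Nat.le_mul_of_pos_right _ (Nat.succ_pos _)
  | .read a e, h => by
    simp only [Expr.eval, Expr.sz, one_mul]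
    exact (size_le_of_abs_le h.2).trans (Nat.le_succ _)
  | .bin o e f, h => by
    have := size_eval_binOp_le o (e.eval m) (f.eval m) (size_eval_le h.1) (size_eval_le h.2)
    simp only [Expr.eval, Expr.sz]
    exact this.trans (by nlinarith)

/-- Only the cells read need a bound: intermediate values grow by a factor in bit length that
depends on the expression alone. Hence a fixed program pays `O(size H)` per step. -/
theorem Expr.cost_le {H : ℕ} {m : Memory} :
    ∀ {e : Expr}, e.ReadsBdd H m → e.cost m ≤ e.wt * (H.size + 1)
  | .const z, _ => by
    simp only [Expr.cost, Expr.wt]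
    exact Nat.le_mul_of_pos_right _ (Nat.succ_pos _)
  | .read a e, h => by
    have h1 := cost_le h.1
    have h2 := size_le_of_abs_le h.2
    simp only [Expr.cost, Expr.wt, intCost]
    nlinarith
  | .bin o e f, h => by
    have h1 := cost_le h.1
    have h2 := cost_le h.2
    have h3 := Expr.size_eval_le (e := .bin o e f) h
    simp only [Expr.eval] at h3
    simp only [Expr.cost, Expr.wt, intCost]
    nlinarith

/-! ### Memory -/

theorem Memory.set_apply (m : Memory) (a p : ℕ) (z : ℤ) (b q : ℕ) :
    m.set a p z b q = if b = a ∧ q = p then z else m b q := by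
  unfold Memory.set
  rcases eq_or_ne b a with rfl | h
  · rcases eq_or_ne q p with rfl | h' <;> simp [*]
  · simp [h]

theorem Memory.set_ne (m : Memory) {a b : ℕ} (h : b ≠ a) (p : ℕ) (z : ℤ) :
    m.set a p z b = m b := by
  simp [Memory.set, h]

@[simp] theorem Memory.set_self (m : Memory) (a p : ℕ) (z : ℤ) : m.set a p z a p = z := by
  simp [Memory.set]

theorem Bdd.set {H : ℕ} {m : Memory} (h : Bdd H m) {a p : ℕ} {z : ℤ} (hz : a < 64 → |z| ≤ H) :
    Bdd H (m.set a p z) := by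
  intro b hb q
  rw [Memory.set_apply]
  split_ifs with h'
  · exact hz (h'.1 ▸ hb)
  · exact h b hb q

/-! ### A program logic for total correctness and running time -/

/-- The arrays that the program may change. -/
def Prog.writes : Prog → List ℕ
  | .skip => []
  | .write a _ _ => [a]
  | .flip a _ => [a]
  | .seq c d => c.writes ++ d.writes
  | .ite _ c d => c.writes ++ d.writes
  | .while _ c => c.writes

/-- A structural factor for the cost of one step of the program. -/
def Prog.wt : Prog → ℕ
  | .skip => 1
  | .write _ i e => i.wt + e.wt + 1
  | .flip _ i => i.wt + 1
  | .seq c d => c.wt + d.wt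
  | .ite e c d => e.wt + 1 + c.wt + d.wt
  | .while e c => e.wt + 1 + c.wt

theorem Prog.wt_pos : ∀ c : Prog, 0 < c.wt
  | .skip => Nat.one_pos
  | .write _ _ _ => Nat.succ_pos _
  | .flip _ _ => Nat.succ_pos _
  | .seq c d => Nat.add_pos_left c.wt_pos _
  | .ite e c d => by have := c.wt_pos; simp only [Prog.wt]; omega
  | .while e c => by have := c.wt_pos; simp only [Prog.wt]; omega

/-- The list of written arrays is computed from the syntax, so later proofs can transport untouched
variables by deciding membership in a concrete list. -/
theorem Exec.frame {c : Prog} {s s' : State} {t : ℕ} (h : Exec c s s' t) :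
    ∀ a, a ∉ c.writes → s'.mem a = s.mem a := by
  induction h with
  | skip s => intros; rfl
  | write a i e s => intro b hb; exact Memory.set_ne _ (by simpa [Prog.writes] using hb) _ _
  | flip a i s => intro b hb; exact Memory.set_ne _ (by simpa [Prog.writes] using hb) _ _
  | seq _ _ ih1 ih2 =>
    intro b hb
    simp only [Prog.writes, List.mem_append, not_or] at hb
    rw [ih2 b hb.2, ih1 b hb.1]
  | ite_pos _ _ ih =>
    intro b hb
    simp only [Prog.writes, List.mem_append, not_or] at hb
    exact ih b hb.1
  | ite_neg _ _ ih =>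
    intro b hb
    simp only [Prog.writes, List.mem_append, not_or] at hb
    exact ih b hb.2
  | while_done _ => intros; rfl
  | while_step _ _ _ ih1 ih2 =>
    intro b hb
    rw [ih2 b hb, ih1 b hb]

/-- `Runs H c m T Q`: if the first `64` arrays of `m` are bounded by `H`, then, started with memory
`m`, the program `c` halts after at most `T` steps with a memory that satisfies `Q`, and whose first
`64` arrays are bounded by `H`. It uses no coins. -/
def Runs (H : ℕ) (c : Prog) (m : Memory) (T : ℕ) (Q : Memory → Prop) : Prop :=
  Bdd H m → ∀ r : ℕ → Bool, ∃ (m' : Memory) (t : ℕ),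
    Exec c ⟨m, r⟩ ⟨m', r⟩ t ∧ t ≤ T * (c.wt * (H.size + 1)) ∧ Bdd H m' ∧ Q m'

namespace Runs
variable {H : ℕ} {c d : Prog} {m : Memory} {T T' : ℕ} {Q Q' : Memory → Prop}

theorem mono (h : Runs H c m T Q) (hT : T ≤ T') (hQ : ∀ m', Bdd H m' → Q m' → Q' m') :
    Runs H c m T' Q' := fun hm r => by
  obtain ⟨m', t, h1, h2, h3, h4⟩ := h hm r
  exact ⟨m', t, h1, h2.trans (Nat.mul_le_mul_right _ hT), h3, hQ _ h3 h4⟩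

theorem frame (h : Runs H c m T Q) :
    Runs H c m T (fun m' => Q m' ∧ ∀ a, a ∉ c.writes → m' a = m a) := fun hm r => by
  obtain ⟨m', t, h1, h2, h3, h4⟩ := h hm r
  exact ⟨m', t, h1, h2, h3, h4, h1.frame⟩

theorem bdd (h : Bdd H m → Runs H c m T Q) : Runs H c m T Q := fun hm => h hm hm

theorem skip (hQ : Q m) : Runs H .skip m 1 Q := fun hm r =>
  ⟨m, 1, .skip _, by simp [Prog.wt], hm, hQ⟩

/-- The variant for expressions that read results of the simulated runs, which lie beyond the arrays
controlled by `Bdd`. -/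
theorem write' {a : ℕ} {i e : Expr} (hi : i.low = true) (he : Bdd H m → e.ReadsBdd H m)
    (hb : a < 64 → |e.eval m| ≤ H) (hQ : Q (m.set a (i.eval m).toNat (e.eval m))) :
    Runs H (.write a i e) m 1 Q := fun hm r => by
  refine ⟨_, _, .write a i e _, ?_, hm.set hb, hQ⟩
  have h1 := Expr.cost_le (hm.reads hi)
  have h2 := Expr.cost_le (he hm)
  simp only [Prog.wt]
  nlinarith

theorem write {a : ℕ} {i e : Expr} (hi : i.low = true) (he : e.low = true)
    (hb : a < 64 → |e.eval m| ≤ H) (hQ : Q (m.set a (i.eval m).toNat (e.eval m))) :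
    Runs H (.write a i e) m 1 Q := write' hi (fun hm => hm.reads he) hb hQ

/-- Assignment to a scalar variable. -/
theorem assign {a : ℕ} {e : Expr} {v : ℤ} (he : e.low = true) (hv : e.eval m = v) (hb : |v| ≤ H)
    (hQ : Q (m.set a 0 v)) : Runs H (.write a 0 e) m 1 Q := by
  subst hv
  exact write rfl he (fun _ => hb) hQ

/-- Assignment to a cell. -/
theorem store {a p : ℕ} {i e : Expr} {v : ℤ} (hi : i.low = true) (he : e.low = true)
    (hp : i.eval m = p) (hv : e.eval m = v) (hb : a < 64 → |v| ≤ H) (hQ : Q (m.set a p v)) :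
    Runs H (.write a i e) m 1 Q := by
  subst hv
  exact write hi he hb (by rwa [hp, Int.toNat_natCast])

/-- Each step is charged the weight of the whole program. This wastes a constant factor, but makes
step counts simply additive. -/
theorem seq (h : Runs H c m T (fun m' => Runs H d m' T' Q)) :
    Runs H (.seq c d) m (T + T') Q := fun hm r => by
  obtain ⟨m', t, h1, h2, h3, h4⟩ := h hm r
  obtain ⟨m'', t', h1', h2', h3', h4'⟩ := h4 h3 r
  refine ⟨m'', _, .seq h1 h1', ?_, h3', h4'⟩
  simp only [Prog.wt]
  nlinarith [Nat.zero_le (T * (d.wt * (H.size + 1))), Nat.zero_le (T' * (c.wt * (H.size + 1)))]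

theorem ite {e : Expr} (he : e.low = true) (h1 : 0 < e.eval m → Runs H c m T Q)
    (h2 : ¬ 0 < e.eval m → Runs H d m T Q) : Runs H (.ite e c d) m (T + 1) Q := fun hm r => by
  have h0 := Expr.cost_le (hm.reads he)
  by_cases h : 0 < e.eval m
  · obtain ⟨m', t, h1, h2, h3, h4⟩ := h1 h hm r
    refine ⟨m', _, .ite_pos h h1, ?_, h3, h4⟩
    simp only [Prog.wt]
    nlinarith [Nat.zero_le (T * (d.wt * (H.size + 1))), Nat.zero_le (d.wt * (H.size + 1)),
      Nat.zero_le (c.wt * (H.size + 1)), Nat.zero_le (T * ((e.wt + 1) * (H.size + 1)))]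
  · obtain ⟨m', t, h1, h2, h3, h4⟩ := h2 h hm r
    refine ⟨m', _, .ite_neg h h1, ?_, h3, h4⟩
    simp only [Prog.wt]
    nlinarith [Nat.zero_le (T * (c.wt * (H.size + 1))), Nat.zero_le (d.wt * (H.size + 1)),
      Nat.zero_le (c.wt * (H.size + 1)), Nat.zero_le (T * ((e.wt + 1) * (H.size + 1)))]

/-- The invariant is indexed by the number of iterations done, so termination and running time come
out together; the induction is on the iterations that remain. -/
theorem while_ {e : Expr} (he : e.low = true) {Inv : ℕ → Memory → Prop} (N : ℕ)
    (hpos : ∀ j < N, ∀ m', Inv j m' → 0 < e.eval m')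
    (hstep : ∀ j < N, ∀ m', Inv j m' → Runs H c m' T (Inv (j + 1)))
    (hneg : ∀ m', Inv N m' → ¬ 0 < e.eval m') (h0 : Inv 0 m) :
    Runs H (.while e c) m (N * (T + 1) + 1) (Inv N) := by
  suffices ∀ k j, j + k = N → ∀ m', Inv j m' →
      Runs H (.while e c) m' (k * (T + 1) + 1) (Inv N) from this N 0 (by simp) m h0
  intro k
  induction k with
  | zero =>
    rintro j rfl m' hm' hb r
    have h1 := Expr.cost_le (hb.reads he)
    refine ⟨m', _, .while_done (hneg _ hm'), ?_, hb, hm'⟩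
    simp only [Prog.wt]
    nlinarith [Nat.zero_le (c.wt * (H.size + 1))]
  | succ k ih =>
    intro j hj m' hm' hb r
    have h0 := Expr.cost_le (hb.reads he)
    obtain ⟨m1, t1, h1, h2, h3, h4⟩ := hstep j (by omega) m' hm' hb r
    obtain ⟨m2, t2, h5, h6, h7, h8⟩ := ih (j + 1) (by omega) m1 h4 h3 r
    refine ⟨m2, _, .while_step (hpos j (by omega) m' hm') h1 h5, ?_, h7, h8⟩
    simp only [Prog.wt] at h6 ⊢
    nlinarith [Nat.zero_le (c.wt * (H.size + 1)), Nat.zero_le (T * ((e.wt + 1) * (H.size + 1)))]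

end Runs

/-- `for i := 0, …, V v - 1 do c`. -/
def forLoop (i v : ℕ) (c : Prog) : Prog :=
  .seq (.write i 0 0) (.while (V v - V i) (.seq c (.write i 0 (V i + 1))))

/-- The counter is incremented after the body has established the next invariant, whence the
requirement `hset` that the invariant ignore the counter cell. -/
theorem Runs.forLoop {H : ℕ} {c : Prog} {m : Memory} {T : ℕ} {i v : ℕ} {N : ℕ}
    (Inv : ℕ → Memory → Prop)
    (hi : i < 64 ∧ i ∉ c.writes ∧ v < 64 ∧ v ∉ c.writes ∧ v ≠ i) (hN : m v 0 = (N : ℤ))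
    (h0 : Inv 0 m) (hset : ∀ j m' z, Inv j m' → Inv j (m'.set i 0 z))
    (hstep : ∀ j < N, ∀ m', (∀ a, a ≠ i → a ∉ c.writes → m' a = m a) → m' i 0 = (j : ℤ) → Inv j m' →
      Runs H c m' T (Inv (j + 1))) :
    Runs H (forLoop i v c) m (N * (T + 2) + 2) (fun m' => Inv N m' ∧ m' i 0 = (N : ℤ)) := by
  refine Runs.bdd fun hm => ?_
  -- The loop bound is itself stored in a bounded array, which bounds all values of the counter.
  have hNH : (N : ℤ) ≤ H := by have := hm v hi.2.2.1 0; rw [hN] at this; exact (le_abs_self _).trans this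
  have hlow : (V v - V i).low = true := low_sub (low_V hi.2.2.1) (low_V hi.1)
  let J : ℕ → Memory → Prop := fun j m' =>
    (∀ a, a ≠ i → a ∉ c.writes → m' a = m a) ∧ m' i 0 = (j : ℤ) ∧ Inv j m'
  have key : Runs H (.while (V v - V i) (.seq c (.write i 0 (V i + 1)))) (m.set i 0 0)
      (N * (T + 1 + 1) + 1) (J N) := by
    refine Runs.while_ (Inv := J) hlow N ?_ ?_ ?_ ?_
    · rintro j hj m' ⟨h1, h2, -⟩
      simp only [eval_sub, eval_V, h2, h1 v hi.2.2.2.2 hi.2.2.2.1, hN]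
      omega
    · rintro j hj m' ⟨h1, h2, h3⟩
      refine Runs.seq ((hstep j hj m' h1 h2 h3).frame.mono le_rfl ?_)
      rintro m1 hb ⟨h4, h5⟩
      have e1 : m1 i 0 = j := by rw [h5 i hi.2.1, h2]
      refine Runs.write rfl (low_add (low_V hi.1) rfl) ?_ ⟨?_, ?_, ?_⟩
      · intro _
        simp only [eval_add, eval_V, eval_one, e1]
        rw [abs_of_nonneg (by positivity)]
        exact le_trans (by exact_mod_cast hj) hNH
      · intro a ha ha'
        rw [Memory.set_ne _ ha, h5 a ha', h1 a ha ha']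
      · simp [e1]
      · simp only [eval_zero]; exact hset _ _ _ h4
    · rintro m' ⟨h1, h2, -⟩
      simp only [eval_sub, eval_V, h2, h1 v hi.2.2.2.2 hi.2.2.2.1, hN]
      omega
    · refine ⟨fun a ha _ => Memory.set_ne _ ha _ _, by simp, hset _ _ _ h0⟩
  refine (Runs.seq (T := 1) (Runs.write rfl rfl (by simp) (by simpa only [eval_zero, Int.toNat_zero] using key))).mono (by ring_nf; omega) ?_
  rintro m' - ⟨-, h2, h3⟩
  exact ⟨h3, h2⟩

/-! ### Determinism -/

/-- Needed for standard soundness: `Outputs` asserts the existence of a run, so ruling out an output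
requires uniqueness of runs. -/
theorem Exec.det {c : Prog} {s s₁ s₂ : State} {t₁ t₂ : ℕ} (h₁ : Exec c s s₁ t₁)
    (h₂ : Exec c s s₂ t₂) : s₁ = s₂ ∧ t₁ = t₂ := by
  induction h₁ generalizing s₂ t₂ with
  | skip => cases h₂; exact ⟨rfl, rfl⟩
  | write => cases h₂; exact ⟨rfl, rfl⟩
  | flip => cases h₂; exact ⟨rfl, rfl⟩
  | seq _ _ ih1 ih2 =>
    cases h₂ with
    | seq h3 h4 =>
      obtain ⟨rfl, rfl⟩ := ih1 h3
      obtain ⟨rfl, rfl⟩ := ih2 h4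
      exact ⟨rfl, rfl⟩
  | ite_pos he _ ih =>
    cases h₂ with
    | ite_pos _ h3 => obtain ⟨rfl, rfl⟩ := ih h3; exact ⟨rfl, rfl⟩
    | ite_neg h' _ => exact absurd he h'
  | ite_neg he _ ih =>
    cases h₂ with
    | ite_neg _ h3 => obtain ⟨rfl, rfl⟩ := ih h3; exact ⟨rfl, rfl⟩
    | ite_pos h' _ => exact absurd h' he
  | while_done he =>
    cases h₂ with
    | while_done _ => exact ⟨rfl, rfl⟩
    | while_step h' _ _ => exact absurd h' he
  | while_step he _ _ ih1 ih2 =>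
    cases h₂ with
    | while_done h' => exact absurd he h'
    | while_step _ h3 h4 =>
      obtain ⟨rfl, rfl⟩ := ih1 h3
      obtain ⟨rfl, rfl⟩ := ih2 h4
      exact ⟨rfl, rfl⟩

end PsdProof

namespace PsdProof

/-! ### Bit lengths against logarithms, row-major matrices, schoolbook multiplication. -/

theorem one_half_lt_log (n M : ℕ) : 1 / 2 < Real.log ((n : ℝ) + M + 2) := by
  have h1 : Real.log 2 ≤ Real.log ((n : ℝ) + M + 2) :=
    Real.log_le_log (by norm_num) (by have := n.cast_nonneg (α := ℝ); have := M.cast_nonneg (α := ℝ); linarith)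
  linarith [Real.log_two_gt_d9]

/-- From `2 ^ (size - 1) ≤ x` one gets `(size - 1) * log 2 ≤ c * log (n + M + 2)`. Since `log 2 > 1
/ 2`, dividing costs a factor `2`, and the additive constant `2` is at most four times the
logarithm. -/
theorem size_le_log {x c n M : ℕ} (h : x ≤ (n + M + 2) ^ c) :
    (x.size : ℝ) + 1 ≤ (2 * c + 4) * Real.log ((n : ℝ) + M + 2) := by
  have hL := one_half_lt_log n M
  rcases Nat.eq_zero_or_pos x with rfl | hx
  · simp only [Nat.size_zero, Nat.cast_zero]
    nlinarith [c.cast_nonneg (α := ℝ)]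
  have hs : 0 < x.size := Nat.size_pos.2 hx
  have h1 : 2 ^ (x.size - 1) ≤ x := Nat.lt_size.1 (by omega)
  have h2 : ((2 : ℝ) ^ (x.size - 1)) ≤ ((n : ℝ) + M + 2) ^ c := by exact_mod_cast h1.trans h
  have h3 := Real.log_le_log (by positivity) h2
  rw [Real.log_pow, Real.log_pow] at h3
  rw [Nat.cast_sub hs, Nat.cast_one] at h3
  have hs' : (1 : ℝ) ≤ x.size := by exact_mod_cast hs
  nlinarith [Real.log_two_gt_d9]

theorem rowMajor_apply {n : ℕ} (A : Matrix (Fin n) (Fin n) ℤ) (i j : Fin n) :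
    rowMajor A ((i : ℕ) * n + j) = A i j := by
  have h : (finProdFinEquiv (i, j) : ℕ) = (i : ℕ) * n + j := by
    simp [finProdFinEquiv, mul_comm, add_comm]
  have h' : (i : ℕ) * n + j < n * n := h ▸ (finProdFinEquiv (i, j)).2
  rw [rowMajor, dif_pos h']
  have : (⟨(i : ℕ) * n + j, h'⟩ : Fin (n * n)) = finProdFinEquiv (i, j) := Fin.ext h.symm
  rw [this]
  simp

theorem rowMajor_of_le {n : ℕ} (A : Matrix (Fin n) (Fin n) ℤ) {p : ℕ} (h : n * n ≤ p) :
    rowMajor A p = 0 := dif_neg (by omega)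

theorem abs_rowMajor_le {n M : ℕ} {A : Matrix (Fin n) (Fin n) ℤ} (h : ∀ i j, (A i j).natAbs ≤ M)
    (p : ℕ) : |rowMajor A p| ≤ M := by
  unfold rowMajor
  split_ifs with h'
  · rw [Int.abs_eq_natAbs]; exact_mod_cast h _ _
  · simp

theorem mul_apply_eq_sum_rowMajor {n : ℕ} (A B : Matrix (Fin n) (Fin n) ℤ) (i j : Fin n) :
    (A * B) i j =
      ∑ b ∈ Finset.range n, rowMajor A ((i : ℕ) * n + b) * rowMajor B (b * n + j) := by
  rw [Matrix.mul_apply, Finset.sum_range]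
  exact Finset.sum_congr rfl fun b _ => by rw [rowMajor_apply, rowMajor_apply]

/-- Summation over the multiples of a block: the indices `T < n * N` with `T / n = p`. -/
theorem sum_range_div_eq {n N p : ℕ} (hp : p < N) (f : ℕ → ℤ) :
    (∑ T ∈ Finset.range (N * n), if T / n = p then f T else 0) =
      ∑ b ∈ Finset.range n, f (p * n + b) := by
  rw [← Finset.sum_filter]
  symm
  refine Finset.sum_bij (fun b _ => p * n + b) ?_ ?_ ?_ ?_
  · intro b hb
    rw [Finset.mem_range] at hb
    have h0 : 0 < n := by omega
    rw [Finset.mem_filter, Finset.mem_range]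
    constructor
    · calc p * n + b < p * n + n := by omega
        _ = (p + 1) * n := by ring
        _ ≤ N * n := Nat.mul_le_mul_right _ hp
    · rw [mul_comm, Nat.mul_add_div h0, Nat.div_eq_of_lt hb, add_zero]
  · intro b _ b' _ h; simpa using h
  · intro T hT
    rw [Finset.mem_filter, Finset.mem_range] at hT
    have h0 : 0 < n := Nat.pos_of_ne_zero (by rintro rfl; simp at hT)
    exact ⟨T % n, Finset.mem_range.2 (Nat.mod_lt _ h0), by
      rw [← hT.2, mul_comm]; exact Nat.div_add_mod T n⟩
  · intros; rfl

theorem mul_add_div_of_lt {n b : ℕ} (h : b < n) (a : ℕ) : (a * n + b) / n = a := by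
  rw [mul_comm, Nat.mul_add_div (by omega), Nat.div_eq_of_lt h, add_zero]

theorem mul_add_mod_of_lt {n b : ℕ} (h : b < n) (a : ℕ) : (a * n + b) % n = b := by
  rw [Nat.mul_add_mod', Nat.mod_eq_of_lt h]

theorem mul_add_lt {a b n N : ℕ} (ha : a < N) (hb : b < n) : a * n + b < N * n := by
  calc a * n + b < a * n + n := by omega
    _ = (a + 1) * n := by ring
    _ ≤ N * n := Nat.mul_le_mul_right _ ha

/-- Schoolbook matrix multiplication. -/
def naiveMatMul : Prog :=
  .seq (.write 10 0 (V 0 * V 0 * V 0))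
    (forLoop 11 10 (.write 3 (V 11 / V 0)
      (.read 3 (V 11 / V 0) + .read 1 (V 11 / V 0 / V 0 * V 0 + V 11 % V 0) *
        .read 2 (V 11 % V 0 * V 0 + V 11 / V 0 % V 0))))

/-- A single loop runs over the codes `T = (i * n + j) * n + b`, adding one product to the output
cell `T / n`. The fifth power covers both the loop bound `n ^ 3` and the partial sums, which are at
most `n ^ 3 * M ^ 2`. -/
theorem naiveMatMul_runs {n M : ℕ} (A B : Matrix (Fin n) (Fin n) ℤ)
    (hA : ∀ i j, (A i j).natAbs ≤ M) (hB : ∀ i j, (B i j).natAbs ≤ M) :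
    Runs ((n + M + 2) ^ 5) naiveMatMul (matMulInput A B) (1 + (n * n * n * 3 + 2))
      (fun m => ∀ i j : Fin n, m 3 ((i : ℕ) * n + j) = (A * B) i j) := by
  let f : ℕ → ℤ := fun T => rowMajor A (T / n / n * n + T % n) * rowMajor B (T % n * n + T / n % n)
  have hf : ∀ T, |f T| ≤ (M : ℤ) * M := fun T => by
    rw [abs_mul]
    exact mul_le_mul (abs_rowMajor_le hA _) (abs_rowMajor_le hB _) (abs_nonneg _) (by positivity)
  have hn3 : n * n * n ≤ (n + M + 2) ^ 5 := by
    calc n * n * n ≤ (n + M + 2) * (n + M + 2) * (n + M + 2) := by gcongr <;> omega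
      _ = (n + M + 2) ^ 3 := by ring
      _ ≤ _ := Nat.pow_le_pow_right (by omega) (by omega)
  have hb : n * n * n * (M * M) ≤ (n + M + 2) ^ 5 := by
    calc n * n * n * (M * M) ≤ (n + M + 2) * (n + M + 2) * (n + M + 2) * ((n + M + 2) * (n + M + 2)) := by
          gcongr <;> omega
      _ = _ := by ring
  refine Runs.seq (Runs.write rfl rfl ?_ ?_)
  · intro _
    have : ((n : ℤ) * n * n) ≤ ((n + M + 2) ^ 5 : ℕ) := by exact_mod_cast hn3
    simpa [matMulInput, scalar, abs_of_nonneg (show (0 : ℤ) ≤ (n : ℤ) * n * n by positivity)]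
      using this
  · refine (Runs.forLoop (N := n * n * n) (T := 1) (fun j m => ∀ p, m 3 p =
      ∑ T ∈ Finset.range j, if T / n = p then f T else 0) (by decide) (by
        simp [matMulInput, scalar]) ?_ ?_ ?_).mono le_rfl ?_
    · intro p; simp [Memory.set_apply, matMulInput]
    · intro j m' z h p; rw [Memory.set_ne _ (by decide)]; exact h p
    · intro j hj m' hfr hi h3
      have e0 : m' 0 0 = n := by rw [hfr 0 (by decide) (by decide)]; simp [Memory.set_apply, matMulInput, scalar]
      have e1 : m' 1 = rowMajor A := by
        rw [hfr 1 (by decide) (by decide), Memory.set_ne _ (by decide)]; rfl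
      have e2 : m' 2 = rowMajor B := by
        rw [hfr 2 (by decide) (by decide), Memory.set_ne _ (by decide)]; rfl
      have ev : ∀ p, p = j / n → m' 3 p + f j = ∑ T ∈ Finset.range (j + 1), if T / n = p then f T else 0 := by
        rintro p rfl
        rw [Finset.sum_range_succ, if_pos rfl, h3]
      have hval : (Expr.read 3 (V 11 / V 0) + .read 1 (V 11 / V 0 / V 0 * V 0 + V 11 % V 0) *
        .read 2 (V 11 % V 0 * V 0 + V 11 / V 0 % V 0) : Expr).eval m' = m' 3 (j / n) + f j := by
        simp only [eval_add, eval_mul, eval_read, eval_div, eval_mod, eval_V, e0, e1, e2, hi]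
        norm_cast
      refine Runs.write rfl rfl ?_ ?_
      · intro _
        rw [hval, ev _ rfl]
        refine (Finset.abs_sum_le_sum_abs _ _).trans ?_
        refine (Finset.sum_le_card_nsmul _ _ ((M : ℤ) * M) ?_).trans ?_
        · intro T _
          split_ifs
          · exact hf T
          · simp; positivity
        · rw [Finset.card_range, nsmul_eq_mul]
          have : (j + 1) * (M * M) ≤ (n + M + 2) ^ 5 := (Nat.mul_le_mul_right _ hj).trans hb
          exact_mod_cast this
      · have hadd : ((V 11 / V 0 : Expr).eval m').toNat = j / n := by
          simp only [eval_div, eval_V, e0, hi]; norm_cast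
        intro p
        rw [hval, hadd, Memory.set_apply]
        split_ifs with h
        · rw [h.2]; exact ev _ rfl
        · rw [Finset.sum_range_succ, if_neg (fun h' => h ⟨rfl, h'.symm⟩), add_zero]; exact h3 p
    · rintro m' - ⟨h3, -⟩ i j
      rw [h3, mul_apply_eq_sum_rowMajor]
      rw [sum_range_div_eq (mul_add_lt i.2 j.2)]
      refine Finset.sum_congr rfl fun b hb => ?_
      rw [Finset.mem_range] at hb
      simp only [f, mul_add_div_of_lt hb, mul_add_mod_of_lt hb, mul_add_div_of_lt j.2,
        mul_add_mod_of_lt j.2]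

/-- Makes the set that defines `omega` nonempty, without which its infimum would be a default value.
-/
theorem matMulInTime_three : MatMulInTime 3 := by
  refine ⟨naiveMatMul, 3 * naiveMatMul.wt * 14, 1, by simp [naiveMatMul, forLoop, Prog.Deterministic],
    fun n M A B hA hB => ?_⟩
  have hbdd : Bdd ((n + M + 2) ^ 5) (matMulInput A B) := by
    have h1 : n + M + 2 ≤ (n + M + 2) ^ 5 := Nat.le_self_pow (by norm_num) _
    have hM : (M : ℤ) ≤ ((n + M + 2) ^ 5 : ℕ) := by exact_mod_cast (by omega : M ≤ n + M + 2).trans h1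
    have hn : (n : ℤ) ≤ ((n + M + 2) ^ 5 : ℕ) := by exact_mod_cast (by omega : n ≤ n + M + 2).trans h1
    intro a _ p
    match a with
    | 0 =>
      simp only [matMulInput, scalar]
      split_ifs
      · rw [abs_of_nonneg (by positivity)]; exact hn
      · simp; positivity
    | 1 => exact (abs_rowMajor_le hA p).trans hM
    | 2 => exact (abs_rowMajor_le hB p).trans hM
    | a + 3 => simp [matMulInput]; positivity
  obtain ⟨m', t, h1, h2, -, h3⟩ := naiveMatMul_runs A B hA hB hbdd fun _ => false
  refine ⟨_, t, h1, ?_, fun i j => ?_⟩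
  · have hs := size_le_log (x := (n + M + 2) ^ 5) (c := 5) le_rfl
    have hL := one_half_lt_log n M
    unfold softBound
    have e : (3 : ℝ) = (3 : ℕ) := by norm_num
    rw [pow_one, e, Real.rpow_natCast, ← e]
    have h2' : (t : ℝ) ≤ (1 + (n * n * n * 3 + 2)) * (naiveMatMul.wt * ((((n + M + 2) ^ 5 : ℕ).size : ℝ) + 1)) := by
      exact_mod_cast h2
    have hn : (1 + ((n : ℝ) * n * n * 3 + 2)) ≤ 3 * ((n : ℝ) + 1) ^ 3 := by
      nlinarith [n.cast_nonneg (α := ℝ), sq_nonneg (n : ℝ)]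
    calc (t : ℝ) ≤ _ := h2'
      _ ≤ (3 * ((n : ℝ) + 1) ^ 3) * (naiveMatMul.wt * ((2 * (5 : ℕ) + 4) * Real.log ((n : ℝ) + M + 2))) := by
        gcongr
      _ = _ := by push_cast; ring
  · rw [← h3]
    simp [finProdFinEquiv, mul_comm, add_comm]

end PsdProof

namespace PsdProof

/-! ### The exponent of matrix multiplication lies between two and three -/

/-- A write changes one cell and costs at least one, so time bounds the number of changed cells. -/
theorem Exec.changed_cells {c : Prog} {s s' : State} {t : ℕ} (h : Exec c s s' t) (a : ℕ) :
    ∃ F : Finset ℕ, F.card ≤ t ∧ ∀ p ∉ F, s'.mem a p = s.mem a p := by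
  induction h with
  | skip s => exact ⟨∅, by simp, by simp⟩
  | write b i e s =>
    refine ⟨{(i.eval s.mem).toNat}, by simp, fun p hp => ?_⟩
    rw [Finset.mem_singleton] at hp
    simp only [Memory.set_apply]
    rw [if_neg (fun h => hp h.2)]
  | flip b i s =>
    refine ⟨{(i.eval s.mem).toNat}, by simp, fun p hp => ?_⟩
    rw [Finset.mem_singleton] at hp
    simp only [Memory.set_apply]
    rw [if_neg (fun h => hp h.2)]
  | seq _ _ ih1 ih2 =>
    obtain ⟨F, h1, h2⟩ := ih1
    obtain ⟨G, h3, h4⟩ := ih2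
    refine ⟨F ∪ G, (Finset.card_union_le _ _).trans (by omega), fun p hp => ?_⟩
    rw [Finset.mem_union, not_or] at hp
    rw [h4 p hp.2, h2 p hp.1]
  | ite_pos _ _ ih => obtain ⟨F, h1, h2⟩ := ih; exact ⟨F, by omega, h2⟩
  | ite_neg _ _ ih => obtain ⟨F, h1, h2⟩ := ih; exact ⟨F, by omega, h2⟩
  | while_done _ => exact ⟨∅, by simp, by simp⟩
  | while_step _ _ _ ih1 ih2 =>
    obtain ⟨F, h1, h2⟩ := ih1
    obtain ⟨G, h3, h4⟩ := ih2
    refine ⟨F ∪ G, (Finset.card_union_le _ _).trans (by omega), fun p hp => ?_⟩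
    rw [Finset.mem_union, not_or] at hp
    rw [h4 p hp.2, h2 p hp.1]

theorem sq_le_of_matMulInTime {τ : ℝ} (h : MatMulInTime τ) :
    ∃ (C : ℝ) (k : ℕ), ∀ n : ℕ, (n : ℝ) ^ 2 ≤ softBound C k τ n 1 := by
  obtain ⟨c, C, k, -, h⟩ := h
  refine ⟨C, k, fun n => ?_⟩
  -- All entries of the square of the all-ones matrix are nonzero, whereas the output array is zero
  -- at the start. So all `n * n` output cells must be changed.
  let A : Matrix (Fin n) (Fin n) ℤ := Matrix.of fun _ _ => 1
  obtain ⟨s, t, h1, h2, h3⟩ := h n 1 A A (by simp [A]) (by simp [A])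
  refine le_trans ?_ h2
  obtain ⟨F, h4, h5⟩ := h1.changed_cells 3
  have hsub : Finset.range (n * n) ⊆ F := by
    intro p hp
    rw [Finset.mem_range] at hp
    by_contra hpF
    have e1 := h5 p hpF
    have e2 := h3 (finProdFinEquiv.symm ⟨p, hp⟩).1 (finProdFinEquiv.symm ⟨p, hp⟩).2
    rw [Prod.mk.eta, Equiv.apply_symm_apply] at e2
    have hn : 0 < n := Nat.pos_of_ne_zero (by rintro rfl; simp at hp)
    simp only [matMulInput] at e1
    rw [e1, Matrix.mul_apply] at e2
    simp [A] at e2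
    omega
  have := Finset.card_le_card hsub
  rw [Finset.card_range] at this
  rw [sq]
  exact_mod_cast this.trans h4

theorem two_le_of_matMulInTime {τ : ℝ} (h : MatMulInTime τ) : 2 ≤ τ := by
  by_contra! hτ
  obtain ⟨C, k, h⟩ := sq_le_of_matMulInTime h
  -- A nonnegative exponent, so that the base `n + 1` may be enlarged to `n + 3`.
  set σ := max τ 0 with hσ
  have hσ2 : 0 < 2 - σ := by rcases max_cases τ 0 with h | h <;> linarith
  -- The constant `32` wins because `(n + 3) ^ 2 ≤ 16 * n ^ 2` for `n ≥ 1`: the outcome is `n ^ 2 ≤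
  -- n ^ 2 / 2`.
  have hlo := (isLittleO_log_rpow_rpow_atTop (k : ℝ) hσ2).bound
    (show (0 : ℝ) < 1 / (32 * (|C| + 1)) by positivity)
  obtain ⟨x₀, hx₀⟩ := Filter.eventually_atTop.1 hlo
  obtain ⟨n, hn⟩ := exists_nat_ge (max x₀ 1)
  have hn1 : (1 : ℝ) ≤ n := (le_max_right _ _).trans hn
  have hx := hx₀ ((n : ℝ) + 3) (by linarith [le_max_left x₀ 1])
  set x := (n : ℝ) + 3 with hxdef
  have hx3 : (3 : ℝ) ≤ x := by linarith
  have hlog : 0 ≤ Real.log x := Real.log_nonneg (by linarith)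
  have hlogk : 0 ≤ Real.log x ^ k := by positivity
  rw [Real.rpow_natCast, Real.norm_of_nonneg hlogk,
    Real.norm_of_nonneg (by positivity)] at hx
  have hb := h n
  have e1 : (n : ℝ) + (1 : ℕ) + 2 = x := by push_cast; ring
  unfold softBound at hb
  rw [e1] at hb
  have h1 : ((n : ℝ) + 1) ^ τ ≤ x ^ σ :=
    (Real.rpow_le_rpow_of_exponent_le (by linarith) (le_max_left _ _)).trans
      (Real.rpow_le_rpow (by linarith) (by linarith) (le_max_right _ _))
  have h2 : C * ((n : ℝ) + 1) ^ τ * Real.log x ^ k ≤ (|C| + 1) * x ^ σ * Real.log x ^ k := by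
    have : C ≤ |C| + 1 := (le_abs_self C).trans (by linarith)
    gcongr
  have h3 : (|C| + 1) * x ^ σ * Real.log x ^ k ≤
      (|C| + 1) * x ^ σ * (1 / (32 * (|C| + 1)) * x ^ (2 - σ)) := by gcongr
  have h4 : (|C| + 1) * x ^ σ * (1 / (32 * (|C| + 1)) * x ^ (2 - σ)) = x ^ 2 / 32 := by
    have : x ^ σ * x ^ (2 - σ) = x ^ 2 := by
      rw [← Real.rpow_add (by linarith)]
      norm_num
    rw [← this]
    have : |C| + 1 ≠ 0 := by positivity
    field_simp
  nlinarith

/-- Guarantees `1 - ω / 3 ≤ 1 / 3`, on which the balance of exponents relies. -/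
theorem two_le_omega : 2 ≤ omega :=
  le_csInf ⟨3, matMulInTime_three⟩ fun _ h => two_le_of_matMulInTime h

/-- The infimum need not be attained, so the protocol works with an exponent slightly above it. -/
theorem exists_matMulInTime_lt {ε : ℝ} (hε : 0 < ε) : ∃ τ, MatMulInTime τ ∧ τ < omega + ε :=
  exists_lt_of_csInf_lt (s := {τ | MatMulInTime τ}) ⟨3, matMulInTime_three⟩
    (show sInf {τ | MatMulInTime τ} < omega + ε from lt_add_of_pos_right _ hε)

end PsdProof

namespace PsdProof

/-! ### Running a program many times on interleaved memories

The cell `p` of array `a` in run number `x` is kept in the cell `p * D + x` of array `a + 64`, where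
`D` is the value of variable `11` and `x` that of variable `13`. -/

theorem intCost_binOp_le (o : BinOp) (x y : ℤ) :
    intCost (o.eval x y) ≤ intCost x + intCost y := by
  have := size_eval_binOp_le o x y le_rfl le_rfl
  unfold intCost; omega

theorem one_le_intCost (z : ℤ) : 1 ≤ intCost z := Nat.le_add_left _ _

theorem Expr.intCost_eval_le (m : Memory) (e : Expr) : intCost (e.eval m) ≤ e.cost m := by
  cases e <;> simp [Expr.eval, Expr.cost]

/-- The maximum of `e` and `0`. -/
def Expr.pos (e : Expr) : Expr := e * (1 + e / (e * e + 1))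

-- Euclidean division of `v` by `v * v + 1` gives `0` for `v ≥ 0` and `-1` for `v < 0`. Addresses
-- must be truncated before they are scaled, because the machine reads negative addresses as `0`.
@[simp] theorem eval_pos (m : Memory) (e : Expr) : e.pos.eval m = max (e.eval m) 0 := by
  simp only [Expr.pos, eval_mul, eval_add, eval_div, eval_one]
  generalize e.eval m = v
  rcases le_or_gt 0 v with h | h
  · rw [Int.ediv_eq_zero_of_lt h (by nlinarith), max_eq_left h]; ring
  · have : v / (v * v + 1) = -1 := by
      rw [Int.ediv_eq_iff_of_pos (by nlinarith)]
      constructor <;> nlinarith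
    rw [this, max_eq_right h.le]; ring

/-- The address that corresponds to `e` in the current run. -/
def Expr.runAddr (e : Expr) : Expr := e.pos * V 11 + V 13

theorem eval_runAddr {m : Memory} {e : Expr} {D x : ℕ} (hD : m 11 0 = D) (hx : m 13 0 = x) :
    (e.runAddr.eval m).toNat = (e.eval m).toNat * D + x := by
  simp only [Expr.runAddr, eval_add, eval_mul, eval_pos, eval_V, hD, hx]
  rw [← Int.toNat_eq_max]
  norm_cast

theorem cost_runAddr_le {m : Memory} {e : Expr} {D x : ℕ} (hD : m 11 0 = D) (hx : m 13 0 = x) :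
    e.runAddr.cost m ≤ 52 * e.cost m + 5 * (intCost D + intCost x) := by
  have c0 : intCost 0 = 1 := by decide
  have c1 : intCost 1 = 2 := by decide
  set v := e.eval m with hv
  have h0 : intCost v ≤ e.cost m := e.intCost_eval_le m
  have h1 := intCost_binOp_le .mul v v
  have h2 := intCost_binOp_le .add (v * v) 1
  have h3 := intCost_binOp_le .div v (v * v + 1)
  have h4 := intCost_binOp_le .add 1 (v / (v * v + 1))
  have h5 := intCost_binOp_le .mul v (1 + v / (v * v + 1))
  have h6 := intCost_binOp_le .mul (v * (1 + v / (v * v + 1))) D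
  have h7 := intCost_binOp_le .add (v * (1 + v / (v * v + 1)) * D) x
  simp only [BinOp.eval] at h1 h2 h3 h4 h5 h6 h7
  have hcost : e.runAddr.cost m = e.cost m + (2 + (e.cost m + (e.cost m + e.cost m + intCost (v * v) +
      2 + intCost (v * v + 1)) + intCost (v / (v * v + 1))) + intCost (1 + v / (v * v + 1))) +
      intCost (v * (1 + v / (v * v + 1))) + (1 + intCost D) +
      intCost (v * (1 + v / (v * v + 1)) * D) + (1 + intCost x) +
      intCost (v * (1 + v / (v * v + 1)) * D + x) := by
    rw [← hD, ← hx, ← c1, ← c0]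
    rfl
  have := one_le_intCost v
  have := one_le_intCost D
  have := one_le_intCost x
  omega

def Expr.lift : Expr → Expr
  | .const z => .const z
  | .read a e => .read (a + 64) e.lift.runAddr
  | .bin o e f => .bin o e.lift f.lift

/-- The clause for `flip` is a placeholder: the simulation is only claimed for deterministic
programs. -/
def Prog.lift : Prog → Prog
  | .skip => .skip
  | .write a i e => .write (a + 64) i.lift.runAddr e.lift
  | .flip a i => .flip a i
  | .seq c d => .seq c.lift d.lift
  | .ite e c d => .ite e.lift c.lift d.lift
  | .while e c => .while e.lift c.lift

/-- The cost of `e.lift` relative to that of `e`. -/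
def Expr.overhead : Expr → ℕ
  | .const _ => 1
  | .read _ e => 52 * e.overhead + 6
  | .bin _ e f => e.overhead + f.overhead + 1

/-- The cost of `c.lift` relative to that of `c`. -/
def Prog.overhead : Prog → ℕ
  | .skip => 1
  | .write _ i e => 52 * i.overhead + 6 + e.overhead
  | .flip _ _ => 1
  | .seq c d => c.overhead + d.overhead
  | .ite e c d => e.overhead + 1 + c.overhead + d.overhead
  | .while e c => e.overhead + 1 + c.overhead

/-- `m'` represents the memory `m` of run `x`. -/
structure Sim (D x : ℕ) (m m' : Memory) : Prop where
  stride : m' 11 0 = D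
  run : m' 13 0 = x
  cell : ∀ a p, m' (a + 64) (p * D + x) = m a p

section
variable {D x : ℕ} {m m' : Memory}

theorem Sim.eval (h : Sim D x m m') : ∀ e : Expr, e.lift.eval m' = e.eval m
  | .const _ => rfl
  | .read a e => by
    simp only [Expr.lift, eval_read, eval_runAddr h.stride h.run, h.eval e, h.cell]
  | .bin o e f => by simp only [Expr.lift, Expr.eval, h.eval e, h.eval f]

theorem Expr.one_le_cost (m : Memory) (e : Expr) : 1 ≤ e.cost m :=
  (one_le_intCost _).trans (e.intCost_eval_le m)

/-- An address grows only by the bit lengths of the stride and of the run number. For a fixed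
expression the overhead is therefore logarithmic in `D`. -/
theorem Sim.cost (h : Sim D x m m') :
    ∀ e : Expr, e.lift.cost m' ≤ e.overhead * (intCost D + intCost x) * e.cost m
  | .const z => by
    have := one_le_intCost D
    simp only [Expr.lift, Expr.cost, Expr.overhead]
    exact Nat.le_mul_of_pos_left _ (by omega)
  | .read a e => by
    have h1 := h.cost e
    have h2 := cost_runAddr_le (e := e.lift) h.stride h.run
    have h3 := e.one_le_cost m
    simp only [Expr.lift, Expr.cost, Expr.overhead, eval_runAddr h.stride h.run, h.eval e, h.cell]
    set E := intCost D + intCost x with hE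
    have hE1 : 1 ≤ E := by have := one_le_intCost D; omega
    have h5 : intCost (m a (e.eval m).toNat) ≤ E * intCost (m a (e.eval m).toNat) :=
      Nat.le_mul_of_pos_left _ hE1
    have h6 : E ≤ E * e.cost m := Nat.le_mul_of_pos_right _ h3
    nlinarith [Nat.zero_le (e.overhead * E * intCost (m a (e.eval m).toNat)),
      Nat.zero_le (E * e.cost m)]
  | .bin o e f => by
    have h1 := h.cost e
    have h2 := h.cost f
    have h3 := one_le_intCost D
    simp only [Expr.lift, Expr.cost, Expr.overhead, h.eval e, h.eval f]
    set E := intCost D + intCost x with hE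
    set z := intCost (o.eval (e.eval m) (f.eval m))
    have h4 : z ≤ E * z := Nat.le_mul_of_pos_left _ (by omega)
    nlinarith [Nat.zero_le (e.overhead * E * f.cost m), Nat.zero_le (f.overhead * E * e.cost m),
      Nat.zero_le (E * e.cost m), Nat.zero_le (E * f.cost m),
      Nat.zero_le (e.overhead * E * z), Nat.zero_le (f.overhead * E * z)]

end

theorem mul_add_eq_iff {D x p p' : ℕ} (hD : x < D) : p * D + x = p' * D + x ↔ p = p' := by
  constructor
  · intro h
    exact Nat.eq_of_mul_eq_mul_right (by omega) (Nat.add_right_cancel h)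
  · rintro rfl; rfl

theorem Sim.set {D x : ℕ} {m m' : Memory} (hx : x < D) (h : Sim D x m m') (a p : ℕ) (z : ℤ) :
    Sim D x (m.set a p z) (m'.set (a + 64) (p * D + x) z) := by
  refine ⟨?_, ?_, fun b q => ?_⟩
  · rw [Memory.set_ne _ (by omega)]; exact h.stride
  · rw [Memory.set_ne _ (by omega)]; exact h.run
  · simp only [Memory.set_apply, mul_add_eq_iff hx, add_left_inj, h.cell]

/-- The cells that belong neither to the first `64` arrays nor to run `x` are those of `m`. -/
def SameOutside (D x : ℕ) (m m' : Memory) : Prop :=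
  (∀ a < 64, m' a = m a) ∧ ∀ a p, p % D ≠ x → m' a p = m a p

theorem SameOutside.trans {D x : ℕ} {m₁ m₂ m₃ : Memory} (h : SameOutside D x m₁ m₂)
    (h' : SameOutside D x m₂ m₃) : SameOutside D x m₁ m₃ :=
  ⟨fun a ha => (h'.1 a ha).trans (h.1 a ha), fun a p hp => (h'.2 a p hp).trans (h.2 a p hp)⟩

/-- A step-by-step simulation. The last conjunct says that cells of other residues modulo `D` are
untouched, so many runs can share the arrays one after the other with no clearing in between and no
knowledge of how much memory a run uses. -/
theorem Exec.lift {D x : ℕ} (hx : x < D) {c : Prog} {s s' : State} {t : ℕ} (h : Exec c s s' t)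
    (hc : c.Deterministic) (m : Memory) (r : ℕ → Bool) (hm : Sim D x s.mem m) :
    ∃ (m' : Memory) (t' : ℕ), Exec c.lift ⟨m, r⟩ ⟨m', r⟩ t' ∧
      t' ≤ c.overhead * (intCost D + intCost x) * t ∧ Sim D x s'.mem m' ∧ SameOutside D x m m' := by
  have hE1 : 1 ≤ intCost D + intCost x := by have := one_le_intCost D; omega
  generalize hE : intCost D + intCost x = E at hE1
  induction h generalizing m with
  | skip s =>
    exact ⟨m, 1, .skip _, by simpa [Prog.overhead] using hE1, hm, fun _ _ => rfl, fun _ _ _ => rfl⟩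
  | write a i e s =>
    refine ⟨_, _, .write _ _ _ _, ?_, ?_, ?_, ?_⟩
    · have h1 := hm.cost e
      have h2 := hm.cost i
      have h3 := cost_runAddr_le (e := i.lift) hm.stride hm.run
      rw [hE] at h1 h2 h3
      have h4 : E ≤ E * i.cost s.mem := Nat.le_mul_of_pos_right _ (i.one_le_cost _)
      simp only [Prog.overhead]
      nlinarith [Nat.zero_le (i.overhead * E * e.cost s.mem), Nat.zero_le (e.overhead * E * i.cost s.mem),
        Nat.zero_le (i.overhead * E), Nat.zero_le (e.overhead * E), Nat.zero_le (E * e.cost s.mem)]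
    · rw [hm.eval, eval_runAddr hm.stride hm.run, hm.eval]
      exact hm.set hx _ _ _
    · exact fun b hb => Memory.set_ne _ (by omega) _ _
    · intro b p hp
      rw [eval_runAddr hm.stride hm.run, Memory.set_apply, if_neg]
      rintro ⟨-, rfl⟩
      -- The written cell has residue `x` modulo the stride.
      exact hp (by rw [mul_add_mod_of_lt hx])
  | flip a i s => exact hc.elim
  | seq _ _ ih1 ih2 =>
    obtain ⟨m1, t1, h1, h2, h3, h4⟩ := ih1 hc.1 m hm
    obtain ⟨m2, t2, h5, h6, h7, h8⟩ := ih2 hc.2 m1 h3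
    refine ⟨m2, _, .seq h1 h5, ?_, h7, h4.trans h8⟩
    simp only [Prog.overhead]
    refine (add_le_add h2 h6).trans ?_
    rw [mul_add]
    gcongr <;> omega
  | @ite_pos e c₁ c₂ s _ t he _ ih =>
    obtain ⟨m1, t1, h1, h2, h3, h4⟩ := ih hc.1 m hm
    refine ⟨m1, _, .ite_pos (by rw [hm.eval]; exact he) h1, ?_, h3, h4⟩
    have h5 := hm.cost e
    rw [hE] at h5
    have h6 := e.one_le_cost s.mem
    simp only [Prog.overhead]
    nlinarith [Nat.zero_le (e.overhead * E * t), Nat.zero_le (e.overhead * E), Nat.zero_le (E * t),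
      Nat.zero_le (c₁.overhead * E * (e.cost s.mem + 1)), Nat.zero_le (E * e.cost s.mem),
      Nat.zero_le (c₂.overhead * E * (e.cost s.mem + 1 + t))]
  | @ite_neg e c₁ c₂ s _ t he _ ih =>
    obtain ⟨m1, t1, h1, h2, h3, h4⟩ := ih hc.2 m hm
    refine ⟨m1, _, .ite_neg (by rw [hm.eval]; exact he) h1, ?_, h3, h4⟩
    have h5 := hm.cost e
    rw [hE] at h5
    have h6 := e.one_le_cost s.mem
    simp only [Prog.overhead]
    nlinarith [Nat.zero_le (e.overhead * E * t), Nat.zero_le (e.overhead * E), Nat.zero_le (E * t),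
      Nat.zero_le (c₂.overhead * E * (e.cost s.mem + 1)), Nat.zero_le (E * e.cost s.mem),
      Nat.zero_le (c₁.overhead * E * (e.cost s.mem + 1 + t))]
  | @while_done e c s he =>
    refine ⟨m, _, .while_done (by rw [hm.eval]; exact he), ?_, hm, fun _ _ => rfl, fun _ _ _ => rfl⟩
    have h5 := hm.cost e
    rw [hE] at h5
    simp only [Prog.overhead]
    nlinarith [Nat.zero_le (c.overhead * E * (e.cost s.mem + 1)), Nat.zero_le (e.overhead * E),
      Nat.zero_le (E * e.cost s.mem)]
  | @while_step e c s _ _ t₁ t₂ he _ _ ih1 ih2 =>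
    obtain ⟨m1, t1, h1, h2, h3, h4⟩ := ih1 hc m hm
    obtain ⟨m2, t2, h5, h6, h7, h8⟩ := ih2 hc m1 h3
    refine ⟨m2, _, .while_step (by rw [hm.eval]; exact he) h1 h5, ?_, h7, h4.trans h8⟩
    have h9 := hm.cost e
    rw [hE] at h9
    simp only [Prog.overhead] at h6 ⊢
    nlinarith [Nat.zero_le (e.overhead * E * t₁), Nat.zero_le (e.overhead * E), Nat.zero_le (E * t₁),
      Nat.zero_le (c.overhead * E * (e.cost s.mem + 1)), Nat.zero_le (E * e.cost s.mem)]

end PsdProof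

noncomputable section

namespace PsdProof

/-! ### Triples of vertices

The triple `(a, b, c)` of vertices is coded by the number `(a * n + b) * n + c`. -/

namespace WeightedGraph
variable (x : WeightedGraph)

def A : ℕ → ℤ := rowMajor x.adjMatrix
def W : ℕ → ℤ := rowMajor x.weightMatrix

/-- `1` if the triple is a triangle, and else `0`. -/
def tri (T : ℕ) : ℤ :=
  x.A (T / x.n / x.n * x.n + T / x.n % x.n) * x.A (T / x.n / x.n * x.n + T % x.n) *
    x.A (T / x.n % x.n * x.n + T % x.n)

/-- The weight of a triple. -/
def wt (T : ℕ) : ℤ :=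
  x.W (T / x.n / x.n * x.n + T / x.n % x.n) + x.W (T / x.n / x.n * x.n + T % x.n) +
    x.W (T / x.n % x.n * x.n + T % x.n)

/-- The triple is a triangle of weight `0`. -/
def Zero (T : ℕ) : Prop := x.tri T = 1 ∧ x.wt T = 0

/-- The triple is a triangle whose weight is divisible by `P`. -/
def ZeroMod (P T : ℕ) : Prop := x.tri T = 1 ∧ (P : ℤ) ∣ x.wt T

theorem A_eq (p : ℕ) : x.A p = 0 ∨ x.A p = 1 := by
  unfold A rowMajor
  split_ifs with h
  · simp only [adjMatrix, Matrix.of_apply]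
    split_ifs <;> simp
  · simp

theorem tri_eq (T : ℕ) : x.tri T = 0 ∨ x.tri T = 1 := by
  unfold tri
  rcases x.A_eq (T / x.n / x.n * x.n + T / x.n % x.n) with h | h <;>
  rcases x.A_eq (T / x.n / x.n * x.n + T % x.n) with h' | h' <;>
  rcases x.A_eq (T / x.n % x.n * x.n + T % x.n) with h'' | h'' <;> simp [h, h', h'']

/-- The squares of the weights, summed up (with a shift). -/
def sumSq : ℕ := x.n + 2 + ∑ p ∈ Finset.range (x.n * x.n), (x.W p).natAbs ^ 2

/-- The length of the input data, up to a constant factor. -/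
def len : ℕ := x.sumSq.size

theorem two_le_len : 2 ≤ x.len :=
  Nat.lt_size.2 (by unfold sumSq; omega)

theorem sumSq_lt : x.sumSq < 2 ^ x.len := Nat.lt_size_self _

theorem n_lt : x.n < 2 ^ x.len := lt_of_le_of_lt (by unfold sumSq; omega) x.sumSq_lt

theorem abs_W_le_sumSq (p : ℕ) : |x.W p| ≤ x.sumSq := by
  by_cases hp : p < x.n * x.n
  · have h1 : (x.W p).natAbs ^ 2 ≤ ∑ p ∈ Finset.range (x.n * x.n), (x.W p).natAbs ^ 2 :=
      Finset.single_le_sum (f := fun p => (x.W p).natAbs ^ 2) (fun _ _ => Nat.zero_le _)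
        (Finset.mem_range.2 hp)
    have h2 : (x.W p).natAbs ≤ (x.W p).natAbs ^ 2 := Nat.le_self_pow (by norm_num) _
    rw [Int.abs_eq_natAbs]
    have h3 : (x.W p).natAbs ≤ x.sumSq := by unfold sumSq; omega
    exact_mod_cast h3
  · have : x.W p = 0 := rowMajor_of_le _ (by omega)
    rw [this]; simp

theorem abs_A_le (p : ℕ) : |x.A p| ≤ 1 := by rcases x.A_eq p with h | h <;> simp [h]

end WeightedGraph

/-! ### The size parameters of an instance. -/

/-- The constants that the programs depend on. -/
structure Params where
  C : ℕ
  g : ℕ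
  r : ℕ
  s : ℕ
  s_pos : 0 < s
  r_le : r ≤ s
  C_pos : 0 < C

section params
variable (π : Params) (x : WeightedGraph)

/-- The bound for the factors of the modulus. -/
def Params.B : ℕ := π.C * x.len ^ (2 * π.g)

/-- The modulus bound is the least power of two above `n ^ (r / s)`. The exponent is rational so
that the comparison involves integer powers only and can be made by the machine. -/
theorem Params.exists_k : ∃ j, x.n ^ π.r < (2 ^ j) ^ π.s := by
  refine ⟨x.len, ?_⟩
  calc x.n ^ π.r ≤ (x.n + 1) ^ π.r := Nat.pow_le_pow_left (by omega) _
    _ ≤ (x.n + 1) ^ π.s := Nat.pow_le_pow_right (by omega) π.r_le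
    _ ≤ x.sumSq ^ π.s := Nat.pow_le_pow_left (by unfold WeightedGraph.sumSq; omega) _
    _ < _ := Nat.pow_lt_pow_left x.sumSq_lt π.s_pos.ne'

/-- The number of binary digits of the residues. -/
def Params.k : ℕ := Nat.find (π.exists_k x)
/-- The bound for the modulus. -/
def Params.Q : ℕ := 2 ^ π.k x
/-- The number of matrix products. -/
def Params.D : ℕ := 3 ^ π.k x
/-- A bound for the numbers that occur. -/
def Params.H : ℕ := 2 ^ ((π.C + 2 * π.g + 30) * x.len)

theorem Params.k_spec : x.n ^ π.r < π.Q x ^ π.s := Nat.find_spec (π.exists_k x)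

/-- Minimality, used for the upper bound on `Q` within a factor `2`. -/
theorem Params.lt_k {j : ℕ} (h : j < π.k x) : (2 ^ j) ^ π.s ≤ x.n ^ π.r :=
  not_lt.1 (Nat.find_min (π.exists_k x) h)

theorem Params.k_le : π.k x ≤ x.len := by
  refine Nat.find_min' _ ?_
  calc x.n ^ π.r ≤ (x.n + 1) ^ π.r := Nat.pow_le_pow_left (by omega) _
    _ ≤ (x.n + 1) ^ π.s := Nat.pow_le_pow_right (by omega) π.r_le
    _ ≤ x.sumSq ^ π.s := Nat.pow_le_pow_left (by unfold WeightedGraph.sumSq; omega) _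
    _ < _ := Nat.pow_lt_pow_left x.sumSq_lt π.s_pos.ne'

theorem Params.Q_le : π.Q x ≤ 2 ^ x.len := Nat.pow_le_pow_right (by norm_num) (π.k_le x)

theorem Params.Q_pos : 0 < π.Q x := by unfold Params.Q; positivity
theorem Params.D_pos : 0 < π.D x := by unfold Params.D; positivity

theorem Params.D_le : π.D x ≤ 2 ^ (2 * x.len) := by
  unfold Params.D
  calc 3 ^ π.k x ≤ 4 ^ π.k x := Nat.pow_le_pow_left (by norm_num) _
    _ = 2 ^ (2 * π.k x) := by rw [pow_mul]; norm_num
    _ ≤ _ := Nat.pow_le_pow_right (by norm_num) (Nat.mul_le_mul_left _ (π.k_le x))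

theorem Params.B_pos : 0 < π.B x := by
  have := x.two_le_len
  exact Nat.mul_pos π.C_pos (Nat.pow_pos (by omega))

theorem Params.B_le : π.B x ≤ 2 ^ ((π.C + 2 * π.g) * x.len) := by
  unfold Params.B
  rw [add_mul, pow_add]
  refine Nat.mul_le_mul ?_ ?_
  · exact Nat.lt_two_pow_self.le.trans (Nat.pow_le_pow_right (by norm_num)
      (Nat.le_mul_of_pos_right _ (by have := x.two_le_len; omega)))
  · exact (Nat.pow_le_pow_left Nat.lt_two_pow_self.le _).trans_eq
      (by rw [← pow_mul, mul_comm x.len])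

theorem Params.le_H {y a : ℕ} (h : y ≤ 2 ^ (a * x.len)) (ha : a ≤ 30) : y ≤ π.H x :=
  h.trans (Nat.pow_le_pow_right (by norm_num) (Nat.mul_le_mul_right _ (by omega)))

theorem Params.B_mul_le_H {y a : ℕ} (h : y ≤ 2 ^ (a * x.len)) (ha : a ≤ 30) : π.B x * y ≤ π.H x := by
  refine (Nat.mul_le_mul (π.B_le x) h).trans ?_
  rw [← pow_add, ← add_mul]
  exact Nat.pow_le_pow_right (by norm_num) (Nat.mul_le_mul_right _ (by omega))

theorem Params.size_H : (π.H x).size = (π.C + 2 * π.g + 30) * x.len + 1 := by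
  unfold Params.H
  exact Nat.size_pow

/-- `y` is at most the `a`-th power of the length bound. -/
def Small (x : WeightedGraph) (a y : ℕ) : Prop := y ≤ 2 ^ (a * x.len)

end params

/-! ### A calculus for showing that numbers fit below the bound `H`. -/

namespace Small
variable {x : WeightedGraph} {a b y z : ℕ}

theorem mul (hy : Small x a y) (hz : Small x b z) : Small x (a + b) (y * z) := by
  unfold Small
  rw [add_mul, pow_add]
  exact Nat.mul_le_mul hy hz

theorem mono (hy : Small x a y) (h : a ≤ b) : Small x b y :=
  hy.trans (Nat.pow_le_pow_right (by norm_num) (Nat.mul_le_mul_right _ h))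

theorem of_le (hy : Small x a y) (h : z ≤ y) : Small x a z := le_trans h hy

theorem add (hy : Small x a y) (hz : Small x a z) : Small x (a + 1) (y + z) := by
  unfold Small at *
  have h1 : 2 ≤ 2 ^ x.len := by
    calc 2 = 2 ^ 1 := rfl
      _ ≤ _ := Nat.pow_le_pow_right (by norm_num) (by have := x.two_le_len; omega)
  rw [add_mul, pow_add, one_mul]
  nlinarith

theorem lit {c : ℕ} (hc : c ≤ 4 := by norm_num) : Small x 1 c := by
  unfold Small
  calc c ≤ 2 ^ 2 := hc
    _ ≤ _ := Nat.pow_le_pow_right (by norm_num) (by have := x.two_le_len; omega)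

theorem n (x : WeightedGraph) : Small x 1 x.n := by
  have := x.n_lt; unfold Small; rw [one_mul]; omega

theorem len (x : WeightedGraph) : Small x 1 x.len := by
  unfold Small; rw [one_mul]; exact Nat.lt_two_pow_self.le

theorem n2 (x : WeightedGraph) : Small x 2 (x.n * x.n) := (n x).mul (n x)
theorem n3 (x : WeightedGraph) : Small x 3 (x.n * x.n * x.n) := (n2 x).mul (n x)

theorem Q (π : Params) (x : WeightedGraph) : Small x 1 (π.Q x) := by
  unfold Small; rw [one_mul]; exact π.Q_le x

theorem D (π : Params) (x : WeightedGraph) : Small x 2 (π.D x) := π.D_le x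

theorem le_H (π : Params) (h : Small x a y) (ha : a ≤ 30 := by norm_num) : y ≤ π.H x :=
  π.le_H x h ha

theorem abs_le_H (π : Params) (h : Small x a y) (ha : a ≤ 30 := by norm_num) :
    |(y : ℤ)| ≤ π.H x := by
  rw [Nat.abs_cast]; exact_mod_cast h.le_H π ha

end Small

/-! ### Expressions that test a triple -/

/-- The memory holds the graph. -/
structure Holds (x : WeightedGraph) (m : Memory) : Prop where
  n : m 3 0 = x.n
  A : m 4 = x.A
  W : m 5 = x.W

section
variable (t : Expr)

def triE : Expr :=
  .read 4 (t / V 3 / V 3 * V 3 + t / V 3 % V 3) * .read 4 (t / V 3 / V 3 * V 3 + t % V 3) *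
    .read 4 (t / V 3 % V 3 * V 3 + t % V 3)

def wtE : Expr :=
  .read 5 (t / V 3 / V 3 * V 3 + t / V 3 % V 3) + .read 5 (t / V 3 / V 3 * V 3 + t % V 3) +
    .read 5 (t / V 3 % V 3 * V 3 + t % V 3)

/-- Control flow tests positivity only. The triangle factor is `0` or `1`, and `1 - w * w` is
positive exactly when the integer `w` is `0`. Likewise `1 - w % P` is positive exactly when `P ∣ w`,
since Euclidean remainders are nonnegative. -/
def zeroE : Expr := triE t * (1 - wtE t * wtE t)

def zeroModE (P : Expr) : Expr := triE t * (1 - wtE t % P)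

/-- The additional factor `w * w` excludes the genuine triangles of weight zero. -/
def falseE (P : Expr) : Expr := triE t * (1 - wtE t % P) * (wtE t * wtE t)

variable {t} {x : WeightedGraph} {m : Memory} {T : ℕ}

theorem eval_triE (h : Holds x m) (ht : t.eval m = T) : (triE t).eval m = x.tri T := by
  simp only [triE, eval_mul, eval_read, eval_add, eval_div, eval_mod, eval_V, h.n, h.A, ht]
  norm_cast

theorem eval_wtE (h : Holds x m) (ht : t.eval m = T) : (wtE t).eval m = x.wt T := by
  simp only [wtE, eval_mul, eval_read, eval_add, eval_div, eval_mod, eval_V, h.n, h.W, ht]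
  norm_cast

theorem eval_zeroE (h : Holds x m) (ht : t.eval m = T) : 0 < (zeroE t).eval m ↔ x.Zero T := by
  simp only [zeroE, eval_mul, eval_sub, eval_one, eval_triE h ht, eval_wtE h ht,
    WeightedGraph.Zero]
  rcases x.tri_eq T with h1 | h1
  · simp [h1]
  · simp only [h1, one_mul, true_and]
    constructor
    · intro h2; by_contra h3
      have : 0 < x.wt T * x.wt T := mul_self_pos.2 h3
      omega
    · intro h2; simp [h2]

theorem eval_zeroModE (h : Holds x m) (ht : t.eval m = T) {P : Expr} {p : ℕ} (hp : P.eval m = p)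
    (hp0 : 0 < p) : 0 < (zeroModE t P).eval m ↔ x.ZeroMod p T := by
  simp only [zeroModE, eval_mul, eval_sub, eval_one, eval_mod, eval_triE h ht, eval_wtE h ht, hp,
    WeightedGraph.ZeroMod, Int.dvd_iff_emod_eq_zero]
  have h0 := Int.emod_nonneg (x.wt T) (b := (p : ℤ)) (by omega)
  rcases x.tri_eq T with h1 | h1
  · simp [h1]
  · simp only [h1, one_mul, true_and]
    omega

theorem eval_falseE (h : Holds x m) (ht : t.eval m = T) {P : Expr} {p : ℕ} (hp : P.eval m = p)
    (hp0 : 0 < p) : 0 < (falseE t P).eval m ↔ x.ZeroMod p T ∧ x.wt T ≠ 0 := by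
  have h2 := eval_zeroModE h ht hp hp0
  have h1 : (falseE t P).eval m = (zeroModE t P).eval m * (x.wt T * x.wt T) := by
    simp only [falseE, zeroModE, eval_mul, eval_wtE h ht]
  rw [h1, ← h2]
  rcases eq_or_ne (x.wt T) 0 with h3 | h3
  · simp [h3]
  · have : 0 < x.wt T * x.wt T := mul_self_pos.2 h3
    simp [h3, mul_pos_iff_of_pos_right this]

end

end PsdProof

end

noncomputable section

namespace PsdProof

local infixr:60 " ;; " => Prog.seq

theorem Holds.frame {x : WeightedGraph} {m m' : Memory} (h : Holds x m)
    (hm : ∀ a ∈ [3, 4, 5], m' a = m a) : Holds x m' :=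
  ⟨by rw [hm 3 (by decide), h.n], by rw [hm 4 (by decide), h.A], by rw [hm 5 (by decide), h.W]⟩

theorem Holds.set {x : WeightedGraph} {m : Memory} (h : Holds x m) {a : ℕ} (p : ℕ) (z : ℤ)
    (ha : ∀ b ∈ [3, 4, 5], b ≠ a) : Holds x (m.set a p z) :=
  h.frame fun b hb => Memory.set_ne _ (ha b hb) _ _

/-! ### The parameters of an instance -/

/-- The memory holds the graph and the parameters that the programs derive from it. -/
structure Setup (π : Params) (x : WeightedGraph) (m : Memory) : Prop extends Holds x m where
  len : m 7 0 = x.len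
  B : m 8 0 = π.B x
  Q : m 9 0 = π.Q x
  k : m 10 0 = π.k x
  D : m 11 0 = π.D x
  L : m 15 0 = (3 * x.len : ℕ)

/-- The arrays of the parameters. -/
def setupArrays : List ℕ := [3, 4, 5, 7, 8, 9, 10, 11, 15]

theorem Setup.frame {π : Params} {x : WeightedGraph} {m m' : Memory} (h : Setup π x m)
    (hm : ∀ a ∈ setupArrays, m' a = m a) : Setup π x m' where
  n := by rw [hm 3 (by decide), h.n]
  A := by rw [hm 4 (by decide), h.A]
  W := by rw [hm 5 (by decide), h.W]
  len := by rw [hm 7 (by decide), h.len]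
  B := by rw [hm 8 (by decide), h.B]
  Q := by rw [hm 9 (by decide), h.Q]
  k := by rw [hm 10 (by decide), h.k]
  D := by rw [hm 11 (by decide), h.D]
  L := by rw [hm 15 (by decide), h.L]

theorem Setup.set {π : Params} {x : WeightedGraph} {m : Memory} (h : Setup π x m) {a : ℕ} (p : ℕ)
    (z : ℤ) (ha : ∀ b ∈ setupArrays, b ≠ a) : Setup π x (m.set a p z) :=
  h.frame fun b hb => Memory.set_ne _ (ha b hb) _ _

/-- A sum of squares dominates every absolute weight and is computed without any comparison. -/
def sumSqProg : Prog :=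
  .write 6 0 (V 3 + 2) ;; .write 14 0 (V 3 * V 3) ;;
  forLoop 12 14 (.write 6 0 (V 6 + .read 5 (V 12) * .read 5 (V 12)))

def lenProg : Prog :=
  .write 7 0 0 ;; .while (V 6) (.write 6 0 (V 6 / 2) ;; .write 7 0 (V 7 + 1))

/-- The loop doubles until the `s`-th power exceeds `n ^ r`; the matching power of three is carried
along. -/
def powersProg (π : Params) : Prog :=
  .write 9 0 1 ;; .write 10 0 0 ;; .write 11 0 1 ;;
  .while ((V 3).pow π.r + 1 - (V 9).pow π.s)
    (.write 9 0 (V 9 * 2) ;; .write 10 0 (V 10 + 1) ;; .write 11 0 (V 11 * 3))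

def prelude (π : Params) : Prog :=
  sumSqProg ;; lenProg ;; .write 8 0 (.const π.C * (V 7).pow (2 * π.g)) ;; powersProg π ;;
  .write 15 0 (3 * V 7)

section
variable (π : Params) {x : WeightedGraph} {m : Memory}

theorem sumSqProg_runs (h : Holds x m) :
    Runs (π.H x) sumSqProg m (1 + (1 + (x.n * x.n * 3 + 2))) (fun m' => m' 6 0 = x.sumSq) := by
  have hS : Small x 1 x.sumSq := by unfold Small; rw [one_mul]; exact x.sumSq_lt.le
  refine Runs.seq (Runs.assign (v := (x.n + 2 : ℕ)) rfl ?_ ?_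
    (Runs.seq (Runs.assign (v := (x.n * x.n : ℕ)) rfl ?_ ?_ ?_)))
  · rw [eval_add, eval_V, h.n]; rfl
  · exact ((Small.n x).add (.lit (c := 2))).abs_le_H π
  · rw [eval_mul, eval_V, Memory.set_ne _ (by decide), h.n]; push_cast; rfl
  · exact (Small.n2 x).abs_le_H π
  · have h := (h.set (a := 6) 0 (x.n + 2 : ℕ) (by decide)).set (a := 14) 0 (x.n * x.n : ℕ) (by decide)
    refine (Runs.forLoop (N := x.n * x.n) (T := 1) (fun j m' => m' 6 0 =
      ((x.n + 2 + ∑ p ∈ Finset.range j, (x.W p).natAbs ^ 2 : ℕ) : ℤ)) (by decide) ?_ ?_ ?_ ?_).mono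
      le_rfl ?_
    · rfl
    · simp [Memory.set_apply]
    · intro j m' z h; exact h
    · intro j hj m' hfr hi h6
      have e5 : m' 5 = x.W := by rw [hfr 5 (by decide) (by decide)]; exact h.W
      have hval : (V 6 + .read 5 (V 12) * .read 5 (V 12) : Expr).eval m' =
          ((x.n + 2 + ∑ p ∈ Finset.range (j + 1), (x.W p).natAbs ^ 2 : ℕ) : ℤ) := by
        simp only [eval_add, eval_mul, eval_read, eval_V, h6, hi, e5, Int.toNat_natCast,
          Finset.sum_range_succ]
        push_cast
        rw [sq_abs]; ring
      refine Runs.write rfl rfl ?_ ?_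
      · intro _
        rw [hval]
        refine (hS.of_le ?_).abs_le_H π
        unfold WeightedGraph.sumSq
        gcongr
        omega
      · rw [hval]; exact Memory.set_self _ _ _ _
    · rintro m' - ⟨h6, -⟩; exact h6

theorem lenProg_runs (h : m 6 0 = x.sumSq) :
    Runs (π.H x) lenProg m (1 + (x.len * (2 + 1) + 1)) (fun m' => m' 7 0 = x.len) := by
  have hS : Small x 1 x.sumSq := by unfold Small; rw [one_mul]; exact x.sumSq_lt.le
  refine Runs.seq (Runs.write rfl rfl (by simp) ?_)
  refine (Runs.while_ rfl (T := 2)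
    (Inv := fun j m' => m' 6 0 = (x.sumSq / 2 ^ j : ℕ) ∧ m' 7 0 = j) x.len ?_ ?_ ?_ ?_).mono le_rfl ?_
  · rintro j hj m' ⟨h1, -⟩
    rw [eval_V, h1]
    have := Nat.lt_size.1 hj
    exact_mod_cast Nat.div_pos this (by positivity)
  · rintro j hj m' ⟨h1, h2⟩
    have e1 : (V 6 / 2 : Expr).eval m' = (x.sumSq / 2 ^ (j + 1) : ℕ) := by
      rw [eval_div, eval_V, h1, eval_two, pow_succ, ← Nat.div_div_eq_div_mul]
      norm_cast
    refine Runs.seq (T := 1) (T' := 1) (Runs.write rfl rfl ?_ (Runs.write rfl rfl ?_ ⟨?_, ?_⟩))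
    · intro _; rw [e1]; exact (hS.of_le (Nat.div_le_self _ _)).abs_le_H π
    · intro _
      rw [eval_add, eval_V, Memory.set_ne _ (by decide), h2, eval_one]
      exact ((Small.len x).of_le hj).abs_le_H π
    · rw [Memory.set_ne _ (by decide), e1]; exact Memory.set_self _ _ _ _
    · rw [eval_add, eval_V, Memory.set_ne _ (by decide : 7 ≠ 6), h2, eval_one]
      exact Memory.set_self _ _ _ _
  · rintro m' ⟨h1, -⟩
    rw [eval_V, h1, Nat.div_eq_of_lt x.sumSq_lt]; simp
  · refine ⟨?_, Memory.set_self _ _ _ _⟩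
    rw [Memory.set_ne _ (by decide), h]; simp
  · rintro m' - ⟨-, h⟩; exact h

theorem powersProg_runs (h : m 3 0 = x.n) :
    Runs (π.H x) (powersProg π) m (1 + (1 + (1 + (π.k x * (3 + 1) + 1)))) (fun m' =>
      m' 9 0 = π.Q x ∧ m' 10 0 = π.k x ∧ m' 11 0 = π.D x) := by
  refine Runs.seq (Runs.write rfl rfl (fun _ => (Small.lit (c := 1)).abs_le_H π) (Runs.seq
    (Runs.write rfl rfl (by simp) (Runs.seq
    (Runs.write rfl rfl (fun _ => (Small.lit (c := 1)).abs_le_H π) ?_)))))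
  refine (Runs.while_ (T := 3) (low_sub (low_add (low_pow rfl _) rfl) (low_pow rfl _))
    (Inv := fun j m' => m' 3 0 = x.n ∧ m' 9 0 = (2 ^ j : ℕ) ∧ m' 10 0 = j ∧ m' 11 0 = (3 ^ j : ℕ))
    (π.k x) ?_ ?_ ?_ ?_).mono le_rfl ?_
  · rintro j hj m' ⟨h1, h2, -⟩
    have := π.lt_k x hj
    simp only [eval_sub, eval_add, eval_pow, eval_V, h1, h2, eval_one]
    have : ((2 ^ j : ℕ) : ℤ) ^ π.s ≤ (x.n : ℤ) ^ π.r := by exact_mod_cast this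
    omega
  · rintro j hj m' ⟨h1, h2, h3, h4⟩
    have e1 : (V 9 * 2 : Expr).eval m' = (2 ^ (j + 1) : ℕ) := by
      rw [eval_mul, eval_V, h2, eval_two, pow_succ]; push_cast; rfl
    refine Runs.seq (T := 1) (T' := 2) (Runs.write rfl rfl ?_ (Runs.seq (T := 1) (T' := 1)
      (Runs.write rfl rfl ?_ (Runs.write rfl rfl ?_ ⟨h1, ?_, ?_, ?_⟩))))
    · intro _; rw [e1]
      refine ((Small.Q π x).of_le ?_).abs_le_H π
      exact Nat.pow_le_pow_right (by norm_num) hj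
    · intro _
      change |m' 10 0 + 1| ≤ _
      rw [h3]
      exact ((Small.len x).of_le (hj.trans_le (π.k_le x))).abs_le_H π
    · intro _
      change |m' 11 0 * 3| ≤ _
      rw [h4]
      have : (3 ^ (j + 1) : ℕ) ≤ π.D x := Nat.pow_le_pow_right (by norm_num) hj
      have := ((Small.D π x).of_le this).abs_le_H π
      push_cast at this ⊢
      rwa [pow_succ] at this
    · rw [e1]; rfl
    · change m' 10 0 + 1 = _; rw [h3]; push_cast; rfl
    · change m' 11 0 * 3 = _; rw [h4, pow_succ]; push_cast; rfl
  · rintro m' ⟨h1, h2, -⟩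
    have := π.k_spec x
    simp only [eval_sub, eval_add, eval_pow, eval_V, h1, h2, eval_one]
    have : (x.n : ℤ) ^ π.r < ((2 ^ π.k x : ℕ) : ℤ) ^ π.s := by exact_mod_cast this
    omega
  · exact ⟨h, rfl, rfl, rfl⟩
  · rintro m' - ⟨-, h⟩; exact h

/-- The number of steps of `prelude`. -/
def preludeSteps (π : Params) (x : WeightedGraph) : ℕ :=
  (1 + (1 + (x.n * x.n * 3 + 2))) + ((1 + (x.len * (2 + 1) + 1)) + (1 +
    ((1 + (1 + (1 + (π.k x * (3 + 1) + 1)))) + 1)))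

theorem prelude_runs (h : Holds x m) :
    Runs (π.H x) (prelude π) m (preludeSteps π x) (Setup π x) := by
  refine Runs.seq ((sumSqProg_runs π h).frame.mono le_rfl ?_)
  rintro m1 - ⟨h6, hf1⟩
  have h1 : Holds x m1 := h.frame fun a ha => hf1 a ((by decide : ∀ a ∈ [3, 4, 5], a ∉ _) a ha)
  refine Runs.seq ((lenProg_runs π h6).frame.mono le_rfl ?_)
  rintro m2 - ⟨h7, hf2⟩
  have h2 : Holds x m2 := h1.frame fun a ha => hf2 a ((by decide : ∀ a ∈ [3, 4, 5], a ∉ _) a ha)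
  have e8 : (.const π.C * (V 7).pow (2 * π.g) : Expr).eval m2 = (π.B x : ℕ) := by
    simp only [eval_mul, eval_const, eval_pow, eval_V, h7, Params.B]
    push_cast; rfl
  refine Runs.seq (Runs.assign (low_mul rfl (low_pow rfl _)) e8 ?_ ?_)
  · rw [Nat.abs_cast]
    have := π.B_mul_le_H x (y := 1) (a := 1) Nat.one_le_two_pow (by norm_num)
    rw [mul_one] at this
    exact_mod_cast this
  refine Runs.seq ((powersProg_runs π (x := x) (m := m2.set 8 0 (π.B x : ℕ)) h2.n).frame.mono le_rfl ?_)
  rintro m3 - ⟨⟨h9, h10, h11⟩, hf3⟩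
  have h37 : m3 7 0 = x.len := by rw [hf3 7 (show 7 ∉ [9, 10, 11, 9, 10, 11] by decide)]; exact h7
  have e15 : (3 * V 7 : Expr).eval m3 = (3 * x.len : ℕ) := by
    rw [eval_mul, eval_V, h37, eval_three]; push_cast; rfl
  refine Runs.assign rfl e15 ?_ ?_
  · exact ((Small.lit (c := 3)).mul (.len x)).abs_le_H π
  have h3 : Holds x m3 := by
    refine (h2.set (a := 8) 0 (π.B x) (by decide)).frame ?_
    exact fun a ha => hf3 a ((by decide : ∀ a ∈ [3, 4, 5], a ∉ [9, 10, 11, 9, 10, 11]) a ha)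
  have h38 : m3 8 0 = π.B x := by rw [hf3 8 (show 8 ∉ [9, 10, 11, 9, 10, 11] by decide)]; rfl
  exact { h3.set (a := 15) 0 _ (by decide) with
    len := h37, B := h38, Q := h9, k := h10, D := h11, L := rfl }

end

/-! ### The first triangle of weight zero -/

open Classical in
/-- The code of the first triangle of weight zero, and `n ^ 3` if there is none. -/
def WeightedGraph.first (x : WeightedGraph) : ℕ :=
  if h : ∃ T, T < x.n * x.n * x.n ∧ x.Zero T then Nat.find h else x.n * x.n * x.n

/-- The codes are scanned downwards and every hit overwrites the previous one, so the smallest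
survives. The initial value `n ^ 3` signals that there is none. -/
def findFirst : Prog :=
  .write 14 0 (V 3 * V 3 * V 3) ;; .write 16 0 (V 14) ;;
  forLoop 12 14 (.write 17 0 (V 14 - 1 - V 12) ;;
    .ite (zeroE (V 17)) (.write 16 0 (V 17)) .skip)

-- Identifies the first code both at the end of the search loop and in the soundness argument.
open Classical in
theorem WeightedGraph.eq_first {x : WeightedGraph} {t : ℕ}
    (h1 : ∀ T < x.n * x.n * x.n, x.Zero T → t ≤ T)
    (h2 : t = x.n * x.n * x.n ∨ t < x.n * x.n * x.n ∧ x.Zero t) : t = x.first := by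
  unfold first
  split_ifs with h
  · have h3 := Nat.find_spec h
    rcases h2 with h2 | h2
    · have := h1 _ h3.1 h3.2; omega
    · exact le_antisymm (h1 _ h3.1 h3.2) (Nat.find_min' h h2)
  · rcases h2 with h2 | h2
    · exact h2
    · exact absurd ⟨t, h2⟩ h

theorem findFirst_runs (π : Params) {x : WeightedGraph} {m : Memory} (h : Holds x m) :
    Runs (π.H x) findFirst m (1 + (1 + (x.n * x.n * x.n * 5 + 2))) (fun m' => m' 16 0 = x.first) := by
  set N := x.n * x.n * x.n with hN
  have hNs : Small x 3 N := Small.n3 x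
  have e14 : (V 3 * V 3 * V 3 : Expr).eval m = (N : ℕ) := by
    simp only [eval_mul, eval_V, h.n, hN]; push_cast; rfl
  refine Runs.seq (Runs.assign rfl e14 (hNs.abs_le_H π)
    (Runs.seq (Runs.assign rfl rfl (hNs.abs_le_H π) ?_)))
  have h := (h.set (a := 14) 0 N (by decide)).set (a := 16) 0 N (by decide)
  refine (Runs.forLoop (i := 12) (v := 14) (N := N) (T := 3) (fun j m' => ∃ t : ℕ, m' 16 0 = t ∧
      (∀ T < N, N - j ≤ T → x.Zero T → t ≤ T) ∧ (t = N ∨ t < N ∧ x.Zero t) ∧ N - j ≤ t)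
    (by decide) rfl ?_ (fun _ _ _ h => h) ?_).mono le_rfl ?_
  · exact ⟨N, rfl, fun T _ h _ => by omega, .inl rfl, by omega⟩
  · rintro j hj m' hfr hi ⟨t, ht, h1, h2, h3⟩
    have e : (V 14 - 1 - V 12 : Expr).eval m' = (N - 1 - j : ℕ) := by
      have : m' 14 0 = N := by rw [hfr 14 (by decide) (by decide)]; rfl
      simp only [eval_sub, eval_V, eval_one, this, hi]
      omega
    have hT : Small x 3 (N - 1 - j) := hNs.of_le (by omega)
    refine Runs.seq (T := 1) (T' := 2) (Runs.assign rfl e (hT.abs_le_H π) ?_)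
    have hh : Holds x (m'.set 17 0 (N - 1 - j : ℕ)) := by
      refine Holds.set (a := 17) (h.frame fun a ha => ?_) 0 _ (by decide)
      exact hfr a ((by decide : ∀ a ∈ [3, 4, 5], a ≠ 12) a ha)
        ((by decide : ∀ a ∈ [3, 4, 5], a ∉ _) a ha)
    refine Runs.ite (T := 1) rfl (fun hz => ?_) (fun hz => ?_)
    · rw [eval_zeroE (T := N - 1 - j) (t := V 17) hh rfl] at hz
      refine Runs.assign rfl rfl (hT.abs_le_H π) ⟨N - 1 - j, rfl, ?_, .inr ⟨by omega, hz⟩, ?_⟩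
      · intro T _ hT' _; omega
      · omega
    · rw [eval_zeroE (T := N - 1 - j) (t := V 17) hh rfl] at hz
      refine Runs.skip ⟨t, ht, ?_, h2, ?_⟩
      · intro T hTN hT' hz'
        rcases eq_or_ne T (N - 1 - j) with rfl | hne
        · exact absurd hz' hz
        · exact h1 T hTN (by omega) hz'
      · omega
  · rintro m' - ⟨⟨t, ht, h1, h2, -⟩, -⟩
    rw [ht, WeightedGraph.eq_first (fun T hT hz => h1 T hT (by omega) hz) h2]

end PsdProof

end

noncomputable section

namespace PsdProof

/-! ### Karatsuba's identity

The product of two polynomials of degree less than `2 ^ k` is a combination of `3 ^ k` products of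
sums of coefficients. The coefficient vectors are products over the digits of the indices. -/

/-- The left and right factors of the bilinear form `X`, for a single digit. -/
def digitU (X r : ℕ) : ℤ := ((X : ℤ) + r - 1) * (X + r - 1) % 3
/-- The sign of the term `Y` in the result `X`, for a single digit. -/
def digitS (X Y : ℕ) : ℤ := 1 - Y * (2 - (X : ℤ) / 2)
/-- The degree of the term `Y` in the result `X`, for a single digit. -/
def digitD (X Y : ℕ) : ℤ := 2 * (X : ℤ) % 3 * (1 - Y) + Y

def kU : ℕ → ℕ → ℕ → ℤ
  | 0, _, _ => 1
  | k + 1, X, r => digitU (X % 3) (r % 2) * kU k (X / 3) (r / 2)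

def kS : ℕ → ℕ → ℕ → ℤ
  | 0, _, _ => 1
  | k + 1, X, Y => digitS (X % 3) (Y % 2) * kS k (X / 3) (Y / 2)

def kD : ℕ → ℕ → ℕ → ℤ
  | 0, _, _ => 0
  | k + 1, X, Y => digitD (X % 3) (Y % 2) + 2 * kD k (X / 3) (Y / 2)

theorem sum_range_mul_eq (N q : ℕ) (f : ℕ → ℤ) :
    ∑ i ∈ Finset.range (N * q), f i =
      ∑ a ∈ Finset.range N, ∑ b ∈ Finset.range q, f (a * q + b) := by
  induction N with
  | zero => simp
  | succ N ih => rw [Nat.succ_mul, Finset.sum_range_add, ih, Finset.sum_range_succ]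

/-- This is `(a₀ + a₁ z) (b₀ + b₁ z) = a₀ b₀ (1 - z) + a₁ b₁ (z² - z) + (a₀ + a₁) (b₀ + b₁) z`, the
three products being numbered `0`, `1`, `2`. The monomial of degree `d` is replaced by `F d` for an
arbitrary function `F`. -/
theorem digit_identity {r s : ℕ} (hr : r < 2) (hs : s < 2) (F : ℤ → ℤ) :
    ∑ i ∈ Finset.range 3, ∑ j ∈ Finset.range 2,
      digitU i r * digitU i s * digitS i j * F (digitD i j) = F (r + s) := by
  interval_cases r <;> interval_cases s <;>
    simp [Finset.sum_range_succ, digitU, digitS, digitD]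

/-- The tensor power of the one-digit identity. The lowest digits are split off, and the induction
hypothesis is applied to the higher digits with `d ↦ F (r % 2 + s % 2 + 2 * d)`. This is why `F` has
to be arbitrary. -/
theorem karatsuba (k : ℕ) : ∀ {r s : ℕ}, r < 2 ^ k → s < 2 ^ k → ∀ F : ℤ → ℤ,
    ∑ X ∈ Finset.range (3 ^ k), ∑ Y ∈ Finset.range (2 ^ k),
      kU k X r * kU k X s * kS k X Y * F (kD k X Y) = F (r + s) := by
  induction k with
  | zero =>
    intro r s hr hs F
    obtain rfl : r = 0 := by simpa using hr
    obtain rfl : s = 0 := by simpa using hs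
    simp [kU, kS, kD]
  | succ k ih =>
    intro r s hr hs F
    rw [pow_succ] at hr hs
    have hr' : r / 2 < 2 ^ k := by omega
    have hs' : s / 2 < 2 ^ k := by omega
    rw [pow_succ, pow_succ, sum_range_mul_eq]
    have h1 : ∀ X, (∑ i ∈ Finset.range 3, ∑ Y ∈ Finset.range (2 ^ k * 2),
        kU (k + 1) (X * 3 + i) r * kU (k + 1) (X * 3 + i) s * kS (k + 1) (X * 3 + i) Y *
          F (kD (k + 1) (X * 3 + i) Y)) =
        ∑ Y ∈ Finset.range (2 ^ k), kU k X (r / 2) * kU k X (s / 2) * kS k X Y *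
          F ((r % 2 : ℕ) + (s % 2 : ℕ) + 2 * kD k X Y) := by
      intro X
      simp_rw [sum_range_mul_eq]
      rw [Finset.sum_comm]
      refine Finset.sum_congr rfl fun Y _ => ?_
      rw [← digit_identity (Nat.mod_lt r two_pos) (Nat.mod_lt s two_pos)
        (fun d => F (d + 2 * kD k X Y)), Finset.mul_sum]
      refine Finset.sum_congr rfl fun i hi => ?_
      rw [Finset.mul_sum]
      refine Finset.sum_congr rfl fun j hj => ?_
      rw [Finset.mem_range] at hi hj
      simp only [kU, kS, kD, mul_add_div_of_lt hi, mul_add_mod_of_lt hi, mul_add_div_of_lt hj,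
        mul_add_mod_of_lt hj]
      ring
    rw [Finset.sum_congr rfl fun X _ => h1 X,
      ih hr' hs' (fun d => F ((r % 2 : ℕ) + (s % 2 : ℕ) + 2 * d))]
    congr 1
    push_cast
    omega

theorem kU_zero (k : ℕ) : kU k 0 0 = 1 := by
  induction k with
  | zero => rfl
  | succ k ih => simp [kU, ih, digitU]

theorem kS_zero (k : ℕ) : kS k 0 0 = 1 := by
  induction k with
  | zero => rfl
  | succ k ih => simp [kS, ih, digitS]

theorem kD_zero (k : ℕ) : kD k 0 0 = 0 := by
  induction k with
  | zero => rfl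
  | succ k ih => simp [kD, ih, digitD]

section
variable {k : ℕ}

/-- A leading zero digit contributes the factor `1`. So the recursion that drops the lowest digit
stays within the table for `k` digits. -/
theorem kU_succ : ∀ {k X r : ℕ}, X < 3 ^ k → r < 2 ^ k → kU (k + 1) X r = kU k X r
  | 0, X, r, hX, hr => by
    obtain rfl : X = 0 := by simpa using hX
    obtain rfl : r = 0 := by simpa using hr
    rfl
  | k + 1, X, r, hX, hr => by
    rw [pow_succ] at hX hr
    rw [kU, kU_succ (k := k) (by omega) (by omega), kU]

theorem kS_succ : ∀ {k X r : ℕ}, X < 3 ^ k → r < 2 ^ k → kS (k + 1) X r = kS k X r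
  | 0, X, r, hX, hr => by
    obtain rfl : X = 0 := by simpa using hX
    obtain rfl : r = 0 := by simpa using hr
    rfl
  | k + 1, X, r, hX, hr => by
    rw [pow_succ] at hX hr
    rw [kS, kS_succ (k := k) (by omega) (by omega), kS]

theorem kD_succ : ∀ {k X r : ℕ}, X < 3 ^ k → r < 2 ^ k → kD (k + 1) X r = kD k X r
  | 0, X, r, hX, hr => by
    obtain rfl : X = 0 := by simpa using hX
    obtain rfl : r = 0 := by simpa using hr
    rfl
  | k + 1, X, r, hX, hr => by
    rw [pow_succ] at hX hr
    rw [kD, kD_succ (k := k) (by omega) (by omega), kD]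

theorem abs_kU_le (k : ℕ) : ∀ X r, |kU k X r| ≤ 1 := by
  induction k with
  | zero => intros; simp [kU]
  | succ k ih =>
    intro X r
    rw [kU, abs_mul]
    have : |digitU (X % 3) (r % 2)| ≤ 1 := by
      have h1 := Nat.mod_lt X (show 3 > 0 by norm_num)
      have h2 := Nat.mod_lt r (show 2 > 0 by norm_num)
      interval_cases X % 3 <;> interval_cases r % 2 <;> decide
    exact mul_le_one₀ this (abs_nonneg _) (ih _ _)

theorem abs_kS_le (k : ℕ) : ∀ X r, |kS k X r| ≤ 1 := by
  induction k with
  | zero => intros; simp [kS]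
  | succ k ih =>
    intro X r
    rw [kS, abs_mul]
    have : |digitS (X % 3) (r % 2)| ≤ 1 := by
      have h1 := Nat.mod_lt X (show 3 > 0 by norm_num)
      have h2 := Nat.mod_lt r (show 2 > 0 by norm_num)
      interval_cases X % 3 <;> interval_cases r % 2 <;> decide
    exact mul_le_one₀ this (abs_nonneg _) (ih _ _)

/-- The bound is the degree of a product of two polynomials of degree `2 ^ k - 1`. -/
theorem abs_kD_le (k : ℕ) : ∀ X r, |kD k X r| ≤ 2 * 2 ^ k - 2 := by
  induction k with
  | zero => intros; simp [kD]
  | succ k ih =>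
    intro X r
    rw [kD]
    have : |digitD (X % 3) (r % 2)| ≤ 2 := by
      have h1 := Nat.mod_lt X (show 3 > 0 by norm_num)
      have h2 := Nat.mod_lt r (show 2 > 0 by norm_num)
      interval_cases X % 3 <;> interval_cases r % 2 <;> decide
    have h := ih (X / 3) (r / 2)
    rw [pow_succ]
    rw [abs_le] at *
    constructor <;> linarith [h.1, h.2, this.1, this.2]

end

/-- The coefficients by which the results enter into the residue class `t` modulo `P`. -/
def kV (k P X t : ℕ) : ℤ :=
  ∑ Y ∈ Finset.range (2 ^ k), if (-kD k X Y) % P = t then kS k X Y else 0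

/-- Karatsuba's identity with the indicator of `-d ≡ t` modulo `P` in place of `F`. The reduction
modulo `P` is absorbed by the third factor, so divisibility becomes a trilinear form with `3 ^ k`
terms. -/
theorem sum_kU_mul_kV {k P r s t : ℕ} (hr : r < 2 ^ k) (hs : s < 2 ^ k) (ht : t < P) :
    ∑ X ∈ Finset.range (3 ^ k), kU k X r * kU k X s * kV k P X t =
      if (P : ℤ) ∣ r + s + t then 1 else 0 := by
  have h := karatsuba k hr hs (fun d => if (-d) % P = t then 1 else 0)
  have e : ((-((r : ℤ) + s)) % P = t) ↔ (P : ℤ) ∣ r + s + t := by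
    have ht' : (t : ℤ) % P = t := Int.emod_eq_of_lt (by positivity) (by exact_mod_cast ht)
    rw [← ht', ← Int.ModEq, Int.modEq_iff_dvd, ht']
    rw [show (t : ℤ) - -(r + s) = r + s + t by ring]
  rw [← if_congr e rfl rfl, ← h]
  refine Finset.sum_congr rfl fun X _ => ?_
  rw [kV, Finset.mul_sum]
  refine Finset.sum_congr rfl fun Y _ => ?_
  split_ifs <;> simp

/-! ### Counting triangles whose weight is divisible by `P` -/

namespace WeightedGraph
variable (x : WeightedGraph)

open Classical in
/-- The number of triangles with a code below `N` whose weight is divisible by `P`. -/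
def count (P N : ℕ) : ℕ := ((Finset.range N).filter fun T => x.ZeroMod P T).card

/-- The residue of a weight modulo `P`. -/
def res (P p : ℕ) : ℕ := (x.W p % P).toNat

theorem res_lt {P : ℕ} (hP : 0 < P) (p : ℕ) : x.res P p < P := by
  have h1 := Int.emod_nonneg (x.W p) (b := (P : ℤ)) (by omega)
  have h2 := Int.emod_lt_of_pos (x.W p) (b := (P : ℤ)) (by omega)
  unfold res; omega

theorem coe_res {P : ℕ} (hP : 0 < P) (p : ℕ) : (x.res P p : ℤ) = x.W p % P :=
  Int.toNat_of_nonneg (Int.emod_nonneg _ (by omega))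

/-- The entries of the matrix number `X`. -/
def entry (k P X p : ℕ) : ℤ := x.A p * kU k X (x.res P p)

/-- The entries of the square of the matrix number `X`. -/
def square (k P X p : ℕ) : ℤ :=
  ∑ b ∈ Finset.range x.n, x.entry k P X (p / x.n * x.n + b) * x.entry k P X (b * x.n + p % x.n)

/-- For fixed `X` the edges `ab` and `bc` carry the same coefficient function, so the sum over the
middle vertex `b` is an entry of a matrix square, and the edge `ac` supplies the outer factor. All
`b` and `c` are included, which is why the range consists of complete blocks of first vertices. -/
theorem sum_square_eq_count {k P i : ℕ} (hP : 0 < P) (hPk : P ≤ 2 ^ k) :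
    ∑ p ∈ Finset.range (i * x.n), ∑ X ∈ Finset.range (3 ^ k),
      x.A p * kV k P X (x.res P p) * x.square k P X p = x.count P (i * x.n * x.n) := by
  classical
  have h1 : ∀ a c, c < x.n → (∑ X ∈ Finset.range (3 ^ k),
      x.A (a * x.n + c) * kV k P X (x.res P (a * x.n + c)) * x.square k P X (a * x.n + c)) =
      ∑ b ∈ Finset.range x.n, if x.ZeroMod P ((a * x.n + b) * x.n + c) then 1 else 0 := by
    intro a c hc
    simp only [square, mul_add_div_of_lt hc, mul_add_mod_of_lt hc, Finset.mul_sum]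
    rw [Finset.sum_comm]
    refine Finset.sum_congr rfl fun b hb => ?_
    rw [Finset.mem_range] at hb
    have h2 := sum_kU_mul_kV (k := k) (lt_of_lt_of_le (x.res_lt hP (a * x.n + b)) hPk)
      (lt_of_lt_of_le (x.res_lt hP (b * x.n + c)) hPk) (x.res_lt hP (a * x.n + c))
    have h3 : (P : ℤ) ∣ (x.res P (a * x.n + b) : ℤ) + x.res P (b * x.n + c) +
        x.res P (a * x.n + c) ↔ (P : ℤ) ∣ x.wt ((a * x.n + b) * x.n + c) := by
      simp only [coe_res x hP, wt, mul_add_div_of_lt hc, mul_add_mod_of_lt hc, mul_add_div_of_lt hb,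
        mul_add_mod_of_lt hb]
      rw [add_right_comm (x.W (a * x.n + b))]
      simp only [Int.dvd_iff_emod_eq_zero, Int.add_emod, Int.emod_emod]
    rw [if_congr h3 rfl rfl] at h2
    calc _ = x.tri ((a * x.n + b) * x.n + c) * ∑ X ∈ Finset.range (3 ^ k),
        kU k X (x.res P (a * x.n + b)) * kU k X (x.res P (b * x.n + c)) *
          kV k P X (x.res P (a * x.n + c)) := by
          rw [Finset.mul_sum]
          refine Finset.sum_congr rfl fun X _ => ?_
          simp only [tri, entry, mul_add_div_of_lt hc, mul_add_mod_of_lt hc, mul_add_div_of_lt hb,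
            mul_add_mod_of_lt hb]
          ring
      _ = _ := by
          rw [h2]
          unfold ZeroMod
          rcases x.tri_eq ((a * x.n + b) * x.n + c) with h4 | h4 <;> simp [h4]
  rw [sum_range_mul_eq]
  have h2 : ((x.count P (i * x.n * x.n) : ℕ) : ℤ) =
      ∑ T ∈ Finset.range (i * x.n * x.n), if x.ZeroMod P T then 1 else 0 := by
    rw [count, Finset.card_filter]; push_cast; rfl
  rw [h2, sum_range_mul_eq, sum_range_mul_eq]
  refine Finset.sum_congr rfl fun a _ => ?_
  -- The codes run over `b` before `c`, whereas the matrix entries are indexed by `a` and `c`.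
  rw [Finset.sum_comm (s := Finset.range x.n) (t := Finset.range x.n)]
  exact Finset.sum_congr rfl fun c hc => h1 a c (Finset.mem_range.1 hc)

theorem abs_entry_le (k P X p : ℕ) : |x.entry k P X p| ≤ 1 := by
  rw [entry, abs_mul]
  exact mul_le_one₀ (x.abs_A_le p) (abs_nonneg _) (abs_kU_le _ _ _)

theorem abs_square_le (k P X p : ℕ) : |x.square k P X p| ≤ x.n := by
  refine (Finset.abs_sum_le_sum_abs _ _).trans ((Finset.sum_le_card_nsmul _ _ 1 ?_).trans ?_)
  · intro b _
    rw [abs_mul]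
    exact mul_le_one₀ (x.abs_entry_le _ _ _ _) (abs_nonneg _) (x.abs_entry_le _ _ _ _)
  · simp

end WeightedGraph

theorem abs_kV_le (k P X t : ℕ) : |kV k P X t| ≤ 2 ^ k := by
  refine (Finset.abs_sum_le_sum_abs _ _).trans ((Finset.sum_le_card_nsmul _ _ 1 ?_).trans ?_)
  · intro b _
    split_ifs
    · exact abs_kS_le _ _ _
    · simp
  · simp

end PsdProof

end

noncomputable section

namespace PsdProof

local infixr:60 " ;; " => Prog.seq

/-! ### The tables of coefficients

The modulus `P` is in variable `18`. -/

/-- Entry `(X, Y)` is derived from the entry `(X / 3, Y / 2)` of the same table, whose cell number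
is held in variable `36`. The sign is then added to the coefficient of the residue class that its
degree determines. -/
def tableStep : Prog :=
  .write 34 0 (V 12 / V 9) ;; .write 35 0 (V 12 % V 9) ;;
  .write 36 0 (V 34 / 3 * V 9 + V 35 / 2) ;;
  .write 25 (V 12) ((V 34 % 3 + V 35 % 2 - 1) * (V 34 % 3 + V 35 % 2 - 1) % 3 * .read 25 (V 36)) ;;
  .write 26 (V 12) ((1 - V 35 % 2 * (2 - V 34 % 3 / 2)) * .read 26 (V 36)) ;;
  .write 27 (V 12) (2 * (V 34 % 3) % 3 * (1 - V 35 % 2) + V 35 % 2 + 2 * .read 27 (V 36)) ;;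
  .write 37 0 (V 34 * V 18 + (0 - .read 27 (V 12)) % V 18) ;;
  .write 28 (V 37) (.read 28 (V 37) + .read 26 (V 12))

def tables : Prog :=
  .write 25 0 1 ;; .write 26 0 1 ;; .write 27 0 0 ;; .write 14 0 (V 11 * V 9) ;;
  forLoop 12 14 tableStep

/-- The cell of the table of the coefficients `kV` to which the term number `i` contributes. -/
def kCell (k P i : ℕ) : ℕ :=
  i / 2 ^ k * P + ((-kD k (i / 2 ^ k) (i % 2 ^ k)) % P).toNat

/-- The tables hold the coefficients. -/
structure Tables (k P : ℕ) (m : Memory) : Prop where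
  U : ∀ X < 3 ^ k, ∀ r < 2 ^ k, m 25 (X * 2 ^ k + r) = kU k X r
  V : ∀ X < 3 ^ k, ∀ t < P, m 28 (X * P + t) = kV k P X t

theorem sum_kCell {k P X t : ℕ} (hX : X < 3 ^ k) (ht : t < P) :
    (∑ i ∈ Finset.range (3 ^ k * 2 ^ k), if kCell k P i = X * P + t then
      kS k (i / 2 ^ k) (i % 2 ^ k) else 0) = kV k P X t := by
  have hP : (P : ℤ) ≠ 0 := by omega
  have hn : ∀ d : ℤ, 0 ≤ d % P := fun d => Int.emod_nonneg _ hP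
  have hl : ∀ d : ℤ, (d % P).toNat < P := fun d => by
    have := hn d; have := Int.emod_lt_of_pos d (b := (P : ℤ)) (by omega); omega
  rw [sum_range_mul_eq, Finset.sum_eq_single X]
  · rw [kV]
    refine Finset.sum_congr rfl fun Y hY => ?_
    rw [Finset.mem_range] at hY
    simp only [kCell, mul_add_div_of_lt hY, mul_add_mod_of_lt hY]
    refine if_congr ?_ rfl rfl
    have := hn (-kD k X Y)
    omega
  · intro X' _ hne
    refine Finset.sum_eq_zero fun Y hY => ?_
    rw [Finset.mem_range] at hY
    rw [if_neg]
    simp only [kCell, mul_add_div_of_lt hY, mul_add_mod_of_lt hY]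
    intro h
    have := congrArg (· / P) h
    simp only [mul_add_div_of_lt (hl _), mul_add_div_of_lt ht] at this
    exact hne this
  · intro h; exact absurd (Finset.mem_range.2 hX) h

theorem tables_runs (π : Params) {x : WeightedGraph} {m : Memory} (h : Setup π x m) {P : ℕ}
    (hP : 0 < P) (hm : m 18 0 = P) (hPQ : P ≤ π.Q x) (h28 : ∀ p, m 28 p = 0) :
    Runs (π.H x) tables m (1 + (1 + (1 + (1 + (π.D x * π.Q x * 10 + 2)))))
      (Tables (π.k x) P) := by
  set k := π.k x with hk
  set N := π.D x * π.Q x with hN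
  have hNs : Small x 3 N := (Small.D π x).mul (.Q π x)
  have hQ : π.Q x = 2 ^ k := rfl
  have hD : π.D x = 3 ^ k := rfl
  have h2k : 0 < 2 ^ k := by positivity
  have h1s : Small x 1 1 := .lit
  refine Runs.seq (Runs.assign rfl (v := (1 : ℕ)) rfl (h1s.abs_le_H π)
    (Runs.seq (Runs.assign rfl (v := (1 : ℕ)) rfl (h1s.abs_le_H π)
    (Runs.seq (Runs.assign rfl (v := (0 : ℕ)) rfl (by simp)
    (Runs.seq (Runs.assign (v := N) rfl ?_ (hNs.abs_le_H π) ?_)))))))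
  · change m 11 0 * m 9 0 = _
    rw [h.D, h.Q, hN, Nat.cast_mul]
  -- The entry `0` is its own parent, so it is preset before the loop; hence `max j 1`.
  refine (Runs.forLoop (i := 12) (v := 14) (N := N) (T := 8) (fun j m' =>
      (∀ i < max j 1, m' 25 i = kU k (i / 2 ^ k) (i % 2 ^ k) ∧ m' 26 i = kS k (i / 2 ^ k) (i % 2 ^ k) ∧
        m' 27 i = kD k (i / 2 ^ k) (i % 2 ^ k)) ∧
      ∀ q, m' 28 q = ∑ i ∈ Finset.range j, if kCell k P i = q then
        kS k (i / 2 ^ k) (i % 2 ^ k) else 0)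
    (by decide) rfl ?_ (fun _ _ _ h => h) ?_).mono le_rfl ?_
  · refine ⟨fun i hi => ?_, fun q => ?_⟩
    · obtain rfl : i = 0 := by simpa using hi
      simp only [Nat.zero_div, Nat.zero_mod, kU_zero, kS_zero, kD_zero]
      exact ⟨rfl, rfl, rfl⟩
    · rw [Finset.range_zero, Finset.sum_empty]
      exact h28 q
  · rintro j hj m' hfr hi ⟨h1, h2⟩
    have e9 : m' 9 0 = (2 ^ k : ℕ) := by
      rw [hfr 9 (by decide) (by decide)]; exact h.Q
    have e18 : m' 18 0 = P := by rw [hfr 18 (by decide) (by decide)]; exact hm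
    set X := j / 2 ^ k with hX
    set Y := j % 2 ^ k with hY
    have hYlt : Y < 2 ^ k := Nat.mod_lt _ h2k
    have hXlt : X < 3 ^ k := Nat.div_lt_of_lt_mul (by rw [mul_comm]; exact hj)
    have hjXY : X * 2 ^ k + Y = j := Nat.div_add_mod' j (2 ^ k)
    set par := X / 3 * 2 ^ k + Y / 2 with hpar
    have hpar' : par < max j 1 := by
      rcases Nat.eq_zero_or_pos j with h0 | h0
      · have : X = 0 := by rw [hX, h0, Nat.zero_div]
        have : Y = 0 := by rw [hY, h0, Nat.zero_mod]
        simp [*]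
      · rw [max_eq_left h0, ← hjXY]
        rcases Nat.eq_zero_or_pos X with h0' | h0'
        · have : Y / 2 < Y := Nat.div_lt_self (by rw [h0'] at hjXY; omega) (by norm_num)
          rw [hpar, h0']; omega
        · have : X / 3 + 1 ≤ X := by omega
          have := Nat.mul_le_mul_right (2 ^ k) this
          rw [add_mul] at this
          omega
    have hpd : par / 2 ^ k = X / 3 := mul_add_div_of_lt (by omega) _
    have hpm : par % 2 ^ k = Y / 2 := mul_add_mod_of_lt (by omega) _
    obtain ⟨p25, p26, p27⟩ := h1 par hpar'
    rw [hpd, hpm] at p25 p26 p27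
    -- Padding to `k + 1` digits lets the defining recursion unfold onto the parent entry.
    have u := kU_succ hXlt hYlt
    have v := kS_succ hXlt hYlt
    have w := kD_succ hXlt hYlt
    rw [kU, ← p25] at u
    rw [kS, ← p26] at v
    rw [kD, ← p27] at w
    have hjs : Small x 3 j := hNs.of_le hj.le
    have hYs : Small x 1 Y := (Small.Q π x).of_le hYlt.le
    have hXs : Small x 2 X := (Small.D π x).of_le hXlt.le
    have hone : ∀ z : ℤ, |z| ≤ 1 → |z| ≤ π.H x := fun z hz =>
      hz.trans (by have := h1s.abs_le_H π; simpa using this)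
    unfold tableStep
    refine Runs.seq (T := 1) (T' := 7) (Runs.assign rfl (v := X) ?_ (hXs.abs_le_H π) ?_)
    · change m' 12 0 / m' 9 0 = _; rw [hi, e9]; norm_cast
    refine Runs.seq (T := 1) (T' := 6) (Runs.assign rfl (v := Y) ?_ (hYs.abs_le_H π) ?_)
    · change m' 12 0 % m' 9 0 = _; rw [hi, e9]; norm_cast
    refine Runs.seq (T := 1) (T' := 5) (Runs.assign rfl (v := par) ?_ (Small.abs_le_H (a := 4) π ?_) ?_)
    · change (X : ℤ) / 3 * m' 9 0 + Y / 2 = _; rw [e9, hpar]; push_cast; rfl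
    · refine Small.add (a := 3) ?_ (Small.mono (hYs.of_le (Nat.div_le_self _ _)) (by norm_num))
      exact (hXs.of_le (Nat.div_le_self _ _)).mul (.Q π x)
    refine Runs.seq (T := 1) (T' := 4) (Runs.store (p := j) (v := kU k X Y) rfl rfl hi ?_
      (fun _ => hone _ (abs_kU_le _ _ _)) ?_)
    · rw [← u, digitU]; push_cast; rfl
    refine Runs.seq (T := 1) (T' := 3) (Runs.store (p := j) (v := kS k X Y) rfl rfl hi ?_
      (fun _ => hone _ (abs_kS_le _ _ _)) ?_)
    · rw [← v, digitS]; push_cast; rfl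
    refine Runs.seq (T := 1) (T' := 2) (Runs.store (p := j) (v := kD k X Y) rfl rfl hi ?_
      (fun _ => ?_) ?_)
    · rw [← w, digitD]; push_cast; rfl
    · have := abs_kD_le k X Y
      have h3 := ((Small.lit (c := 2)).mul (Small.Q π x)).abs_le_H π
      rw [Nat.abs_cast] at h3
      push_cast [hQ] at h3
      linarith
    set m3 := (((((m'.set 34 0 X).set 35 0 Y).set 36 0 par).set 25 j (kU k X Y)).set 26 j
      (kS k X Y)).set 27 j (kD k X Y) with hm3
    have hcell : kCell k P j = X * P + ((-kD k X Y) % P).toNat := rfl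
    have hmod := Int.emod_nonneg (-kD k X Y) (b := (P : ℤ)) (by omega)
    have hmod' := Int.emod_lt_of_pos (-kD k X Y) (b := (P : ℤ)) (by omega)
    refine Runs.seq (T := 1) (T' := 1) (Runs.assign rfl (v := kCell k P j) ?_
      (Small.abs_le_H (a := 4) π ?_) ?_)
    · have e3 : m3 27 j = kD k X Y := Memory.set_self _ _ _ _
      simp only [eval_add, eval_mul, eval_mod, eval_sub, eval_read, eval_V, eval_zero]
      have e12 : (m3 12 0).toNat = j := by change (m' 12 0).toNat = j; rw [hi, Int.toNat_natCast]
      rw [e12, e3, hcell]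
      change (X : ℤ) * m' 18 0 + (0 - kD k X Y) % m' 18 0 = _
      rw [e18, zero_sub]
      push_cast
      rw [Int.toNat_of_nonneg hmod]
    · rw [hcell]
      refine Small.add (a := 3) (hXs.mul ((Small.Q π x).of_le hPQ)) ?_
      refine Small.mono (a := 1) ((Small.Q π x).of_le ?_) (by norm_num)
      omega
    have e26 : m3 26 j = kS k X Y := by
      change ((((m'.set 34 0 X).set 35 0 Y).set 36 0 par).set 25 j (kU k X Y)).set 26 j
        (kS k X Y) 26 j = _
      exact Memory.set_self _ _ _ _
    have e28 : m' 28 (kCell k P j) + kS k X Y = ∑ i ∈ Finset.range (j + 1),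
        if kCell k P i = kCell k P j then kS k (i / 2 ^ k) (i % 2 ^ k) else 0 := by
      rw [Finset.sum_range_succ, if_pos rfl, h2]
    refine Runs.store (p := kCell k P j) (v := m' 28 (kCell k P j) + kS k X Y) rfl rfl rfl ?_
      (fun _ => ?_) ⟨fun i hij => ?_, fun q => ?_⟩
    · simp only [eval_add, eval_read, eval_V]
      have e12 : ((m3.set 37 0 (kCell k P j)) 12 0).toNat = j := by
        change (m' 12 0).toNat = j; rw [hi, Int.toNat_natCast]
      rw [e12]
      change m' 28 (kCell k P j : ℤ).toNat + m3 26 j = _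
      rw [e26, Int.toNat_natCast]
    · rw [e28]
      refine (Finset.abs_sum_le_sum_abs _ _).trans
        ((Finset.sum_le_card_nsmul _ _ 1 ?_).trans ?_)
      · intro i _
        split_ifs
        · exact abs_kS_le _ _ _
        · simp
      · have := (hNs.of_le hj).abs_le_H π
        rw [Nat.abs_cast] at this
        simpa using this
    · change (((m'.set 34 0 X).set 35 0 Y).set 36 0 par).set 25 j (kU k X Y) 25 i = _ ∧
        ((((m'.set 34 0 X).set 35 0 Y).set 36 0 par).set 25 j (kU k X Y)).set 26 j
        (kS k X Y) 26 i = _ ∧ m3 27 i = _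
      rw [hm3]
      simp only [Memory.set_apply, true_and]
      rcases eq_or_ne i j with rfl | hne
      · simp only [if_true]; exact ⟨rfl, rfl, rfl⟩
      · simp only [if_neg hne]
        exact h1 i (by rw [max_eq_left (by omega : 1 ≤ j + 1)] at hij; omega)
    · rw [Memory.set_apply]
      simp only [true_and]
      split_ifs with hq
      · rw [e28, hq]
      · rw [Finset.sum_range_succ, if_neg (fun h => hq h.symm), add_zero]
        exact h2 q
  · rintro m' - ⟨⟨h1, h2⟩, -⟩
    refine ⟨fun X hX r hr => ?_, fun X hX t ht => ?_⟩
    · have := (h1 (X * 2 ^ k + r) (lt_max_of_lt_left (mul_add_lt hX hr))).1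
      rw [this, mul_add_div_of_lt hr, mul_add_mod_of_lt hr]
    · rw [h2, ← sum_kCell hX ht]; rfl

end PsdProof

end

noncomputable section

namespace PsdProof

local infixr:60 " ;; " => Prog.seq

/-! ### The matrix products -/

/-- Write the matrices of all runs. -/
def fillInputs : Prog :=
  .write 14 0 (V 3 * V 3 * V 11) ;;
  forLoop 12 14 (.write 34 0 (V 12 / V 11) ;;
    .write 35 0 (.read 4 (V 34) * .read 25 (V 12 % V 11 * V 9 + .read 5 (V 34) % V 18)) ;;
    .write 65 (V 12) (V 35) ;; .write 66 (V 12) (V 35))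

/-- Run `c` on the matrices of all runs. -/
def callAll (c : Prog) : Prog := forLoop 13 11 (.write 64 (V 13) (V 3) ;; c.lift)

/-- Sum up the results for the rows below those of `base`, which is in variable `21`. -/
def accumulate : Prog :=
  .write 22 0 0 ;; .write 14 0 (V 21 / V 3 * V 11) ;;
  forLoop 12 14 (.write 34 0 (V 12 / V 11) ;;
    .write 22 0 (V 22 + .read 4 (V 34) *
      .read 28 (V 12 % V 11 * V 18 + .read 5 (V 34) % V 18) * .read 67 (V 12)))

/-- Count the triangles below `base` whose weight is divisible by `P`. -/
def countProg (c : Prog) : Prog := tables ;; fillInputs ;; callAll c ;; accumulate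

section
variable (π : Params) {x : WeightedGraph} {m : Memory} {P : ℕ}

theorem Tables.frame {k : ℕ} {m m' : Memory} (h : Tables k P m) (h25 : m' 25 = m 25)
    (h28 : m' 28 = m 28) : Tables k P m' :=
  ⟨fun X hX r hr => by rw [h25]; exact h.U X hX r hr,
    fun X hX t ht => by rw [h28]; exact h.V X hX t ht⟩

theorem eval_res {e : Expr} {p : ℕ} (h : Holds x m) (hP : 0 < P) (hm : m 18 0 = P)
    (he : e.eval m = p) : (.read 5 e % V 18 : Expr).eval m = x.res P p := by
  rw [eval_mod, eval_read, eval_V, he, Int.toNat_natCast, h.W, hm, WeightedGraph.coe_res x hP]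

/-- The arrays `65` and `66` are the input arrays `1` and `2` of the simulated program. Entry `p` of
matrix `X` belongs to cell `p * D + X`. -/
theorem fillInputs_runs (h : Setup π x m) (hP : 0 < P) (hm : m 18 0 = P) (hPQ : P ≤ π.Q x)
    (hT : Tables (π.k x) P m) (h65 : ∀ p, m 65 p = 0) (h66 : ∀ p, m 66 p = 0) :
    Runs (π.H x) fillInputs m (1 + (x.n * x.n * π.D x * 6 + 2)) (fun m' => ∀ i,
      (m' 65 i = if i < x.n * x.n * π.D x then x.entry (π.k x) P (i % π.D x) (i / π.D x) else 0) ∧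
      m' 66 i = if i < x.n * x.n * π.D x then x.entry (π.k x) P (i % π.D x) (i / π.D x) else 0) := by
  set N := x.n * x.n * π.D x with hN
  have hNs : Small x 4 N := (Small.n2 x).mul (.D π x)
  have hD := π.D_pos x
  refine Runs.seq (Runs.assign (v := N) rfl ?_ (hNs.abs_le_H π) ?_)
  · change m 3 0 * m 3 0 * m 11 0 = _; rw [h.n, h.D]; rfl
  refine (Runs.forLoop (i := 12) (v := 14) (N := N) (T := 4) (fun j m' => ∀ i,
      (m' 65 i = if i < j then x.entry (π.k x) P (i % π.D x) (i / π.D x) else 0) ∧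
      m' 66 i = if i < j then x.entry (π.k x) P (i % π.D x) (i / π.D x) else 0)
    (by decide) rfl ?_ (fun _ _ _ h => h) ?_).mono le_rfl ?_
  · intro i; simp only [not_lt_zero, if_false]; exact ⟨h65 i, h66 i⟩
  · rintro j hj m' hfr hi h1
    have hs : Setup π x m' := (h.set (a := 14) 0 N (by decide)).frame fun a ha =>
      hfr a ((by decide : ∀ a ∈ setupArrays, a ≠ 12) a ha)
        ((by decide : ∀ a ∈ setupArrays, a ∉ _) a ha)
    have e18 : m' 18 0 = P := by rw [hfr 18 (by decide) (by decide)]; exact hm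
    have hT' : Tables (π.k x) P m' := hT.frame (hfr 25 (by decide) (by decide))
      (hfr 28 (by decide) (by decide))
    set p := j / π.D x with hp
    have hXlt : j % π.D x < π.D x := Nat.mod_lt _ hD
    have e0 : (V 12 / V 11 : Expr).eval m' = p := by
      rw [eval_div, eval_V, eval_V, hi, hs.D]; norm_cast
    refine Runs.seq (T := 1) (T' := 3) (Runs.assign rfl e0
      ((hNs.of_le ((Nat.div_le_self _ _).trans hj.le)).abs_le_H π) ?_)
    have hs1 : Setup π x (m'.set 34 0 p) := hs.set 0 _ (by decide)
    have hE : |x.entry (π.k x) P (j % π.D x) p| ≤ (π.H x : ℤ) :=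
      (x.abs_entry_le _ _ _ _).trans (by exact_mod_cast (Small.lit (c := 1)).abs_le_H (x := x) π)
    refine Runs.seq (T := 1) (T' := 2) (Runs.assign rfl (v := x.entry (π.k x) P (j % π.D x) p) ?_
      hE ?_)
    · have er := eval_res (x := x) (m := m'.set 34 0 p) (e := V 34) (p := p) hs1.toHolds hP e18 rfl
      rw [eval_mul, eval_read (a := 25), eval_add, er, eval_mul, eval_mod]
      change m' 4 (p : ℤ).toNat * m' 25 (m' 12 0 % m' 11 0 * m' 9 0 + x.res P p).toNat = _
      have e25 := hT'.U _ hXlt _ ((x.res_lt hP p).trans_le hPQ)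
      rw [hi, hs.D, hs.Q, Int.toNat_natCast, hs.A, WeightedGraph.entry, ← e25]
      congr 2
    · refine Runs.seq (T := 1) (T' := 1) (Runs.store (p := j) rfl rfl hi rfl (fun h => by omega)
        (Runs.store (p := j) rfl rfl hi rfl (fun h => by omega) ?_))
      intro i
      constructor
      · change ((m'.set 34 0 p).set 35 0 _).set 65 j _ 65 i = _
        rw [Memory.set_apply]
        rcases eq_or_ne i j with rfl | hne
        · simp only [true_and, if_true, Nat.lt_succ_self]; rfl
        · simp only [true_and, if_neg hne]
          rw [if_congr (show i < j + 1 ↔ i < j by omega) rfl rfl]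
          exact (h1 i).1
      · rw [Memory.set_apply]
        rcases eq_or_ne i j with rfl | hne
        · simp only [true_and, if_true, Nat.lt_succ_self]; rfl
        · simp only [true_and, if_neg hne]
          rw [if_congr (show i < j + 1 ↔ i < j by omega) rfl rfl]
          exact (h1 i).2
  · rintro m' - ⟨h1, -⟩; exact h1

/-- The matrix number `X`. -/
def entryMatrix (x : WeightedGraph) (k P X : ℕ) : Matrix (Fin x.n) (Fin x.n) ℤ :=
  Matrix.of fun i j => x.entry k P X ((i : ℕ) * x.n + j)

theorem rowMajor_entryMatrix (x : WeightedGraph) (k P X p : ℕ) :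
    rowMajor (entryMatrix x k P X) p = if p < x.n * x.n then x.entry k P X p else 0 := by
  split_ifs with h
  · have h0 : 0 < x.n := Nat.pos_of_ne_zero (by intro h'; rw [h'] at h; simp at h)
    have h1 : p / x.n < x.n := Nat.div_lt_of_lt_mul h
    have h2 := rowMajor_apply (entryMatrix x k P X) ⟨p / x.n, h1⟩ ⟨p % x.n, Nat.mod_lt _ h0⟩
    have h3 : p / x.n * x.n + p % x.n = p := Nat.div_add_mod' p x.n
    simp only [entryMatrix, Matrix.of_apply, h3] at h2 ⊢
    exact h2
  · exact rowMajor_of_le _ (by omega)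

/-- `c` multiplies matrices with entries bounded by `1` in time `f n`. -/
def Multiplies (c : Prog) (f : ℕ → ℕ) : Prop :=
  c.Deterministic ∧ ∀ (n : ℕ) (A B : Matrix (Fin n) (Fin n) ℤ),
    (∀ i j, (A i j).natAbs ≤ 1) → (∀ i j, (B i j).natAbs ≤ 1) →
    ∃ (s : State) (t : ℕ), Exec c ⟨matMulInput A B, fun _ => false⟩ s t ∧ t ≤ f n ∧
      ∀ i j : Fin n, s.mem 3 (finProdFinEquiv (i, j)) = (A * B) i j

theorem Multiplies.square {c : Prog} {f : ℕ → ℕ} (hc : Multiplies c f) (x : WeightedGraph)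
    (k P X : ℕ) : ∃ (s : State) (t : ℕ),
      Exec c ⟨matMulInput (entryMatrix x k P X) (entryMatrix x k P X), fun _ => false⟩ s t ∧
      t ≤ f x.n ∧ ∀ p < x.n * x.n, s.mem 3 p = x.square k P X p := by
  have hb : ∀ i j, (entryMatrix x k P X i j).natAbs ≤ 1 := fun i j => by
    have := x.abs_entry_le k P X ((i : ℕ) * x.n + j)
    rw [Int.abs_eq_natAbs] at this
    exact_mod_cast this
  obtain ⟨s, t, h1, h2, h3⟩ := hc.2 x.n _ _ hb hb
  refine ⟨s, t, h1, h2, fun p hp => ?_⟩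
  have h0 : 0 < x.n := Nat.pos_of_ne_zero (by intro h'; rw [h'] at hp; simp at hp)
  have h4 := h3 ⟨p / x.n, Nat.div_lt_of_lt_mul hp⟩ ⟨p % x.n, Nat.mod_lt _ h0⟩
  have h5 : (finProdFinEquiv ((⟨p / x.n, Nat.div_lt_of_lt_mul hp⟩ : Fin x.n),
      (⟨p % x.n, Nat.mod_lt _ h0⟩ : Fin x.n)) : ℕ) = p := by
    simp [finProdFinEquiv, Nat.mod_add_div]
  rw [h5, mul_apply_eq_sum_rowMajor] at h4
  rw [h4, WeightedGraph.square]
  refine Finset.sum_congr rfl fun b hb => ?_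
  rw [Finset.mem_range] at hb
  rw [rowMajor_entryMatrix, rowMajor_entryMatrix,
    if_pos (mul_add_lt (Nat.div_lt_of_lt_mul hp) hb), if_pos (mul_add_lt hb (Nat.mod_lt _ h0))]

/-- The number of steps of `callAll`. -/
def callSteps (c : Prog) (f : ℕ → ℕ) (x : WeightedGraph) : ℕ :=
  π.D x * (1 + c.overhead * (2 * intCost (π.D x)) * f x.n + 2) + 2

theorem writes_lift {c : Prog} (hc : c.Deterministic) : ∀ a ∈ c.lift.writes, 64 ≤ a := by
  induction c with
  | skip => simp [Prog.lift, Prog.writes]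
  | write a i e => simp [Prog.lift, Prog.writes]
  | flip a i => exact hc.elim
  | seq c d ih1 ih2 =>
    simp only [Prog.lift, Prog.writes, List.mem_append]
    rintro a (h | h)
    exacts [ih1 hc.1 a h, ih2 hc.2 a h]
  | ite e c d ih1 ih2 =>
    simp only [Prog.lift, Prog.writes, List.mem_append]
    rintro a (h | h)
    exacts [ih1 hc.1 a h, ih2 hc.2 a h]
  | _ e c ih => exact ih hc

/-- The invariant records that cells of residue at least `j` are still in their initial state, so
run `j` starts from exactly the memory that the multiplication program expects. -/
theorem callAll_runs (h : Setup π x m) {c : Prog} {f : ℕ → ℕ} (hc : Multiplies c f)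
    (h65 : ∀ a, a = 65 ∨ a = 66 → ∀ i, m a i =
      if i < x.n * x.n * π.D x then x.entry (π.k x) P (i % π.D x) (i / π.D x) else 0)
    (h67 : ∀ a, 64 ≤ a → a ≠ 65 → a ≠ 66 → ∀ p, m a p = 0) :
    Runs (π.H x) (callAll c) m (callSteps π c f x) (fun m' => (∀ a < 64, a ≠ 13 → m' a = m a) ∧
      ∀ p < x.n * x.n, ∀ X < π.D x, m' 67 (p * π.D x + X) = x.square (π.k x) P X p) := by
  set D := π.D x with hDdef
  have hwr : ∀ a < 64, a ∉ (.write 64 (V 13) (V 3) ;; c.lift : Prog).writes := by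
    intro a ha h'
    simp only [Prog.writes, List.mem_append, List.mem_singleton] at h'
    rcases h' with h' | h'
    · omega
    · have := writes_lift hc.1 a h'; omega
  refine (Runs.forLoop (i := 13) (v := 11) (N := D)
    (T := 1 + c.overhead * (2 * intCost D) * f x.n)
    (fun j m' => (∀ a < 64, a ≠ 13 → m' a = m a) ∧
      (∀ p < x.n * x.n, ∀ X < j, m' 67 (p * D + X) = x.square (π.k x) P X p) ∧
      ∀ a ≥ 64, ∀ p, j ≤ p % D → m' a p = m a p)
    ⟨by norm_num, hwr 13 (by norm_num), by norm_num, hwr 11 (by norm_num), by norm_num⟩ h.D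
    ?_ ?_ ?_).mono le_rfl ?_
  · exact ⟨fun _ _ _ => rfl, fun _ _ X hX => absurd hX (by omega), fun _ _ _ _ => rfl⟩
  · rintro j m' z ⟨h1, h2, h3⟩
    refine ⟨fun a ha ha' => ?_, h2, fun a ha p hp => ?_⟩
    · rw [Memory.set_ne _ ha']; exact h1 a ha ha'
    · rw [Memory.set_ne _ (by omega)]; exact h3 a ha p hp
  · rintro j hj m' hfr hi ⟨h1, h2, h3⟩
    have e11 : m' 11 0 = D := by rw [h1 11 (by norm_num) (by norm_num)]; exact h.D
    have e3 : m' 3 0 = x.n := by rw [h1 3 (by norm_num) (by norm_num)]; exact h.n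
    refine Runs.seq (Runs.store (p := j) (v := x.n) rfl rfl hi e3 (fun h => by omega) ?_)
    obtain ⟨s, t, k1, k2, k3⟩ := hc.square x (π.k x) P j
    have hmod : ∀ p, (p * D + j) % D = j := fun p => mul_add_mod_of_lt hj p
    have hdiv : ∀ p, (p * D + j) / D = p := fun p => mul_add_div_of_lt hj p
    have hsim : Sim D j (matMulInput (entryMatrix x (π.k x) P j) (entryMatrix x (π.k x) P j))
        (m'.set 64 j x.n) := by
      refine ⟨e11, hi, fun a p => ?_⟩
      have hin : ∀ b, b = 65 ∨ b = 66 → m' b (p * D + j) =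
          rowMajor (entryMatrix x (π.k x) P j) p := by
        intro b hb
        rw [h3 b (by omega) _ (hmod p).ge, h65 b hb, hmod, hdiv, rowMajor_entryMatrix]
        refine if_congr ⟨fun h' => ?_, fun h' => mul_add_lt h' hj⟩ rfl rfl
        exact lt_of_mul_lt_mul_right ((Nat.le_add_right _ _).trans_lt h') (Nat.zero_le D)
      match a with
      | 0 =>
        rw [Memory.set_apply, matMulInput, scalar]
        rcases eq_or_ne p 0 with rfl | hp
        · simp
        · have : p * D + j ≠ j := by
            have : 0 < p * D := Nat.mul_pos (Nat.pos_of_ne_zero hp) (π.D_pos x)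
            omega
          rw [if_neg (by tauto), if_neg hp, h3 _ (by omega) _ (hmod p).ge,
            h67 _ (by omega) (by omega) (by omega)]
      | 1 => rw [Memory.set_ne _ (by omega)]; exact hin 65 (.inl rfl)
      | 2 => rw [Memory.set_ne _ (by omega)]; exact hin 66 (.inr rfl)
      | a + 3 =>
        rw [Memory.set_ne _ (by omega), h3 _ (by omega) _ (hmod p).ge,
          h67 _ (by omega) (by omega) (by omega)]
        rfl
    intro hb r
    obtain ⟨m2, t2, l1, l2, l3, l4, l5⟩ := k1.lift hj hc.1 _ r hsim
    refine ⟨m2, t2, l1, ?_, fun a ha p => by rw [l4 a ha]; exact hb a ha p, ?_, ?_, ?_⟩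
    · have hE : intCost (D : ℤ) + intCost (j : ℤ) ≤ 2 * intCost (D : ℤ) := by
        have : intCost (j : ℤ) ≤ intCost (D : ℤ) := by
          unfold intCost; simp only [Int.natAbs_natCast]
          exact Nat.add_le_add_right (Nat.size_le_size hj.le) 1
        omega
      calc t2 ≤ c.overhead * (2 * intCost (D : ℤ)) * f x.n := l2.trans (by gcongr)
        -- The simulated time already includes all costs; the weight that `Runs` multiplies it by is
        -- mere slack.
        _ ≤ _ := Nat.le_mul_of_pos_right _ (Nat.mul_pos c.lift.wt_pos (Nat.succ_pos _))
    · intro a ha ha'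
      rw [l4 a ha, Memory.set_ne _ (by omega)]; exact h1 a ha ha'
    · intro p hp X hX
      rcases eq_or_ne X j with rfl | hne
      · rw [← k3 p hp, ← l3.cell 3 p]
      · rw [l5 67 _ (by rw [mul_add_mod_of_lt (by omega : X < D)]; exact hne),
          Memory.set_ne _ (by norm_num)]
        exact h2 p hp X (by omega)
    · intro a ha p hp
      rw [l5 a p (by omega), Memory.set_apply, if_neg, h3 a ha p (by omega)]
      rintro ⟨-, rfl⟩
      rw [Nat.mod_eq_of_lt hj] at hp
      omega
  · rintro m' - ⟨⟨h1, h2, -⟩, -⟩; exact ⟨h1, h2⟩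

/-- The base code is `i * n * n`, so its quotient by `n` is the number of matrix entries in the rows
below `i`, and these precede all others in memory. -/
theorem accumulate_runs (h : Setup π x m) (hP : 0 < P) (hm : m 18 0 = P) (hPQ : P ≤ π.Q x)
    (hT : Tables (π.k x) P m) {i : ℕ} (hi : i ≤ x.n) (h21 : m 21 0 = (i * x.n * x.n : ℕ))
    (h67 : ∀ p < x.n * x.n, ∀ X < π.D x, m 67 (p * π.D x + X) = x.square (π.k x) P X p) :
    Runs (π.H x) accumulate m (1 + (1 + (i * x.n * π.D x * 4 + 2)))
      (fun m' => m' 22 0 = x.count P (i * x.n * x.n)) := by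
  set D := π.D x with hDdef
  have hD : 0 < D := π.D_pos x
  set N := i * x.n * D with hN
  have hin : i * x.n ≤ x.n * x.n := Nat.mul_le_mul_right _ hi
  have hNs : Small x 4 N := ((Small.n2 x).of_le hin).mul (.D π x)
  let F : ℕ → ℤ := fun j => x.A (j / D) * kV (π.k x) P (j % D) (x.res P (j / D)) *
    x.square (π.k x) P (j % D) (j / D)
  have hF : ∀ j, |F j| ≤ (π.Q x * x.n : ℕ) := fun j => by
    have h1 := x.abs_A_le (j / D)
    have h2 := abs_kV_le (π.k x) P (j % D) (x.res P (j / D))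
    have h3 := x.abs_square_le (π.k x) P (j % D) (j / D)
    simp only [F, abs_mul]
    push_cast
    refine mul_le_mul ?_ h3 (abs_nonneg _) (by positivity)
    have := mul_le_mul h1 h2 (abs_nonneg _) zero_le_one
    simpa [Params.Q] using this
  have hsum : ∑ j ∈ Finset.range N, F j = x.count P (i * x.n * x.n) := by
    rw [← x.sum_square_eq_count (k := π.k x) hP hPQ, hN, sum_range_mul_eq]
    refine Finset.sum_congr rfl fun p _ => Finset.sum_congr rfl fun X hX => ?_
    rw [Finset.mem_range] at hX
    simp only [F]
    rw [mul_add_div_of_lt (show X < D from hX), mul_add_mod_of_lt (show X < D from hX)]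
  refine Runs.seq (Runs.assign rfl (v := 0) rfl (by simp)
    (Runs.seq (Runs.assign (v := N) rfl ?_ (hNs.abs_le_H π) ?_)))
  · change m 21 0 / m 3 0 * m 11 0 = _
    rw [h.n, h21, h.D]
    norm_cast
    rw [hN]
    congr 1
    rcases Nat.eq_zero_or_pos x.n with h0 | h0
    · simp [h0]
    · exact Nat.mul_div_cancel _ h0
  refine (Runs.forLoop (i := 12) (v := 14) (N := N) (T := 2)
    (fun j m' => m' 22 0 = ∑ j ∈ Finset.range j, F j)
    (by decide) rfl ?_ (fun _ _ _ h => h) ?_).mono le_rfl ?_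
  · rfl
  · rintro j hj m' hfr hi h22
    have hs : Setup π x m' := ((h.set (a := 22) 0 0 (by decide)).set (a := 14) 0 N
      (by decide)).frame fun a ha => hfr a ((by decide : ∀ a ∈ setupArrays, a ≠ 12) a ha)
        ((by decide : ∀ a ∈ setupArrays, a ∉ _) a ha)
    have e18 : m' 18 0 = P := by rw [hfr 18 (by decide) (by decide)]; exact hm
    have hT' : Tables (π.k x) P m' := hT.frame (hfr 25 (by decide) (by decide))
      (hfr 28 (by decide) (by decide))
    have e67 : m' 67 j = x.square (π.k x) P (j % D) (j / D) := by
      rw [hfr 67 (by decide) (by decide)]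
      change m 67 j = _
      rw [← h67 (j / D) ((Nat.div_lt_of_lt_mul (by rw [mul_comm]; exact hj)).trans_le hin) (j % D)
        (Nat.mod_lt _ hD), Nat.div_add_mod']
    set p := j / D with hp
    have hXlt : j % D < D := Nat.mod_lt _ hD
    have e0 : (V 12 / V 11 : Expr).eval m' = p := by
      rw [eval_div, eval_V, eval_V, hi, hs.D]; norm_cast
    refine Runs.seq (T := 1) (T' := 1) (Runs.assign rfl e0
      ((hNs.of_le ((Nat.div_le_self _ _).trans hj.le)).abs_le_H π) ?_)
    have hs1 : Setup π x (m'.set 34 0 p) := hs.set 0 _ (by decide)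
    have hval : (V 22 + .read 4 (V 34) * .read 28 (V 12 % V 11 * V 18 + .read 5 (V 34) % V 18) *
        .read 67 (V 12) : Expr).eval (m'.set 34 0 p) = ∑ j ∈ Finset.range (j + 1), F j := by
      have er := eval_res (x := x) (m := m'.set 34 0 p) (e := V 34) (p := p) hs1.toHolds hP e18 rfl
      rw [eval_add, eval_mul, eval_mul, eval_read (a := 28), eval_add, er, eval_mul, eval_mod]
      change m' 22 0 + m' 4 (p : ℤ).toNat *
        m' 28 (m' 12 0 % m' 11 0 * m' 18 0 + x.res P p).toNat * m' 67 (m' 12 0).toNat = _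
      have e28 := hT'.V _ hXlt _ (x.res_lt hP p)
      rw [hi, hs.D, e18, Int.toNat_natCast, Int.toNat_natCast, hs.A, e67, h22,
        Finset.sum_range_succ]
      congr 1
      simp only [F]
      rw [← e28]
      congr 3
    -- Array `67` may contain large leftovers of the simulated runs, but the cell read here is an
    -- entry of a matrix square and hence at most `n`.
    refine Runs.write' rfl (fun hb => ⟨hb.reads rfl, ⟨hb.reads rfl, hb.reads rfl⟩, hb.reads rfl, ?_⟩)
      (fun _ => ?_) ?_
    · change |m' 67 (m' 12 0).toNat| ≤ _
      rw [hi, Int.toNat_natCast, e67]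
      have := (Small.n x).abs_le_H π
      rw [Nat.abs_cast] at this
      exact (x.abs_square_le _ _ _ _).trans this
    · rw [hval]
      refine (Finset.abs_sum_le_sum_abs _ _).trans
        ((Finset.sum_le_card_nsmul _ _ _ (fun i _ => hF i)).trans ?_)
      rw [Finset.card_range, nsmul_eq_mul]
      have := ((hNs.of_le hj).mul ((Small.Q π x).mul (Small.n x))).abs_le_H π
      rw [Nat.abs_cast] at this
      exact_mod_cast this
    · rw [hval]; rfl
  · rintro m' - ⟨h1, -⟩; rw [h1, hsum]

/-- The number of steps of `countProg`. -/
def countSteps (c : Prog) (f : ℕ → ℕ) (x : WeightedGraph) : ℕ :=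
  (1 + (1 + (1 + (1 + (π.D x * π.Q x * 10 + 2))))) + ((1 + (x.n * x.n * π.D x * 6 + 2)) +
    (callSteps π c f x + (1 + (1 + (x.n * x.n * π.D x * 4 + 2)))))

theorem countProg_runs (h : Setup π x m) {c : Prog} {f : ℕ → ℕ} (hc : Multiplies c f)
    (hP : 0 < P) (hm : m 18 0 = P) (hPQ : P ≤ π.Q x) {i : ℕ} (hi : i ≤ x.n)
    (h21 : m 21 0 = (i * x.n * x.n : ℕ)) (h28 : ∀ p, m 28 p = 0)
    (h64 : ∀ a, 64 ≤ a → ∀ p, m a p = 0) :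
    Runs (π.H x) (countProg c) m (countSteps π c f x)
      (fun m' => m' 22 0 = x.count P (i * x.n * x.n) ∧
        ∀ a < 64, a ∉ [12, 13, 14, 22, 25, 26, 27, 28, 34, 35, 36, 37] → m' a = m a) := by
  refine Runs.seq ((tables_runs π h hP hm hPQ h28).frame.mono le_rfl ?_)
  rintro m1 - ⟨hT1, hf1⟩
  have h1 : Setup π x m1 := h.frame fun a ha =>
    hf1 a ((by decide : ∀ a ∈ setupArrays, a ∉ tables.writes) a ha)
  have hz1 : ∀ a, 64 ≤ a → ∀ p, m1 a p = 0 := fun a ha p => by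
    rw [hf1 a, h64 a ha]
    exact fun h' => absurd ((by decide : ∀ a ∈ tables.writes, a < 64) a h') (by omega)
  have e18 : m1 18 0 = P := by rw [hf1 18 (by decide), hm]
  refine Runs.seq ((fillInputs_runs π h1 hP e18 hPQ hT1 (hz1 65 (by norm_num))
    (hz1 66 (by norm_num))).frame.mono le_rfl ?_)
  rintro m2 - ⟨hI, hf2⟩
  have h2 : Setup π x m2 := h1.frame fun a ha =>
    hf2 a ((by decide : ∀ a ∈ setupArrays, a ∉ fillInputs.writes) a ha)
  refine Runs.seq ((callAll_runs π (P := P) h2 hc ?_ ?_).mono le_rfl ?_)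
  · rintro a (rfl | rfl) i
    · exact (hI i).1
    · exact (hI i).2
  · intro a ha h65 h66 p
    rw [hf2 a, hz1 a ha]
    exact fun h' => absurd ((by decide : ∀ a ∈ fillInputs.writes, a < 64 ∨ a = 65 ∨ a = 66) a h')
      (by omega)
  rintro m3 - ⟨hf3, h67⟩
  have h3 : Setup π x m3 := h2.frame fun a ha =>
    hf3 a ((by decide : ∀ a ∈ setupArrays, a < 64) a ha)
      ((by decide : ∀ a ∈ setupArrays, a ≠ 13) a ha)
  have hT3 : Tables (π.k x) P m3 := hT1.frame
    (by rw [hf3 25 (by norm_num) (by norm_num), hf2 25 (by decide)])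
    (by rw [hf3 28 (by norm_num) (by norm_num), hf2 28 (by decide)])
  refine ((accumulate_runs π h3 hP ?_ hPQ hT3 hi ?_ h67).frame).mono ?_ ?_
  · rw [hf3 18 (by norm_num) (by norm_num), hf2 18 (by decide), e18]
  · rw [hf3 21 (by norm_num) (by norm_num), hf2 21 (by decide), hf1 21 (by decide), h21]
  · gcongr
  · rintro m4 - ⟨h22, hf4⟩
    refine ⟨h22, fun a ha hna => ?_⟩
    have w1 : a ∉ tables.writes := fun h' => hna ((by decide : ∀ a ∈ tables.writes, a ∈ _) a h')
    have w2 : a ∉ fillInputs.writes := fun h' => by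
      rcases (by decide : ∀ a ∈ fillInputs.writes, 64 ≤ a ∨
        a ∈ [12, 13, 14, 22, 25, 26, 27, 28, 34, 35, 36, 37]) a h' with h' | h'
      · omega
      · exact hna h'
    have w4 : a ∉ accumulate.writes := fun h' => hna
      ((by decide : ∀ a ∈ accumulate.writes, a ∈ _) a h')
    have w3 : a ≠ 13 := fun h' => hna (by rw [h']; decide)
    rw [hf4 a w4, hf3 a ha w3, hf2 a w2, hf1 a w1]

end

end PsdProof

end

noncomputable section

namespace PsdProof

local infixr:60 " ;; " => Prog.seq

/-! ### Truth values stored in variables. -/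

open Classical in
/-- The number `1` if `p` holds, and else `0`. -/
def flag (p : Prop) : ℤ := if p then 1 else 0

theorem flag_true {p : Prop} (h : p) : flag p = 1 := if_pos h
theorem flag_false {p : Prop} (h : ¬p) : flag p = 0 := if_neg h
theorem flag_pos {p : Prop} : 0 < flag p ↔ p := by unfold flag; split_ifs with h <;> simp [h]
theorem flag_congr {p q : Prop} (h : p ↔ q) : flag p = flag q := by rw [propext h]

/-! ### Reading a message

A message is a sequence of numbers, each given by `L` bits (the most significant one first). -/

/-- The number given by the `l` bits from position `o` on. -/
def field (b : Message) (o : ℕ) : ℕ → ℕ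
  | 0 => 0
  | l + 1 => 2 * field b o l + if b (o + l) then 1 else 0

theorem field_lt (b : Message) (o l : ℕ) : field b o l < 2 ^ l := by
  induction l with
  | zero => simp [field]
  | succ l ih => rw [field, pow_succ]; split_ifs <;> omega

/-- Decode as many fields as variable `38` says. -/
def decode (a : ℕ) : Prog :=
  .write 14 0 (V 38 * V 15) ;;
  forLoop 12 14 (.write a (V 12 / V 15) (2 * .read a (V 12 / V 15) + .read 0 (V 12)))

theorem decode_runs (π : Params) {x : WeightedGraph} {m : Memory} (h : Setup π x m) {a F : ℕ}
    (ha : a = 20 ∨ a = 23) {b : Message} (hb : ∀ p, m 0 p = if b p then 1 else 0)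
    (hz : ∀ p, m a p = 0) (hF : m 38 0 = F) (hFs : Small x 4 F) :
    Runs (π.H x) (decode a) m (1 + (F * (3 * x.len) * 3 + 2)) (fun m' =>
      (∀ f < F, m' a f = field b (f * (3 * x.len)) (3 * x.len)) ∧
      ∀ a', a' ≠ 12 → a' ≠ 14 → a' ≠ a → m' a' = m a') := by
  set L := 3 * x.len with hL
  have hL0 : 0 < L := by have := x.two_le_len; omega
  have hLs : Small x 2 L := (Small.lit (c := 3)).mul (.len x)
  have hN : Small x 6 (F * L) := hFs.mul hLs
  refine Runs.seq (Runs.assign (v := (F * L : ℕ)) rfl ?_ (hN.abs_le_H π) ?_)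
  · change m 38 0 * m 15 0 = _; rw [hF, h.L]; push_cast; rfl
  have hside : 12 < 64 ∧ 12 ∉ (Prog.write a (V 12 / V 15)
      (2 * .read a (V 12 / V 15) + .read 0 (V 12))).writes ∧ 14 < 64 ∧ 14 ∉ (Prog.write a (V 12 / V 15)
      (2 * .read a (V 12 / V 15) + .read 0 (V 12))).writes ∧ 14 ≠ 12 := by
    rcases ha with rfl | rfl <;> decide
  -- After `j` bits, field `f` has received `min (j - f * L) L` of its own. Truncated subtraction
  -- accounts for the fields not yet reached.
  refine (Runs.forLoop (i := 12) (v := 14) (N := F * L) (T := 1) (fun j m' =>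
    (∀ f, m' a f = field b (f * L) (min (j - f * L) L)) ∧
      ∀ a', a' ≠ 12 → a' ≠ 14 → a' ≠ a → m' a' = m a') hside (Memory.set_self _ _ _ _)
    ?_ ?_ ?_).mono le_rfl ?_
  · refine ⟨fun f => ?_, fun a' _ h14 _ => Memory.set_ne _ h14 _ _⟩
    rw [Nat.zero_sub, Nat.zero_min, Memory.set_ne _ (by omega), hz]; rfl
  · rintro j m' z ⟨h1, h2⟩
    refine ⟨fun f => ?_, fun a' k1 k2 k3 => ?_⟩
    · rw [Memory.set_ne _ (by omega)]; exact h1 f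
    · rw [Memory.set_ne _ k1]; exact h2 a' k1 k2 k3
  · rintro j hj m' hfr hi ⟨h1, h2⟩
    have e15 : m' 15 0 = L := by rw [h2 15 (by omega) (by omega) (by omega)]; exact h.L
    have e0 : m' 0 j = if b j then 1 else 0 := by
      rw [h2 0 (by omega) (by omega) (by omega)]; exact hb j
    have hdiv : (V 12 / V 15 : Expr).eval m' = (j / L : ℕ) := by
      rw [eval_div, eval_V, eval_V, hi, e15]; norm_cast
    have hmin : min (j - j / L * L) L = j % L := by
      have := Nat.div_add_mod' j L
      have := Nat.mod_lt j hL0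
      omega
    have hmin' : min (j + 1 - j / L * L) L = j % L + 1 := by
      have := Nat.div_add_mod' j L
      have := Nat.mod_lt j hL0
      omega
    refine Runs.store (p := j / L) (v := (field b (j / L * L) (j % L + 1) : ℕ)) rfl ?_ hdiv ?_
      (fun _ => ?_) ⟨fun f => ?_, fun a' k1 k2 k3 => ?_⟩
    · rcases ha with rfl | rfl <;> rfl
    · rw [eval_add, eval_mul, eval_two, eval_read, eval_read, hdiv, eval_V, hi, Int.toNat_natCast,
        Int.toNat_natCast, e0, h1, hmin, field, Nat.div_add_mod']
      push_cast
      rfl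
    · refine Small.abs_le_H (x := x) (a := 3) π ?_
      unfold Small
      refine (field_lt _ _ _).le.trans (Nat.pow_le_pow_right (by norm_num) ?_)
      have := Nat.mod_lt j hL0
      omega
    · rw [Memory.set_apply]
      rcases eq_or_ne f (j / L) with rfl | hne
      · rw [if_pos ⟨rfl, rfl⟩, hmin']
      · rw [if_neg (fun h => hne h.2), h1]
        suffices hm : min (j - f * L) L = min (j + 1 - f * L) L by rw [hm]
        rcases lt_or_gt_of_ne hne with hlt | hlt
        · have h3 := Nat.mul_le_mul_right L (show f + 1 ≤ j / L from hlt)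
          have h4 := Nat.div_add_mod' j L
          rw [add_mul] at h3
          omega
        · have h3 := Nat.mul_le_mul_right L (show j / L + 1 ≤ f from hlt)
          have h4 := Nat.div_add_mod' j L
          have h5 := Nat.mod_lt j hL0
          rw [add_mul] at h3
          omega
    · rw [Memory.set_ne _ k3]; exact h2 a' k1 k2 k3
  · rintro m' - ⟨⟨h1, h2⟩, -⟩
    refine ⟨fun f hf => ?_, h2⟩
    have h3 := Nat.mul_le_mul_right L (show f + 1 ≤ F from hf)
    rw [add_mul] at h3
    rw [h1, show min (F * L - f * L) L = L by omega]

/-! ### The verifier -/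

/-- Variable `21` becomes the code of the first triple with the first vertex of `V 16`. -/
def baseProg : Prog := .write 21 0 (V 16 / V 3 / V 3 * V 3 * V 3)

/-- Look for a triangle of weight zero in the range from `V 21` to `V 16`. -/
def bruteProg : Prog :=
  .write 14 0 (V 16 - V 21) ;; forLoop 12 14 (.ite (zeroE (V 21 + V 12)) (.write 19 0 0) .skip)

/-- Variable `24` holds the previous entry, so the test enforces a strictly increasing list and
hence distinct entries. -/
def checkEntry : Prog :=
  .write 39 0 (.read 23 (V 13 + 2)) ;;
  .ite (V 39 - V 24) (.ite (V 21 - V 39) (.ite (falseE (V 39) (V 18)) .skip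
    (.write 19 0 0)) (.write 19 0 0)) (.write 19 0 0) ;;
  .write 24 0 (V 39)

/-- Check the list of false positives. -/
def listCheck : Prog :=
  .write 38 0 (V 22 + 2) ;; decode 23 ;; .write 24 0 (0 - 1) ;; forLoop 13 22 checkEntry

def outputProg : Prog :=
  .write 2 1 (V 16 / V 3 / V 3) ;; .write 2 2 (V 16 / V 3 % V 3) ;; .write 2 3 (V 16 % V 3) ;;
  .write 2 0 1

/-- The test that the number of false positives is small enough. -/
def guardE (π : Params) : Expr :=
  (V 3).pow (3 * π.g) * (V 8 + 1).pow (π.g - 1) + 1 - (V 22).pow π.g * (V 9).pow (π.g - 1)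

/-- The guard on the count comes before the list is read, so that no message can make the verifier
exceed its time. -/
def verifierMain (π : Params) (c : Prog) : Prog :=
  .write 19 0 1 ;; baseProg ;; bruteProg ;; countProg c ;;
  .ite (guardE π) listCheck (.write 19 0 0) ;; .ite (V 19) outputProg .skip

def header : Prog :=
  .write 38 0 2 ;; decode 20 ;; .write 16 0 (.read 20 0) ;; .write 18 0 (.read 20 1)

/-- Since the received modulus is nonnegative, the product test on it says that it lies between `1`
and `Q`. -/
def verifierProg (π : Params) (c : Prog) : Prog :=
  prelude π ;; header ;;
  .ite (V 3 * V 3 * V 3 - V 16) (.ite (V 18 * (V 9 + 1 - V 18)) (.ite (zeroE (V 16))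
    (verifierMain π c) .skip) .skip) .skip

section
variable (π : Params) {x : WeightedGraph} {m : Memory}

/-- The first code with the same first vertex as `T`. -/
def WeightedGraph.base (x : WeightedGraph) (T : ℕ) : ℕ := T / x.n / x.n * x.n * x.n

theorem WeightedGraph.base_le (x : WeightedGraph) (T : ℕ) : x.base T ≤ T := by
  unfold base
  calc T / x.n / x.n * x.n * x.n ≤ T / x.n * x.n := Nat.mul_le_mul_right _ (Nat.div_mul_le_self _ _)
    _ ≤ T := Nat.div_mul_le_self _ _

/-- Within the block of one first vertex there are only `n * n` triples, few enough for brute force.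
-/
theorem WeightedGraph.sub_base_le (x : WeightedGraph) {T : ℕ} (hT : T < x.n * x.n * x.n) :
    T - x.base T ≤ x.n * x.n := by
  have h0 : 0 < x.n := Nat.pos_of_ne_zero (by intro h; simp [h] at hT)
  unfold base
  rw [Nat.div_div_eq_div_mul, mul_assoc]
  have h1 := Nat.div_add_mod' T (x.n * x.n)
  have h2 := Nat.mod_lt T (Nat.mul_pos h0 h0)
  omega

theorem WeightedGraph.index_le (x : WeightedGraph) {T : ℕ} (hT : T ≤ x.n * x.n * x.n) :
    T / x.n / x.n ≤ x.n := by
  rcases Nat.eq_zero_or_pos x.n with h0 | h0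
  · simp [h0]
  · rw [Nat.div_div_eq_div_mul]
    exact Nat.div_le_of_le_mul hT

theorem baseProg_runs (h : Holds x m) {T : ℕ} (hT : T ≤ x.n * x.n * x.n) (h16 : m 16 0 = T) :
    Runs (π.H x) baseProg m 1 (fun m' => m' = m.set 21 0 (x.base T)) := by
  refine Runs.assign rfl (v := (x.base T : ℕ)) ?_ (Small.abs_le_H (a := 3) π ?_) rfl
  · simp only [eval_mul, eval_div, eval_V, h16, h.n, WeightedGraph.base]; push_cast; rfl
  · exact (Small.n3 x).of_le ((x.base_le T).trans hT)

theorem bruteProg_runs (h : Holds x m) {T : ℕ} (hT : T < x.n * x.n * x.n) (h16 : m 16 0 = T)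
    (h21 : m 21 0 = x.base T) (h19 : m 19 0 = 1) :
    Runs (π.H x) bruteProg m (1 + (x.n * x.n * 4 + 2)) (fun m' =>
      m' 19 0 = flag (∀ t, x.base T ≤ t → t < T → ¬ x.Zero t)) := by
  have hb := x.base_le T
  have hs : Small x 3 (T - x.base T) := (Small.n3 x).of_le (by omega)
  refine Runs.seq (Runs.assign (v := (T - x.base T : ℕ)) rfl ?_ (hs.abs_le_H π) ?_)
  · rw [eval_sub, eval_V, eval_V, h16, h21, Nat.cast_sub hb]
  refine (Runs.forLoop (i := 12) (v := 14) (N := T - x.base T) (T := 2) (fun j m' =>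
    m' 19 0 = flag (∀ t < j, ¬ x.Zero (x.base T + t))) (by decide) rfl ?_ (fun _ _ _ h => h)
    ?_).mono ?_ ?_
  · exact h19.trans (flag_true (by intro t ht; omega)).symm
  · rintro j hj m' hfr hi h1
    have hh : Holds x m' := (h.set (a := 14) 0 (T - x.base T : ℕ) (by decide)).frame fun a ha =>
      hfr a ((by decide : ∀ a ∈ [3, 4, 5], a ≠ 12) a ha)
        ((by decide : ∀ a ∈ [3, 4, 5], a ∉ _) a ha)
    have e : (V 21 + V 12 : Expr).eval m' = (x.base T + j : ℕ) := by
      rw [eval_add, eval_V, eval_V, hi, hfr 21 (by decide) (by decide)]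
      change m 21 0 + _ = _
      rw [h21]; push_cast; rfl
    refine Runs.ite (T := 1) rfl (fun hz => ?_) (fun hz => ?_)
    · rw [eval_zeroE hh e] at hz
      refine Runs.assign rfl (v := 0) rfl (by simp) ?_
      rw [flag_false (fun h => h j (Nat.lt_succ_self j) hz)]
      rfl
    · rw [eval_zeroE hh e] at hz
      refine Runs.skip (h1.trans (flag_congr ⟨fun h t ht => ?_, fun h t ht => h t (by omega)⟩))
      rcases eq_or_ne t j with rfl | hne
      · exact hz
      · exact h t (by omega)
  · have := x.sub_base_le hT
    gcongr
  · rintro m' - ⟨h1, -⟩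
    refine h1.trans (flag_congr ⟨fun h t h1 h2 => ?_, fun h t ht => h _ (by omega) (by omega)⟩)
    have := h (t - x.base T) (by omega)
    rwa [Nat.add_sub_cancel' h1] at this

/-- The entry number `q` of the list is admissible. -/
def GoodEntry (x : WeightedGraph) (P N : ℕ) (v : ℕ → ℕ) (q : ℕ) : Prop :=
  (∀ p, p + 1 = q → v p < v q) ∧ v q < N ∧ x.ZeroMod P (v q) ∧ x.wt (v q) ≠ 0

theorem checkEntry_runs (h : Holds x m) {P N q : ℕ} {v : ℕ → ℕ} {p : Prop} (hP : 0 < P)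
    (h18 : m 18 0 = P) (h21 : m 21 0 = N) (h13 : m 13 0 = q) (hv : m 23 (q + 2) = v q)
    (hvs : Small x 3 (v q)) (h24 : m 24 0 = if q = 0 then -1 else (v (q - 1) : ℤ))
    (h19 : m 19 0 = flag p) :
    Runs (π.H x) checkEntry m 6 (fun m' => m' 19 0 = flag (p ∧ GoodEntry x P N v q) ∧
      m' 24 0 = v q) := by
  refine Runs.seq (T := 1) (T' := 5) (Runs.assign rfl (v := v q) ?_ (hvs.abs_le_H π) ?_)
  · rw [eval_read, eval_add, eval_V, eval_two, h13]
    exact hv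
  have hh : Holds x (m.set 39 0 (v q)) := h.set 0 _ (by decide)
  -- For `q = 0` the condition is vacuous, in agreement with the initial value `-1`, which every
  -- entry exceeds.
  have hprev : 0 < (V 39 - V 24 : Expr).eval (m.set 39 0 (v q)) ↔ ∀ p, p + 1 = q → v p < v q := by
    change 0 < (v q : ℤ) - m 24 0 ↔ _
    rw [h24]
    split_ifs with h0
    · subst h0
      constructor
      · intro _ p hp; omega
      · intro _; omega
    · constructor
      · intro h1 p hp; obtain rfl : p = q - 1 := by omega
        omega
      · intro h1; have := h1 (q - 1) (by omega); omega
  have hN : 0 < (V 21 - V 39 : Expr).eval (m.set 39 0 (v q)) ↔ v q < N := by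
    change 0 < m 21 0 - (v q : ℤ) ↔ _
    rw [h21]; omega
  have hfalse := eval_falseE (t := V 39) (P := V 18) (p := P) (T := v q) hh rfl h18 hP
  have bad : ¬ GoodEntry x P N v q → ∀ Q : Memory → Prop,
      (∀ m', m' 19 0 = flag (p ∧ GoodEntry x P N v q) → m' 39 0 = (v q : ℤ) → Q m') →
      Runs (π.H x) (.write 19 0 0) (m.set 39 0 (v q)) 1 Q := by
    intro hbad Q hQ
    refine Runs.assign rfl (v := 0) rfl (by simp) (hQ _ ?_ rfl)
    rw [flag_false (fun h => hbad h.2)]; rfl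
  have main : Runs (π.H x) (.ite (V 39 - V 24) (.ite (V 21 - V 39) (.ite (falseE (V 39) (V 18)) .skip
      (.write 19 0 0)) (.write 19 0 0)) (.write 19 0 0)) (m.set 39 0 (v q)) (1 + 1 + 1 + 1)
      (fun m' => m' 19 0 = flag (p ∧ GoodEntry x P N v q) ∧ m' 39 0 = (v q : ℤ)) := by
    refine Runs.ite rfl (fun h1 => Runs.ite rfl (fun h2 => Runs.ite rfl (fun h3 => ?_) fun h3 => ?_)
      fun h2 => ?_) fun h1 => ?_
    · refine Runs.skip ⟨?_, rfl⟩
      change m 19 0 = _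
      rw [h19]
      refine flag_congr ⟨fun hp => ⟨hp, hprev.1 h1, hN.1 h2, hfalse.1 h3⟩, fun h => h.1⟩
    · exact bad (fun h => h3 (hfalse.2 h.2.2)) _ fun m' a b => ⟨a, b⟩
    · exact (bad (fun h => h2 (hN.2 h.2.1)) _ fun m' a b => ⟨a, b⟩).mono (by norm_num) fun _ _ h => h
    · exact (bad (fun h => h1 (hprev.2 h.1)) _ fun m' a b => ⟨a, b⟩).mono (by norm_num) fun _ _ h => h
  refine Runs.seq (T' := 1) (main.mono le_rfl ?_)
  rintro m' - ⟨h1, h2⟩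
  exact Runs.assign rfl h2 (hvs.abs_le_H π) ⟨h1, rfl⟩

/-- The field number `f` of the message. -/
def WeightedGraph.fieldAt (x : WeightedGraph) (b : Message) (f : ℕ) : ℕ :=
  field b (f * (3 * x.len)) (3 * x.len)

theorem small_fieldAt (x : WeightedGraph) (b : Message) (f : ℕ) : Small x 3 (x.fieldAt b f) :=
  (field_lt _ _ _).le

theorem listCheck_runs (h : Setup π x m) {P N cnt : ℕ} {b : Message} {p : Prop} (hP : 0 < P)
    (h18 : m 18 0 = P) (h21 : m 21 0 = N) (h22 : m 22 0 = cnt) (hcnt : cnt ≤ x.n * x.n * x.n)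
    (hb : ∀ p, m 0 p = if b p then 1 else 0) (h23 : ∀ p, m 23 p = 0) (h19 : m 19 0 = flag p) :
    Runs (π.H x) listCheck m (1 + ((1 + ((cnt + 2) * (3 * x.len) * 3 + 2)) + (1 + (cnt * 8 + 2))))
      (fun m' => m' 19 0 =
        flag (p ∧ ∀ q < cnt, GoodEntry x P N (fun q => x.fieldAt b (q + 2)) q)) := by
  have hcs : Small x 4 (cnt + 2) :=
    ((Small.n3 x).of_le hcnt).add (Small.mono (.lit (c := 2)) (by norm_num))
  refine Runs.seq (Runs.assign rfl (v := (cnt + 2 : ℕ)) ?_ (hcs.abs_le_H π) ?_)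
  · rw [eval_add, eval_V, h22]; rfl
  have hs : Setup π x (m.set 38 0 (cnt + 2 : ℕ)) := h.set 0 _ (by decide)
  refine Runs.seq ((decode_runs π hs (.inr rfl) (b := b) hb h23 rfl hcs).mono le_rfl ?_)
  rintro m1 - ⟨hf, hfr⟩
  refine Runs.seq (Runs.assign rfl (v := -1) rfl (by simpa using (Small.lit (x := x) (c := 1)).abs_le_H π) ?_)
  set m2 := m1.set 24 0 (-1) with hm2
  have same : ∀ a, a ≠ 12 → a ≠ 14 → a ≠ 23 → a ≠ 24 → a ≠ 38 → m2 a = m a := by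
    intro a h1 h2 h3 h4 h5
    rw [hm2, Memory.set_ne _ h4, hfr a h1 h2 h3, Memory.set_ne _ h5]
  refine (Runs.forLoop (i := 13) (v := 22) (N := cnt) (T := 6) (fun j m' =>
    m' 19 0 = flag (p ∧ ∀ q < j, GoodEntry x P N (fun q => x.fieldAt b (q + 2)) q) ∧
      m' 24 0 = if j = 0 then -1 else (x.fieldAt b (j - 1 + 2) : ℤ)) (by decide) ?_ ?_
      (fun _ _ _ h => h) ?_).mono le_rfl ?_
  · rw [same 22 (by omega) (by omega) (by omega) (by omega) (by omega), h22]
  · refine ⟨?_, rfl⟩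
    rw [same 19 (by omega) (by omega) (by omega) (by omega) (by omega), h19]
    exact flag_congr ⟨fun hp => ⟨hp, fun q hq => by omega⟩, fun h => h.1⟩
  · rintro j hj m' hfr' hi ⟨h1, h2⟩
    have hh : Holds x m' := h.toHolds.frame fun a ha => by
      rw [hfr' a ((by decide : ∀ a ∈ [3, 4, 5], a ≠ 13) a ha)
        ((by decide : ∀ a ∈ [3, 4, 5], a ∉ _) a ha)]
      simp only [List.mem_cons, List.not_mem_nil, or_false] at ha
      exact same a (by omega) (by omega) (by omega) (by omega) (by omega)
    refine (checkEntry_runs π hh (N := N) (v := fun q => x.fieldAt b (q + 2)) hP ?_ ?_ hi ?_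
      (small_fieldAt _ _ _) h2 h1).mono le_rfl ?_
    · rw [hfr' 18 (by decide) (by decide),
        same 18 (by omega) (by omega) (by omega) (by omega) (by omega), h18]
    · rw [hfr' 21 (by decide) (by decide),
        same 21 (by omega) (by omega) (by omega) (by omega) (by omega), h21]
    · rw [hfr' 23 (by decide) (by decide)]
      exact hf (j + 2) (by omega)
    · rintro m3 - ⟨h3, h4⟩
      refine ⟨h3.trans (flag_congr ?_), by rw [h4, if_neg (Nat.succ_ne_zero j)]; rfl⟩
      rw [and_assoc]
      refine and_congr_right fun _ => ⟨fun hq q hq' => ?_, fun hq =>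
        ⟨fun q hq' => hq q (by omega), hq j (Nat.lt_succ_self j)⟩⟩
      rcases eq_or_ne q j with rfl | hne
      · exact hq.2
      · exact hq.1 q (by omega)
  · rintro m' - ⟨⟨h1, -⟩, -⟩; exact h1

end

end PsdProof

end

noncomputable section

namespace PsdProof

local infixr:60 " ;; " => Prog.seq

/-! ### What the verifier computes, in what time, and why it is sound. -/

/-- The conditions on a message under which the verifier accepts. -/
structure Accepts (π : Params) (x : WeightedGraph) (b : Message) : Prop where
  lt : x.fieldAt b 0 < x.n * x.n * x.n
  pos : 0 < x.fieldAt b 1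
  le : x.fieldAt b 1 ≤ π.Q x
  zero : x.Zero (x.fieldAt b 0)
  brute : ∀ t, x.base (x.fieldAt b 0) ≤ t → t < x.fieldAt b 0 → ¬ x.Zero t
  guard : x.count (x.fieldAt b 1) (x.base (x.fieldAt b 0)) ^ π.g * π.Q x ^ (π.g - 1) ≤
    x.n ^ (3 * π.g) * (π.B x + 1) ^ (π.g - 1)
  list : ∀ q < x.count (x.fieldAt b 1) (x.base (x.fieldAt b 0)),
    GoodEntry x (x.fieldAt b 1) (x.base (x.fieldAt b 0)) (fun q => x.fieldAt b (q + 2)) q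

theorem WeightedGraph.count_le (x : WeightedGraph) (P N : ℕ) : x.count P N ≤ N := by
  classical
  unfold count
  exact (Finset.card_filter_le _ _).trans (Finset.card_range N).le

section
variable (π : Params) {x : WeightedGraph} {m : Memory}

theorem outputProg_runs (h : Holds x m) {T : ℕ} (hT : T < x.n * x.n * x.n) (h16 : m 16 0 = T) :
    Runs (π.H x) outputProg m 4 (fun m' => m' 2 0 = 1 ∧ m' 2 1 = (T / x.n / x.n : ℕ) ∧
      m' 2 2 = (T / x.n % x.n : ℕ) ∧ m' 2 3 = (T % x.n : ℕ)) := by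
  have hs : Small x 3 T := (Small.n3 x).of_le hT.le
  refine Runs.seq (T := 1) (T' := 3) (Runs.store (p := 1) (v := (T / x.n / x.n : ℕ)) rfl rfl rfl ?_
    (fun _ => (hs.of_le ((Nat.div_le_self _ _).trans (Nat.div_le_self _ _))).abs_le_H π) ?_)
  · rw [eval_div, eval_div, eval_V, eval_V, h16, h.n]; norm_cast
  refine Runs.seq (T := 1) (T' := 2) (Runs.store (p := 2) (v := (T / x.n % x.n : ℕ)) rfl rfl rfl ?_
    (fun _ => (hs.of_le ((Nat.mod_le _ _).trans (Nat.div_le_self _ _))).abs_le_H π) ?_)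
  · change m 16 0 / m 3 0 % m 3 0 = _
    rw [h16, h.n]; norm_cast
  refine Runs.seq (T := 1) (T' := 1) (Runs.store (p := 3) (v := (T % x.n : ℕ)) rfl rfl rfl ?_
    (fun _ => (hs.of_le (Nat.mod_le _ _)).abs_le_H π) ?_)
  · change m 16 0 % m 3 0 = _
    rw [h16, h.n]; norm_cast
  refine Runs.assign rfl (v := 1) rfl (by simpa using (Small.lit (x := x) (c := 1)).abs_le_H π) ?_
  refine ⟨?_, ?_, ?_, ?_⟩ <;> simp [Memory.set_apply]

theorem eval_guardE (h : Setup π x m) {cnt : ℕ} (h22 : m 22 0 = cnt) :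
    0 < (guardE π).eval m ↔
      cnt ^ π.g * π.Q x ^ (π.g - 1) ≤ x.n ^ (3 * π.g) * (π.B x + 1) ^ (π.g - 1) := by
  simp only [guardE, eval_sub, eval_add, eval_mul, eval_pow, eval_V, eval_one, h.n, h.B, h.Q, h22]
  rw [sub_pos, Int.lt_add_one_iff]
  norm_cast

theorem low_guardE : (guardE π).low = true :=
  low_sub (low_add (low_mul (low_pow rfl _) (low_pow rfl _)) rfl)
    (low_mul (low_pow rfl _) (low_pow rfl _))

/-- The number of steps of `verifierMain` if there are at most `cmax` false positives. -/
def verifierMainSteps (c : Prog) (f : ℕ → ℕ) (x : WeightedGraph) (cmax : ℕ) : ℕ :=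
  1 + (1 + ((1 + (x.n * x.n * 4 + 2)) + (countSteps π c f x +
    (((1 + ((1 + ((cmax + 2) * (3 * x.len) * 3 + 2)) + (1 + (cmax * 8 + 2)))) + 1) + (4 + 1)))))

/-- What the verifier leaves in its result array. -/
def Verdict (x : WeightedGraph) (T : ℕ) (p : Prop) (m : Memory) : Prop :=
  (p ∧ m 2 0 = 1 ∧ m 2 1 = (T / x.n / x.n : ℕ) ∧ m 2 2 = (T / x.n % x.n : ℕ) ∧
    m 2 3 = (T % x.n : ℕ)) ∨ (¬p ∧ m 2 0 = 0)

/-- The hypothesis `hcm` turns the guard into the bound `cmax` on the length of the list that is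
read; it matters for the running time only. -/
theorem verifierMain_runs (h : Setup π x m) {c : Prog} {f : ℕ → ℕ} (hc : Multiplies c f)
    {b : Message} (hb : ∀ p, m 0 p = if b p then 1 else 0) {T P : ℕ} (hT : T < x.n * x.n * x.n)
    (h16 : m 16 0 = T) (h18 : m 18 0 = P) (hP : 0 < P) (hPQ : P ≤ π.Q x) (h20 : m 2 0 = 0)
    (h23 : ∀ p, m 23 p = 0) (h28 : ∀ p, m 28 p = 0) (h64 : ∀ a, 64 ≤ a → ∀ p, m a p = 0) {cmax : ℕ}
    (hcm : ∀ y ≤ x.n * x.n * x.n, y ^ π.g * π.Q x ^ (π.g - 1) ≤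
      x.n ^ (3 * π.g) * (π.B x + 1) ^ (π.g - 1) → y ≤ cmax) :
    Runs (π.H x) (verifierMain π c) m (verifierMainSteps π c f x cmax) (Verdict x T
      (((∀ t, x.base T ≤ t → t < T → ¬ x.Zero t) ∧
        x.count P (x.base T) ^ π.g * π.Q x ^ (π.g - 1) ≤
          x.n ^ (3 * π.g) * (π.B x + 1) ^ (π.g - 1)) ∧
        ∀ q < x.count P (x.base T), GoodEntry x P (x.base T) (fun q => x.fieldAt b (q + 2)) q)) := by
  set cnt := x.count P (x.base T) with hcnt
  have hcle : cnt ≤ x.n * x.n * x.n := (x.count_le _ _).trans ((x.base_le T).trans hT.le)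
  refine Runs.seq (Runs.assign rfl (v := 1) rfl
    (by simpa using (Small.lit (x := x) (c := 1)).abs_le_H π) ?_)
  have h1 : Setup π x (m.set 19 0 1) := h.set 0 1 (by decide)
  refine Runs.seq ((baseProg_runs π h1.toHolds hT.le h16).mono le_rfl ?_)
  rintro _ - rfl
  have h2 : Setup π x ((m.set 19 0 1).set 21 0 (x.base T)) := h1.set 0 _ (by decide)
  refine Runs.seq ((bruteProg_runs π h2.toHolds hT h16 rfl rfl).frame.mono le_rfl ?_)
  rintro m3 - ⟨h19, hf3⟩
  have h3 : Setup π x m3 := h2.frame fun a ha =>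
    hf3 a ((by decide : ∀ a ∈ setupArrays, a ∉ bruteProg.writes) a ha)
  have hsame3 : ∀ a, a ∉ [12, 14, 19, 21] → m3 a = m a := by
    intro a ha
    rw [hf3 a (fun h' => ha ((by decide : ∀ a ∈ bruteProg.writes, a ∈ _) a h')),
      Memory.set_ne _ (fun h' => ha (by rw [h']; decide)),
      Memory.set_ne _ (fun h' => ha (by rw [h']; decide))]
  refine Runs.seq ((countProg_runs π h3 hc hP ?_ hPQ (x.index_le hT.le) ?_ ?_ ?_).mono le_rfl ?_)
  · rw [hsame3 18 (by decide), h18]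
  · rw [hf3 21 (by decide)]; rfl
  · intro p; rw [hsame3 28 (by decide), h28]
  · intro a ha p
    rw [hsame3 a (fun h' => absurd ((by decide : ∀ a ∈ [12, 14, 19, 21], a < 64) a h') (by omega)),
      h64 a ha]
  rintro m4 - ⟨h22, hf4⟩
  change m4 22 0 = cnt at h22
  have h4 : Setup π x m4 := h3.frame fun a ha =>
    hf4 a ((by decide : ∀ a ∈ setupArrays, a < 64) a ha)
      ((by decide : ∀ a ∈ setupArrays, a ∉ _) a ha)
  have hsame4 : ∀ a < 64, a ∉ [12, 13, 14, 19, 21, 22, 25, 26, 27, 28, 34, 35, 36, 37] →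
      m4 a = m a := by
    intro a ha hna
    rw [hf4 a ha (fun h' => hna ((by decide : ∀ a ∈ [12, 13, 14, 22, 25, 26, 27, 28, 34, 35, 36, 37],
      a ∈ _) a h')), hsame3 a (fun h' => hna ((by decide : ∀ a ∈ [12, 14, 19, 21], a ∈ _) a h'))]
  have h419 : m4 19 0 = flag (∀ t, x.base T ≤ t → t < T → ¬ x.Zero t) := by
    rw [hf4 19 (by norm_num) (by decide), h19]
  refine Runs.seq ((Runs.ite (T := 1 + ((1 + ((cmax + 2) * (3 * x.len) * 3 + 2)) +
    (1 + (cmax * 8 + 2)))) (Q := fun m' => m' 19 0 = flag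
      (((∀ t, x.base T ≤ t → t < T → ¬ x.Zero t) ∧ cnt ^ π.g * π.Q x ^ (π.g - 1) ≤
          x.n ^ (3 * π.g) * (π.B x + 1) ^ (π.g - 1)) ∧
        ∀ q < cnt, GoodEntry x P (x.base T) (fun q => x.fieldAt b (q + 2)) q))
    (low_guardE π) (fun hg => ?_) (fun hg => ?_)).frame.mono le_rfl ?_)
  · rw [eval_guardE π h4 h22] at hg
    have hle := hcm cnt hcle hg
    refine (listCheck_runs π h4 (b := b) (N := x.base T) hP ?_ ?_ h22 hcle ?_ ?_ h419).mono ?_ ?_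
    · rw [hsame4 18 (by norm_num) (by decide), h18]
    · rw [hf4 21 (by norm_num) (by decide), hf3 21 (by decide)]; rfl
    · intro p; rw [hsame4 0 (by norm_num) (by decide), hb]
    · intro p; rw [hsame4 23 (by norm_num) (by decide), h23]
    · gcongr
    · rintro m' - h'
      exact h'.trans (flag_congr ⟨fun ⟨a, b⟩ => ⟨⟨a, hg⟩, b⟩, fun ⟨⟨a, _⟩, b⟩ => ⟨a, b⟩⟩)
  · rw [eval_guardE π h4 h22] at hg
    refine (Runs.assign rfl (v := 0) rfl (by simp) ?_ : Runs _ _ _ 1 _).mono (by omega)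
      fun _ _ h => h
    rw [flag_false (fun h => hg h.1.2)]; rfl
  rintro m5 - ⟨h519, hf5⟩
  have hw5 : ∀ a, a ∉ [12, 13, 14, 19, 23, 24, 38, 39] → m5 a = m4 a := by
    intro a ha
    refine hf5 a fun h' => ha ?_
    exact (by decide : ∀ a ∈ listCheck.writes ++ [19], a ∈ _) a h'
  have h5 : Holds x m5 := h4.toHolds.frame fun a ha =>
    hw5 a ((by decide : ∀ a ∈ [3, 4, 5], a ∉ _) a ha)
  refine Runs.ite rfl (fun ho => ?_) (fun ho => ?_)
  · rw [eval_V, h519, flag_pos] at ho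
    refine (outputProg_runs π h5 hT ?_).mono le_rfl fun m' _ h' => .inl ⟨ho, h'⟩
    rw [hw5 16 (by decide), hsame4 16 (by norm_num) (by decide), h16]
  · rw [eval_V, h519, flag_pos] at ho
    refine (Runs.skip (.inr ⟨ho, ?_⟩) : Runs _ _ _ 1 _).mono (by norm_num) fun _ _ h => h
    rw [hw5 2 (by decide), hsame4 2 (by norm_num) (by decide), h20]

/-- The number of steps of `verifierProg` if there are at most `cmax` false positives. -/
def verifierSteps (c : Prog) (f : ℕ → ℕ) (x : WeightedGraph) (cmax : ℕ) : ℕ :=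
  preludeSteps π x + ((1 + ((1 + (2 * (3 * x.len) * 3 + 2)) + (1 + 1))) +
    (verifierMainSteps π c f x cmax + 1 + 1 + 1))

theorem prelude_writes : (prelude π).writes =
    [6, 14, 12, 6, 12, 7, 6, 7, 8, 9, 10, 11, 9, 10, 11, 15] := rfl

theorem header_runs (h : Setup π x m) {b : Message} (hb : ∀ p, m 0 p = if b p then 1 else 0)
    (h20 : ∀ p, m 20 p = 0) :
    Runs (π.H x) header m (1 + ((1 + (2 * (3 * x.len) * 3 + 2)) + (1 + 1))) (fun m' =>
      m' 16 0 = x.fieldAt b 0 ∧ m' 18 0 = x.fieldAt b 1) := by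
  refine Runs.seq (Runs.assign rfl (v := (2 : ℕ)) rfl
    ((Small.lit (x := x) (c := 2)).abs_le_H π) ?_)
  refine Runs.seq ((decode_runs π (h.set (a := 38) 0 (2 : ℕ) (by decide)) (.inl rfl) (b := b) hb h20
    rfl (Small.mono .lit (by norm_num))).mono le_rfl ?_)
  rintro m1 - ⟨hf, -⟩
  refine Runs.seq (Runs.assign rfl (v := x.fieldAt b 0) (hf 0 (by norm_num))
    ((small_fieldAt x b 0).abs_le_H π) ?_)
  exact Runs.assign rfl (v := x.fieldAt b 1) (hf 1 (by norm_num))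
    ((small_fieldAt x b 1).abs_le_H π) ⟨rfl, rfl⟩

theorem verifierProg_runs (h : Holds x m) {c : Prog} {f : ℕ → ℕ} (hc : Multiplies c f)
    {b : Message} (hb : ∀ p, m 0 p = if b p then 1 else 0)
    (hz : ∀ a, a ∉ [0, 3, 4, 5] → ∀ p, m a p = 0) {cmax : ℕ}
    (hcm : ∀ y ≤ x.n * x.n * x.n, y ^ π.g * π.Q x ^ (π.g - 1) ≤
      x.n ^ (3 * π.g) * (π.B x + 1) ^ (π.g - 1) → y ≤ cmax) :
    Runs (π.H x) (verifierProg π c) m (verifierSteps π c f x cmax)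
      (Verdict x (x.fieldAt b 0) (Accepts π x b)) := by
  refine Runs.seq ((prelude_runs π h).frame.mono le_rfl ?_)
  rintro m1 - ⟨h1, hf1⟩
  rw [prelude_writes] at hf1
  refine Runs.seq ((header_runs π h1 (b := b) ?_ ?_).frame.mono le_rfl ?_)
  · intro p; rw [hf1 0 (by decide), hb]
  · intro p; rw [hf1 20 (by decide), hz 20 (by decide)]
  rintro m2 - ⟨⟨h16, h18⟩, hf2⟩
  have h2 : Setup π x m2 := h1.frame fun a ha =>
    hf2 a ((by decide : ∀ a ∈ setupArrays, a ∉ header.writes) a ha)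
  have hz2 : ∀ a, a ∉ [0, 3, 4, 5, 6, 7, 8, 9, 10, 11, 12, 14, 15, 16, 18, 20, 38] →
      ∀ p, m2 a p = 0 := by
    intro a ha p
    rw [hf2 a fun h' => ha ((by decide : ∀ a ∈ header.writes, a ∈ _) a h'),
      hf1 a fun h' => ha ((by decide : ∀ a ∈ [6, 14, 12, 6, 12, 7, 6, 7, 8, 9, 10, 11, 9, 10, 11, 15],
        a ∈ _) a h'),
      hz a fun h' => ha ((by decide : ∀ a ∈ [0, 3, 4, 5], a ∈ _) a h')]
  set T := x.fieldAt b 0 with hT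
  set P := x.fieldAt b 1 with hP
  -- Rejecting means to leave the result array untouched, because its initial zero is the output
  -- `⊥`.
  have no : ∀ k, ¬ Accepts π x b → Runs (π.H x) .skip m2 (k + 1)
      (Verdict x T (Accepts π x b)) := fun k hn =>
    (Runs.skip (.inr ⟨hn, hz2 2 (by decide) 0⟩)).mono (by omega) fun _ _ h => h
  have c1 : 0 < (V 3 * V 3 * V 3 - V 16 : Expr).eval m2 ↔ T < x.n * x.n * x.n := by
    simp only [eval_sub, eval_mul, eval_V, h2.n, h16, sub_pos]
    norm_cast
  have c2 : 0 < (V 18 * (V 9 + 1 - V 18) : Expr).eval m2 ↔ 0 < P ∧ P ≤ π.Q x := by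
    simp only [eval_sub, eval_mul, eval_add, eval_one, eval_V, h2.Q, h18]
    rcases Nat.eq_zero_or_pos P with h0 | h0
    · simp [h0]
    · rw [mul_pos_iff_of_pos_left (by exact_mod_cast h0)]
      omega
  have c3 := eval_zeroE (t := V 16) h2.toHolds h16
  refine Runs.ite rfl (fun k1 => Runs.ite rfl (fun k2 => Runs.ite rfl (fun k3 => ?_) fun k3 => ?_)
    fun k2 => ?_) fun k1 => ?_
  · have hP2 := c2.1 k2
    refine (verifierMain_runs π h2 hc (b := b) ?_ (c1.1 k1) h16 h18 hP2.1 hP2.2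
      (hz2 2 (by decide) 0) (hz2 23 (by decide)) (hz2 28 (by decide)) ?_ hcm).mono le_rfl ?_
    · intro p; rw [hf2 0 (by decide), hf1 0 (by decide), hb]
    · intro a ha
      exact hz2 a fun h' => absurd ((by decide : ∀ a ∈ [0, 3, 4, 5, 6, 7, 8, 9, 10, 11, 12, 14, 15,
        16, 18, 20, 38], a < 64) a h') (by omega)
    · intro m' _ hv
      refine Eq.mp (congrArg (fun p => Verdict x T p m') (propext ?_)) hv
      exact ⟨fun ⟨⟨a, b⟩, d⟩ => ⟨c1.1 k1, hP2.1, hP2.2, c3.1 k3, a, b, d⟩,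
        fun h => ⟨⟨h.brute, h.guard⟩, h.list⟩⟩
  · exact (no 0 fun h => k3 (c3.2 h.zero)).mono (by unfold verifierMainSteps; omega) fun _ _ h => h
  · exact (no 0 fun h => k2 (c2.2 ⟨h.pos, h.le⟩)).mono (by unfold verifierMainSteps; omega)
      fun _ _ h => h
  · exact (no 0 fun h => k1 (c1.2 h.lt)).mono (by unfold verifierMainSteps; omega) fun _ _ h => h

end

/-! ### Soundness -/

theorem Zero.zeroMod {x : WeightedGraph} {T : ℕ} (h : x.Zero T) (P : ℕ) : x.ZeroMod P T :=
  ⟨h.1, by rw [h.2]; exact dvd_zero _⟩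

/-- The entries are distinct and all belong to the set that was counted, and there are as many of
them as elements of the set. So they fill it, and each has nonzero weight. A zero triangle would
also belong to the set, whatever the modulus. -/
theorem goodEntries_no_zero {x : WeightedGraph} {P N : ℕ} {v : ℕ → ℕ}
    (h : ∀ q < x.count P N, GoodEntry x P N v q) : ∀ t < N, ¬ x.Zero t := by
  classical
  intro t ht hz
  set F := (Finset.range N).filter fun T => x.ZeroMod P T with hF
  have hmono : ∀ q q', q < q' → q' < F.card → v q < v q' := by
    intro q q' hlt
    induction q' with
    | zero => omega
    | succ q' ih =>
      intro hq'
      have h1 := (h (q' + 1) hq').1 q' rfl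
      rcases Nat.lt_succ_iff_lt_or_eq.1 hlt with h2 | rfl
      · exact (ih h2 (by omega)).trans h1
      · exact h1
  have hinj : Set.InjOn v (Finset.range F.card : Set ℕ) := by
    intro q hq q' hq' he
    rw [Finset.coe_range, Set.mem_Iio] at hq hq'
    rcases lt_trichotomy q q' with hlt | heq | hlt
    · have := hmono q q' hlt hq'; omega
    · exact heq
    · have := hmono q' q hlt hq; omega
  have himg : (Finset.range F.card).image v = F := by
    refine Finset.eq_of_subset_of_card_le ?_ ?_
    · intro T hT
      obtain ⟨q, hq, rfl⟩ := Finset.mem_image.1 hT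
      have := h q (Finset.mem_range.1 hq)
      rw [hF, Finset.mem_filter, Finset.mem_range]
      exact ⟨this.2.1, this.2.2.1⟩
    · rw [Finset.card_image_of_injOn hinj, Finset.card_range]
  have : t ∈ F := by
    rw [hF, Finset.mem_filter, Finset.mem_range]
    exact ⟨ht, Zero.zeroMod hz P⟩
  rw [← himg] at this
  obtain ⟨q, hq, rfl⟩ := Finset.mem_image.1 this
  exact (h q (Finset.mem_range.1 hq)).2.2.2 hz.2

/-- An earlier zero triangle would either lie below the base, which the list excludes, or share the
first vertex, which the brute-force search excludes. -/
theorem Accepts.eq_first {π : Params} {x : WeightedGraph} {b : Message} (h : Accepts π x b) :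
    x.fieldAt b 0 = x.first := by
  refine WeightedGraph.eq_first (fun T _ hz => ?_) (.inr ⟨h.lt, h.zero⟩)
  by_contra! hlt
  rcases lt_or_ge T (x.base (x.fieldAt b 0)) with h1 | h1
  · exact goodEntries_no_zero h.list T h1 hz
  · exact h.brute T h1 hlt hz

end PsdProof

end

noncomputable section

namespace PsdProof

/-! ### Few false positives

A number has few prime factors, so there is a modulus with few false positives. -/

/-- The product of the primes divides `w`, and each of them is at least `2`. -/
theorem card_prime_divisors_le {S : Finset ℕ} {w : ℤ} {L : ℕ} (hS : ∀ p ∈ S, p.Prime)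
    (hd : ∀ p ∈ S, (p : ℤ) ∣ w) (hw : w ≠ 0) (hL : w.natAbs < 2 ^ L) : S.card ≤ L := by
  have h1 : ∏ p ∈ S, p ∣ w.natAbs :=
    Finset.prod_primes_dvd _ (fun p hp => (hS p hp).prime) fun p hp =>
      Int.natCast_dvd.1 (hd p hp)
  have h2 : 2 ^ S.card ≤ ∏ p ∈ S, p := Finset.pow_card_le_prod _ _ _ fun p hp => (hS p hp).two_le
  have h3 := (h2.trans (Nat.le_of_dvd (Int.natAbs_pos.2 hw) h1)).trans_lt hL
  exact ((Nat.pow_lt_pow_iff_right (by norm_num)).1 h3).le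

theorem WeightedGraph.natAbs_wt_lt (x : WeightedGraph) (T : ℕ) :
    (x.wt T).natAbs < 2 ^ (2 * x.len) := by
  have h1 := x.sumSq_lt
  have h2 : 4 ≤ 2 ^ x.len := Nat.pow_le_pow_right (n := 2) (by norm_num) x.two_le_len
  have h3 : |x.wt T| ≤ 3 * x.sumSq := by
    unfold wt
    refine (abs_add_three _ _ _).trans ?_
    have := x.abs_W_le_sumSq
    linarith [this (T / x.n / x.n * x.n + T / x.n % x.n), this (T / x.n / x.n * x.n + T % x.n),
      this (T / x.n % x.n * x.n + T % x.n)]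
  rw [Int.abs_eq_natAbs] at h3
  have h4 : (x.wt T).natAbs ≤ 3 * x.sumSq := by exact_mod_cast h3
  rw [two_mul, pow_add]
  nlinarith

/-- Double counting: a triangle counted for `P * p` is already counted for `P`, and its nonzero
weight has at most `2 * len` prime divisors. Coprimality of `p` and `P` is not needed. -/
theorem sum_count_le (x : WeightedGraph) {P N : ℕ} (hN : ∀ t < N, ¬ x.Zero t) {S : Finset ℕ}
    (hS : ∀ p ∈ S, p.Prime) : ∑ p ∈ S, x.count (P * p) N ≤ x.count P N * (2 * x.len) := by
  classical
  have h1 : ∀ p, x.count (P * p) N = ∑ T ∈ (Finset.range N).filter fun T => x.ZeroMod P T,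
      if (p : ℤ) * P ∣ x.wt T then 1 else 0 := by
    intro p
    rw [WeightedGraph.count, Finset.card_filter, Finset.sum_filter]
    refine Finset.sum_congr rfl fun T _ => ?_
    unfold WeightedGraph.ZeroMod
    push_cast
    by_cases ht : x.tri T = 1
    · by_cases hd : (P : ℤ) * p ∣ x.wt T
      · simp [ht, hd, dvd_of_mul_right_dvd hd, mul_comm (p : ℤ)]
      · simp [hd, mul_comm (p : ℤ)]
    · simp [ht]
  simp only [h1]
  rw [Finset.sum_comm, WeightedGraph.count]
  refine (Finset.sum_le_card_nsmul _ _ (2 * x.len) fun T hT => ?_).trans_eq (by simp)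
  rw [Finset.mem_filter, Finset.mem_range] at hT
  rw [← Finset.card_filter]
  refine card_prime_divisors_le (fun p hp => hS p (Finset.mem_filter.1 hp).1)
    (fun p hp => dvd_of_mul_right_dvd (Finset.mem_filter.1 hp).2) (fun h0 => ?_) (x.natAbs_wt_lt T)
  exact hN T hT.1 ⟨hT.2.1, h0⟩

theorem log_le_pow_mul {y : ℝ} (hy : 1 ≤ y) {g : ℕ} (hg : 0 < g) :
    Real.log y ≤ 2 * g * y ^ (1 / (2 * g : ℝ)) := by
  have h := Real.log_le_rpow_div (x := y) (ε := 1 / (2 * g)) (by linarith) (by positivity)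
  rwa [div_div_eq_mul_div, div_one, mul_comm] at h

/-- Chebyshev's bound with its correction term absorbed: from `64` on, `log (y + 1) ≤ 0.15 * y`, and
`log 2 - 0.15` still exceeds `1 / 2`. -/
theorem le_two_mul_primeCounting_mul_log {y : ℕ} (hy : 64 ≤ y) :
    (y : ℝ) ≤ 2 * (Nat.primeCounting y * Real.log y) := by
  have h := Chebyshev.pi_ge y
  have hy' : (64 : ℝ) ≤ y := by exact_mod_cast hy
  have hl : 0 < Real.log y := Real.log_pos (by linarith)
  rw [div_le_iff₀ hl] at h
  have h2 : Real.log (y + 1) ≤ 0.15 * y := by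
    have h3 : Real.log ((y + 1) / 32) ≤ (y + 1) / 32 - 1 := Real.log_le_sub_one_of_pos (by positivity)
    rw [Real.log_div (by positivity) (by norm_num)] at h3
    have h4 : Real.log 32 = 5 * Real.log 2 := by
      rw [show (32 : ℝ) = 2 ^ 5 by norm_num, Real.log_pow]; norm_num
    linarith [Real.log_two_lt_d9]
  nlinarith [Real.log_two_gt_d9]

/-- There are many primes up to `y`, by Chebyshev's bound. -/
theorem pow_le_primeCounting_pow {g l y : ℕ} (hg : 0 < g) (hl : 0 < l)
    (hy : (16 * g * l) ^ (2 * g) ≤ y) : (2 * l) ^ g * y ^ (g - 1) ≤ Nat.primeCounting y ^ g := by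
  have hz : 16 ≤ 16 * g * l := by nlinarith [Nat.mul_pos hg hl]
  have h64 : 64 ≤ y := by
    calc 64 ≤ 16 ^ 2 := by norm_num
      _ ≤ (16 * g * l) ^ 2 := Nat.pow_le_pow_left hz _
      _ ≤ (16 * g * l) ^ (2 * g) := Nat.pow_le_pow_right (by omega) (by omega)
      _ ≤ y := hy
  have hy1 : (1 : ℝ) ≤ y := by exact_mod_cast (by omega : 1 ≤ y)
  have h1 := le_two_mul_primeCounting_mul_log h64
  have h2 := log_le_pow_mul hy1 hg
  -- With `log y ≤ 2 * g * r`, Chebyshev's bound becomes `y ≤ π(y) * (4 * g * r)`. The hypothesis on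
  -- `y` says `16 * g * l ≤ r`, so that `(2 * l) * (4 * g * r) ≤ r ^ 2`, whose `g`-th power is at
  -- most `y`.
  set r := (y : ℝ) ^ (1 / (2 * g : ℝ)) with hr
  have hr0 : 0 < r := by positivity
  have hrg : r ^ (2 * g) = y := by
    rw [hr, ← Real.rpow_natCast, ← Real.rpow_mul (by positivity)]
    push_cast
    rw [one_div, inv_mul_cancel₀ (by positivity), Real.rpow_one]
  have h3 : ((16 * g * l : ℕ) : ℝ) ≤ r := by
    rw [← pow_le_pow_iff_left₀ (by positivity) hr0.le (n := 2 * g) (by omega), hrg]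
    exact_mod_cast hy
  have h4 : (y : ℝ) ≤ Nat.primeCounting y * (4 * g * r) := by
    have := mul_le_mul_of_nonneg_left h2 (Nat.cast_nonneg (α := ℝ) (Nat.primeCounting y))
    linarith
  have h5 : ((2 * l) ^ g * y ^ (g - 1) : ℝ) ≤ (Nat.primeCounting y : ℝ) ^ g := by
    have hy0 : (0 : ℝ) < y := by linarith
    have h6 : (y : ℝ) ^ g ≤ (Nat.primeCounting y : ℝ) ^ g * (4 * g * r) ^ g := by
      rw [← mul_pow]; exact pow_le_pow_left₀ hy0.le h4 _
    have h7 : (2 * l : ℝ) * (4 * g * r) ≤ r ^ 2 := by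
      push_cast at h3
      have : (0 : ℝ) < g * l := by positivity
      nlinarith
    have h8 : (2 * l : ℝ) ^ g * (4 * g * r) ^ g ≤ y := by
      rw [← mul_pow, ← hrg, pow_mul]
      exact pow_le_pow_left₀ (by positivity) h7 _
    have h9 : (0 : ℝ) < (4 * g * r) ^ g := by positivity
    refine le_of_mul_le_mul_right ?_ h9
    calc (2 * l : ℝ) ^ g * (y : ℝ) ^ (g - 1) * (4 * g * r) ^ g
        = ((2 * l : ℝ) ^ g * (4 * g * r) ^ g) * (y : ℝ) ^ (g - 1) := by ring
      _ ≤ y * (y : ℝ) ^ (g - 1) := by gcongr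
      _ = (y : ℝ) ^ g := by rw [← pow_succ']; congr 1; omega
      _ ≤ _ := h6
  exact_mod_cast h5

/-- The bound on the number of false positives for the modulus `P`. -/
def Sparse (π : Params) (x : WeightedGraph) (N P : ℕ) : Prop :=
  x.count P N ^ π.g * P ^ (π.g - 1) ≤ x.n ^ (3 * π.g)

theorem Sparse.one (π : Params) {x : WeightedGraph} {N : ℕ} (hN : N ≤ x.n * x.n * x.n) :
    Sparse π x N 1 := by
  unfold Sparse
  rw [one_pow, mul_one, pow_mul]
  refine Nat.pow_le_pow_left ?_ _
  exact (x.count_le _ _).trans (hN.trans_eq (by ring))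

/-- The best factor does at least as well as the average over the primes up to `B + 1`, and there
are enough of these for the count to drop by `(B + 1) ^ (1 - 1 / g)`. Since the modulus grows by at
most `B + 1`, the invariant persists, even if the best factor is not prime. -/
theorem Sparse.mul {π : Params} (hg : 0 < π.g) (hC : (16 * π.g) ^ (2 * π.g) ≤ π.C)
    {x : WeightedGraph} {N P d : ℕ} (h : Sparse π x N P) (hN : ∀ t < N, ¬ x.Zero t)
    (hd : d ≤ π.B x + 1) (hmin : ∀ p, 2 ≤ p → p ≤ π.B x + 1 → x.count (P * d) N ≤ x.count (P * p) N) :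
    Sparse π x N (P * d) := by
  have hl : 0 < x.len := by have := x.two_le_len; omega
  have h1 : (2 * x.len) ^ π.g * (π.B x + 1) ^ (π.g - 1) ≤ Nat.primeCounting (π.B x + 1) ^ π.g := by
    refine pow_le_primeCounting_pow hg hl (le_trans ?_ (Nat.le_succ _))
    rw [mul_pow]
    exact Nat.mul_le_mul_right _ hC
  have h2 : Nat.primeCounting (π.B x + 1) * x.count (P * d) N ≤ x.count P N * (2 * x.len) := by
    refine le_trans ?_ (sum_count_le x hN (P := P) (S := Nat.primesBelow (π.B x + 1 + 1))
      fun p hp => Nat.prime_of_mem_primesBelow hp)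
    rw [Nat.primeCounting, ← Nat.primesBelow_card_eq_primeCounting', ← smul_eq_mul]
    refine Finset.card_nsmul_le_sum _ _ _ fun p hp => hmin p (Nat.prime_of_mem_primesBelow hp).two_le ?_
    have := Nat.lt_of_mem_primesBelow hp
    omega
  have hpos : 0 < Nat.primeCounting (π.B x + 1) ^ π.g :=
    lt_of_lt_of_le (by positivity) h1
  unfold Sparse at h ⊢
  refine le_trans (Nat.le_of_mul_le_mul_left ?_ hpos) h
  calc Nat.primeCounting (π.B x + 1) ^ π.g * (x.count (P * d) N ^ π.g * (P * d) ^ (π.g - 1))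
      = (Nat.primeCounting (π.B x + 1) * x.count (P * d) N) ^ π.g * P ^ (π.g - 1) *
        d ^ (π.g - 1) := by ring
    _ ≤ (x.count P N * (2 * x.len)) ^ π.g * P ^ (π.g - 1) * (π.B x + 1) ^ (π.g - 1) := by gcongr
    _ = ((2 * x.len) ^ π.g * (π.B x + 1) ^ (π.g - 1)) * (x.count P N ^ π.g * P ^ (π.g - 1)) := by
        ring
    _ ≤ _ := Nat.mul_le_mul_right _ h1

/-- The greedy modulus may miss `Q` by a factor `B + 1`; this polylogarithmic loss is what the
verifier's guard allows for. -/
theorem Sparse.guard {π : Params} {x : WeightedGraph} {N P : ℕ} (h : Sparse π x N P)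
    (hP : π.Q x ≤ P * (π.B x + 1)) :
    x.count P N ^ π.g * π.Q x ^ (π.g - 1) ≤ x.n ^ (3 * π.g) * (π.B x + 1) ^ (π.g - 1) :=
  calc x.count P N ^ π.g * π.Q x ^ (π.g - 1)
      ≤ x.count P N ^ π.g * (P * (π.B x + 1)) ^ (π.g - 1) := by gcongr
    _ = x.count P N ^ π.g * P ^ (π.g - 1) * (π.B x + 1) ^ (π.g - 1) := by rw [mul_pow, mul_assoc]
    _ ≤ _ := Nat.mul_le_mul_right _ h

end PsdProof

end

noncomputable section

namespace PsdProof

local infixr:60 " ;; " => Prog.seq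

/-! ### The prover -/

/-- Count the false positives for all the multiples `P * (2 + e)` of `P`. -/
def countAll : Prog :=
  forLoop 12 29 (.ite (zeroModE (V 12 / V 8) (V 18 * (2 + V 12 % V 8)))
    (.write 30 (V 13 * V 8 + V 12 % V 8) (.read 30 (V 13 * V 8 + V 12 % V 8) + 1)) .skip)

/-- Find the factor with the fewest false positives. -/
def findMin : Prog :=
  .write 31 0 (V 3 * V 3 * V 3 + 1) ;;
  forLoop 12 8 (.ite (V 31 - .read 30 (V 13 * V 8 + V 12))
    (.write 31 0 (.read 30 (V 13 * V 8 + V 12)) ;; .write 32 0 (V 12 + 2)) .skip)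

def greedyStep : Prog := countAll ;; findMin ;; .write 18 0 (V 18 * V 32)

/-- Find a modulus with few false positives. -/
def greedy : Prog :=
  .write 18 0 1 ;; .write 29 0 (V 21 * V 8) ;;
  forLoop 13 10 (.ite (V 9 + 1 - V 18 * (V 8 + 1)) greedyStep .skip)

/-- Write the numbers of the message to array `23`. -/
def listProg : Prog :=
  .write 23 0 (V 16) ;; .write 23 1 (V 18) ;; .write 22 0 0 ;;
  forLoop 12 21 (.ite (zeroModE (V 12) (V 18))
    (.write 23 (V 22 + 2) (V 12) ;; .write 22 0 (V 22 + 1)) .skip)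

/-- Write the bits of the message. -/
def encodeProg : Prog :=
  .write 33 0 1 ;; forLoop 12 15 (.write 33 (V 12 + 1) (2 * .read 33 (V 12))) ;;
  .write 14 0 ((V 22 + 2) * V 15) ;;
  forLoop 12 14 (.write 1 (V 12) (.read 23 (V 12 / V 15) / .read 33 (V 15 - 1 - V 12 % V 15) % 2))

def proverProg (π : Params) : Prog :=
  prelude π ;; findFirst ;; baseProg ;; greedy ;; listProg ;; encodeProg

theorem WeightedGraph.count_succ (x : WeightedGraph) (P N : ℕ) :
    (x.ZeroMod P N → x.count P (N + 1) = x.count P N + 1) ∧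
      (¬ x.ZeroMod P N → x.count P (N + 1) = x.count P N) := by
  classical
  constructor <;> intro h
  · rw [count, count, Finset.range_add_one, Finset.filter_insert, if_pos h,
      Finset.card_insert_of_notMem (by simp)]
  · rw [count, count, Finset.range_add_one, Finset.filter_insert, if_neg h]

/-- The quotient on the left is the number of loop indices below `j` with remainder `e` modulo `B`,
that is, the number of triples already tested for candidate `e`. -/
theorem div_step {B j e : ℕ} (he : e < B) :
    (j + (B - 1 - e)) / B = j / B + (if e < j % B then 1 else 0) := by
  have h1 := Nat.div_add_mod' j B
  have h2 := Nat.mod_lt j (by omega : 0 < B)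
  set q := j / B
  set r := j % B
  rw [← h1]
  split_ifs with h
  · rw [show q * B + r + (B - 1 - e) = (q + 1) * B + (r - 1 - e) by rw [add_mul]; omega,
      mul_add_div_of_lt (by omega)]
  · rw [show q * B + r + (B - 1 - e) = q * B + (r + (B - 1 - e)) by omega,
      mul_add_div_of_lt (by omega), add_zero]

theorem div_step_self {B j : ℕ} (hB : 0 < B) :
    (j + (B - 1 - j % B)) / B = j / B ∧ (j + 1 + (B - 1 - j % B)) / B = j / B + 1 := by
  have h2 := Nat.mod_lt j hB
  have h1 := Nat.div_add_mod' j B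
  constructor
  · rw [div_step h2]; simp
  · set q := j / B
    set r := j % B
    rw [← h1, show q * B + r + 1 + (B - 1 - r) = (q + 1) * B + 0 by rw [add_mul]; omega,
      mul_add_div_of_lt hB]

theorem div_step_ne {B j e : ℕ} (he : e < B) (hne : e ≠ j % B) :
    (j + 1 + (B - 1 - e)) / B = (j + (B - 1 - e)) / B := by
  have h1 := Nat.div_add_mod' j B
  have h2 := Nat.mod_lt j (by omega : 0 < B)
  set q := j / B
  set r := j % B
  rw [← h1]
  rcases lt_or_gt_of_ne hne with h | h
  · rw [show q * B + r + (B - 1 - e) = (q + 1) * B + (r - 1 - e) by rw [add_mul]; omega,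
      show q * B + r + 1 + (B - 1 - e) = (q + 1) * B + (r - e) by rw [add_mul]; omega,
      mul_add_div_of_lt (by omega), mul_add_div_of_lt (by omega)]
  · rw [show q * B + r + (B - 1 - e) = q * B + (r + (B - 1 - e)) by omega,
      show q * B + r + 1 + (B - 1 - e) = q * B + (r + 1 + (B - 1 - e)) by omega,
      mul_add_div_of_lt (by omega), mul_add_div_of_lt (by omega)]

section
variable (π : Params) {x : WeightedGraph} {m : Memory} {N P o : ℕ}

/-- One loop runs over the pairs of a triple `j / B` and a candidate `j % B`. Round `o` counts in
its own block of array `30`, so no counter has to be reset. -/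
theorem countAll_runs (h : Setup π x m) (hN : N ≤ x.n * x.n * x.n) (hP : 0 < P)
    (h13 : m 13 0 = o) (h18 : m 18 0 = P) (h29 : m 29 0 = (N * π.B x : ℕ))
    (h30 : ∀ p, o * π.B x ≤ p → m 30 p = 0) :
    Runs (π.H x) countAll m (N * π.B x * 4 + 2) (fun m' =>
      (∀ e < π.B x, m' 30 (o * π.B x + e) = x.count (P * (2 + e)) N) ∧
      ∀ p, (o + 1) * π.B x ≤ p → m' 30 p = 0) := by
  set B := π.B x with hB
  have hB0 : 0 < B := π.B_pos x
  refine (Runs.forLoop (i := 12) (v := 29) (N := N * B) (T := 2) (fun j m' =>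
      (∀ e < B, m' 30 (o * B + e) = x.count (P * (2 + e)) ((j + (B - 1 - e)) / B)) ∧
      ∀ p, (o + 1) * B ≤ p → m' 30 p = 0)
    (by decide) h29 ?_ (fun _ _ _ h => h) ?_).mono le_rfl ?_
  · refine ⟨fun e he => ?_, fun p hp => h30 p (by rw [add_mul] at hp; omega)⟩
    rw [h30 _ (by omega), Nat.div_eq_of_lt (by omega)]
    simp [WeightedGraph.count]
  · rintro j hj m' hfr hi ⟨h1, h2⟩
    have hs : Setup π x m' := h.frame fun a ha =>
      hfr a ((by decide : ∀ a ∈ setupArrays, a ≠ 12) a ha)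
        ((by decide : ∀ a ∈ setupArrays, a ∉ _) a ha)
    have e13 : m' 13 0 = o := by rw [hfr 13 (by decide) (by decide), h13]
    have e18 : m' 18 0 = P := by rw [hfr 18 (by decide) (by decide), h18]
    have hr := Nat.mod_lt j hB0
    have hq : j / B < N := Nat.div_lt_of_lt_mul (by rwa [mul_comm])
    have et : (V 12 / V 8 : Expr).eval m' = (j / B : ℕ) := by
      rw [eval_div, eval_V, eval_V, hi, hs.B]; norm_cast
    have eP : (V 18 * (2 + V 12 % V 8) : Expr).eval m' = (P * (2 + j % B) : ℕ) := by
      rw [eval_mul, eval_add, eval_mod, eval_V, eval_V, eval_V, eval_two, hi, hs.B, e18]; norm_cast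
    have ei : (V 13 * V 8 + V 12 % V 8 : Expr).eval m' = (o * B + j % B : ℕ) := by
      rw [eval_add, eval_mul, eval_mod, eval_V, eval_V, eval_V, hi, hs.B, e13]; norm_cast
    have key := eval_zeroModE hs.toHolds et eP (by positivity)
    have hsucc := x.count_succ (P * (2 + j % B)) (j / B)
    have hst := div_step_self (j := j) hB0
    refine Runs.ite (T := 1) rfl (fun hz => ?_) (fun hz => ?_)
    · rw [key] at hz
      refine Runs.store (p := o * B + j % B) (v := (x.count (P * (2 + j % B)) (j / B + 1) : ℕ))
        rfl rfl ei ?_ (fun _ => ?_) ⟨fun e he => ?_, fun p hp => ?_⟩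
      · rw [eval_add, eval_read, ei, Int.toNat_natCast, h1 _ hr, hst.1, hsucc.1 hz, eval_one]
        push_cast; rfl
      · exact ((Small.n3 x).of_le ((x.count_le _ _).trans (by omega))).abs_le_H π
      · rw [Memory.set_apply]
        rcases eq_or_ne e (j % B) with rfl | hne
        · rw [if_pos ⟨rfl, rfl⟩, hst.2]
        · rw [if_neg (by omega), h1 e he, div_step_ne he hne]
      · rw [Memory.set_apply, if_neg (by rw [add_mul] at hp; omega), h2 p hp]
    · rw [key] at hz
      refine Runs.skip ⟨fun e he => ?_, h2⟩
      rw [h1 e he]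
      rcases eq_or_ne e (j % B) with rfl | hne
      · rw [hst.1, hst.2, hsucc.2 hz]
      · rw [div_step_ne he hne]
  · rintro m' - ⟨⟨h1, h2⟩, -⟩
    refine ⟨fun e he => ?_, h2⟩
    rw [h1 e he, mul_add_div_of_lt (by omega)]

theorem findMin_runs (h : Setup π x m) (hN : N ≤ x.n * x.n * x.n)
    (h13 : m 13 0 = o)
    (h30 : ∀ e < π.B x, m 30 (o * π.B x + e) = x.count (P * (2 + e)) N) :
    Runs (π.H x) findMin m (1 + (π.B x * 5 + 2)) (fun m' => ∃ d : ℕ, m' 32 0 = d ∧ 2 ≤ d ∧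
      d ≤ π.B x + 1 ∧ ∀ p, 2 ≤ p → p ≤ π.B x + 1 → x.count (P * d) N ≤ x.count (P * p) N) := by
  set B := π.B x with hB
  have hB0 : 0 < B := π.B_pos x
  have hcn : ∀ d, x.count (P * d) N ≤ x.n * x.n * x.n := fun d => (x.count_le _ _).trans hN
  have hBH : ((B : ℤ)) + 1 ≤ π.H x := by
    have h1 := π.B_mul_le_H x (Small.lit (x := x) (c := 2)) (by norm_num)
    have h2 : π.B x + 1 ≤ π.H x := by omega
    exact_mod_cast h2
  -- The initial value exceeds every possible count, so the first candidate is always taken.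
  refine Runs.seq (Runs.assign rfl (v := (x.n * x.n * x.n + 1 : ℕ)) ?_ (((Small.n3 x).add
    (Small.mono (.lit (c := 1)) (by norm_num))).abs_le_H π) ?_)
  · simp only [eval_add, eval_mul, eval_V, h.n, eval_one]; push_cast; rfl
  refine (Runs.forLoop (i := 12) (v := 8) (N := B) (T := 3) (fun j m' => ∃ u d : ℕ, m' 31 0 = u ∧
      (∀ p, 2 ≤ p → p ≤ j + 1 → u ≤ x.count (P * p) N) ∧
      (j = 0 ∧ u = x.n * x.n * x.n + 1 ∨ 0 < j ∧ m' 32 0 = d ∧ 2 ≤ d ∧ d ≤ j + 1 ∧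
        u = x.count (P * d) N))
    (by decide) (by exact h.B) ?_ (fun _ _ _ h => h) ?_).mono le_rfl ?_
  · exact ⟨_, 0, rfl, fun p h1 h2 => by omega, .inl ⟨rfl, rfl⟩⟩
  · rintro j hj m' hfr hi ⟨u, d, h31, hu, hd⟩
    have e13 : m' 13 0 = o := by rw [hfr 13 (by decide) (by decide)]; exact h13
    have e8 : m' 8 0 = B := by rw [hfr 8 (by decide) (by decide)]; exact h.B
    have e30 : m' 30 (o * B + j) = x.count (P * (2 + j)) N := by
      rw [hfr 30 (by decide) (by decide)]; exact h30 j hj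
    have ei : (.read 30 (V 13 * V 8 + V 12) : Expr).eval m' = (x.count (P * (2 + j)) N : ℕ) := by
      have : (V 13 * V 8 + V 12 : Expr).eval m' = (o * B + j : ℕ) := by
        rw [eval_add, eval_mul, eval_V, eval_V, eval_V, hi, e8, e13]; norm_cast
      rw [eval_read, this, Int.toNat_natCast, e30]
    have hlt : 0 < (V 31 - .read 30 (V 13 * V 8 + V 12) : Expr).eval m' ↔
        x.count (P * (2 + j)) N < u := by
      rw [eval_sub, ei, eval_V, h31]; omega
    refine Runs.ite (T := 2) rfl (fun hz => ?_) (fun hz => ?_)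
    · rw [hlt] at hz
      refine Runs.seq (T := 1) (T' := 1) (Runs.assign rfl ei
        (((Small.n3 x).of_le (hcn _)).abs_le_H π) ?_)
      refine Runs.assign rfl (v := (2 + j : ℕ)) ?_ ?_ ?_
      · change m' 12 0 + 2 = _
        rw [hi]; push_cast; ring
      · rw [Nat.abs_cast]; push_cast; omega
      · refine ⟨x.count (P * (2 + j)) N, 2 + j, rfl, fun p h2 hp => ?_,
          .inr ⟨by omega, rfl, by omega, by omega, rfl⟩⟩
        rcases eq_or_ne p (2 + j) with rfl | hne
        · exact le_rfl
        · exact hz.le.trans (hu p h2 (by omega))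
    · rw [hlt] at hz
      refine (Runs.skip ⟨u, d, h31, fun p h2 hp => ?_, ?_⟩ : Runs _ _ _ 1 _).mono (by norm_num)
        fun _ _ h => h
      · rcases eq_or_ne p (2 + j) with rfl | hne
        · omega
        · exact hu p h2 (by omega)
      · rcases hd with ⟨rfl, rfl⟩ | ⟨h1, h2, h3, h4, h5⟩
        · have := hcn (2 + 0); omega
        · exact .inr ⟨by omega, h2, h3, by omega, h5⟩
  · rintro m' - ⟨⟨u, d, h31, hu, hd⟩, -⟩
    rcases hd with ⟨h0, -⟩ | ⟨-, h2, h3, h4, rfl⟩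
    · omega
    · exact ⟨d, h2, h3, h4, hu⟩

/-- The number of steps of `greedy`. -/
def greedySteps (x : WeightedGraph) : ℕ :=
  1 + (1 + (π.k x * ((x.n * x.n * x.n * π.B x * 4 + 2) + ((1 + (π.B x * 5 + 2)) + 1) + 1 + 2) + 2))

/-- Every factor is at least `2`, so `k` rounds either reach `2 ^ k = Q` or stop where another
factor might overshoot, that is, within a factor `B + 1` of `Q`. -/
theorem greedy_runs (hg : 0 < π.g) (hC : (16 * π.g) ^ (2 * π.g) ≤ π.C) (h : Setup π x m)
    (hN : N ≤ x.n * x.n * x.n) (hz : ∀ t < N, ¬ x.Zero t) (h21 : m 21 0 = N)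
    (h30 : ∀ p, m 30 p = 0) :
    Runs (π.H x) greedy m (greedySteps π x) (fun m' => ∃ P : ℕ, m' 18 0 = P ∧ 0 < P ∧ P ≤ π.Q x ∧
      Sparse π x N P ∧ π.Q x ≤ P * (π.B x + 1)) := by
  set B := π.B x with hB
  have hB0 : 0 < B := π.B_pos x
  have hQ0 := π.Q_pos x
  refine Runs.seq (Runs.assign rfl (v := 1) rfl
    (by simpa using (Small.lit (x := x) (c := 1)).abs_le_H π) ?_)
  refine Runs.seq (Runs.assign rfl (v := (N * B : ℕ)) ?_ ?_ ?_)
  · change m 21 0 * m 8 0 = _; rw [h21, h.B]; norm_cast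
  · rw [Nat.abs_cast, mul_comm]
    exact_mod_cast π.B_mul_le_H x (a := 3) ((Small.n3 x).of_le hN) (by norm_num)
  refine (Runs.forLoop (i := 13) (v := 10) (N := π.k x)
    (T := (x.n * x.n * x.n * B * 4 + 2) + ((1 + (B * 5 + 2)) + 1) + 1)
    (fun o m' => ∃ P : ℕ, m' 18 0 = P ∧ 0 < P ∧ P ≤ π.Q x ∧ Sparse π x N P ∧
      (2 ^ o ≤ P ∨ π.Q x ≤ P * (B + 1)) ∧ ∀ p, o * B ≤ p → m' 30 p = 0)
    (by decide) (by exact h.k) ?_ (fun _ _ _ h => h) ?_).mono le_rfl ?_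
  · exact ⟨1, rfl, one_pos, hQ0, Sparse.one π hN, .inl le_rfl, fun p _ => h30 p⟩
  · rintro o ho m' hfr hi ⟨P, h18, hP0, hPQ, hsp, hbig, hz30⟩
    have hs : Setup π x m' := ((h.set (a := 18) 0 1 (by decide)).set (a := 29) 0 (N * B : ℕ)
      (by decide)).frame fun a ha => hfr a ((by decide : ∀ a ∈ setupArrays, a ≠ 13) a ha)
        ((by decide : ∀ a ∈ setupArrays, a ∉ _) a ha)
    have h29 : m' 29 0 = (N * B : ℕ) := by rw [hfr 29 (by decide) (by decide)]; rfl
    have htest : 0 < (V 9 + 1 - V 18 * (V 8 + 1) : Expr).eval m' ↔ P * (B + 1) ≤ π.Q x := by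
      simp only [eval_sub, eval_add, eval_mul, eval_V, eval_one, hs.Q, hs.B, h18]
      rw [sub_pos, Int.lt_add_one_iff]
      norm_cast
    refine Runs.ite rfl (fun ht => ?_) (fun ht => ?_)
    · rw [htest] at ht
      refine Runs.seq (((countAll_runs π hs hN hP0 hi h18 h29 hz30).frame.mono
        (by gcongr) ?_))
      rintro m1 - ⟨⟨h1, h1z⟩, hf1⟩
      have hs1 : Setup π x m1 := hs.frame fun a ha =>
        hf1 a ((by decide : ∀ a ∈ setupArrays, a ∉ countAll.writes) a ha)
      refine Runs.seq ((findMin_runs π hs1 hN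
        (by rw [hf1 13 (by decide), hi]) h1).frame.mono le_rfl ?_)
      rintro m2 - ⟨⟨d, h32, hd2, hdB, hmin⟩, hf2⟩
      have hPd : P * d ≤ π.Q x := (Nat.mul_le_mul_left _ hdB).trans ht
      refine Runs.assign rfl (v := (P * d : ℕ)) ?_ (((Small.Q π x).of_le hPd).abs_le_H π) ?_
      · rw [eval_mul, eval_V, eval_V, h32, hf2 18 (by decide), hf1 18 (by decide), h18]; norm_cast
      · refine ⟨P * d, rfl, by positivity, hPd, hsp.mul hg hC hz hdB hmin, ?_, fun p hp => ?_⟩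
        · rcases hbig with hb | hb
          · exact .inl (by rw [pow_succ]; exact Nat.mul_le_mul hb hd2)
          · right
            exact hb.trans (Nat.mul_le_mul_right _ (Nat.le_mul_of_pos_right _ (by omega)))
        · rw [Memory.set_ne _ (by decide), hf2 30 (by decide)]
          exact h1z p hp
    · rw [htest] at ht
      refine (Runs.skip ⟨P, h18, hP0, hPQ, hsp, .inr (by omega), fun p hp => hz30 p ?_⟩ :
        Runs _ _ _ 1 _).mono (by omega) fun _ _ h => h
      rw [add_mul] at hp; omega
  · rintro m' - ⟨⟨P, h18, hP0, hPQ, hsp, hbig, -⟩, -⟩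
    refine ⟨P, h18, hP0, hPQ, hsp, ?_⟩
    rcases hbig with hb | hb
    · exact hb.trans (Nat.le_mul_of_pos_right _ (by omega))
    · exact hb

theorem listProg_runs (h : Holds x m) {T : ℕ} (hT : T ≤ x.n * x.n * x.n)
    (hN : N ≤ x.n * x.n * x.n) (hP : 0 < P) (hPQ : P ≤ π.Q x) (h16 : m 16 0 = T)
    (h18 : m 18 0 = P) (h21 : m 21 0 = N) :
    Runs (π.H x) listProg m (1 + (1 + (1 + (N * 5 + 2)))) (fun m' => m' 23 0 = T ∧ m' 23 1 = P ∧
      m' 22 0 = x.count P N ∧ ∀ q < x.count P N, ∃ t : ℕ, m' 23 (q + 2) = t ∧ t < N ∧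
        x.ZeroMod P t ∧ ∀ p, p + 1 = q → m' 23 (p + 2) < t) := by
  refine Runs.seq (Runs.store (p := 0) (v := T) rfl rfl rfl h16
    (fun _ => ((Small.n3 x).of_le hT).abs_le_H π) ?_)
  refine Runs.seq (Runs.store (p := 1) (v := P) rfl rfl rfl h18
    (fun _ => ((Small.Q π x).of_le hPQ).abs_le_H π) ?_)
  refine Runs.seq (Runs.assign rfl (v := 0) rfl (by simp) ?_)
  refine (Runs.forLoop (i := 12) (v := 21) (N := N) (T := 3) (fun j m' => m' 23 0 = T ∧ m' 23 1 = P ∧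
      m' 22 0 = x.count P j ∧ ∀ q < x.count P j, ∃ t : ℕ, m' 23 (q + 2) = t ∧ t < j ∧
        x.ZeroMod P t ∧ ∀ p, p + 1 = q → m' 23 (p + 2) < t)
    (by decide) (by exact h21) ?_ (fun _ _ _ h => h) ?_).mono le_rfl ?_
  · have h0 : x.count P 0 = 0 := by simp [WeightedGraph.count]
    refine ⟨?_, ?_, ?_, fun q hq => by omega⟩
    · simp [Memory.set_apply]
    · simp [Memory.set_apply]
    · rw [h0]; rfl
  · rintro j hj m' hfr hi ⟨h0, h1, h22, hl⟩
    have hh : Holds x m' := h.frame fun a ha => by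
      rw [hfr a ((by decide : ∀ a ∈ [3, 4, 5], a ≠ 12) a ha)
        ((by decide : ∀ a ∈ [3, 4, 5], a ∉ _) a ha),
        Memory.set_ne _ ((by decide : ∀ a ∈ [3, 4, 5], a ≠ 22) a ha),
        Memory.set_ne _ ((by decide : ∀ a ∈ [3, 4, 5], a ≠ 23) a ha),
        Memory.set_ne _ ((by decide : ∀ a ∈ [3, 4, 5], a ≠ 23) a ha)]
    have e18 : m' 18 0 = P := by rw [hfr 18 (by decide) (by decide)]; exact h18
    have key := eval_zeroModE (t := V 12) (P := V 18) hh hi e18 hP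
    have hsucc := x.count_succ P j
    have hc := x.count_le P j
    refine Runs.ite (T := 2) rfl (fun hz => ?_) (fun hz => ?_)
    · rw [key] at hz
      rw [hsucc.1 hz]
      refine Runs.seq (T := 1) (T' := 1) (Runs.store (p := x.count P j + 2) (v := j) rfl rfl ?_ hi
        (fun _ => ((Small.n3 x).of_le (by omega)).abs_le_H π) ?_)
      · rw [eval_add, eval_V, h22, eval_two]; push_cast; rfl
      refine Runs.assign rfl (v := (x.count P j + 1 : ℕ)) ?_
        (((Small.n3 x).of_le (by omega)).abs_le_H π) ?_
      · change m' 22 0 + 1 = _; rw [h22]; norm_cast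
      have e23 : ∀ p, ((m'.set 23 (x.count P j + 2) j).set 22 0 (x.count P j + 1 : ℕ)) 23 p =
          if p = x.count P j + 2 then (j : ℤ) else m' 23 p := by
        intro p
        rw [Memory.set_ne _ (by decide), Memory.set_apply]
        simp
      refine ⟨?_, ?_, rfl, fun q hq => ?_⟩
      · rw [e23, if_neg (by omega), h0]
      · rw [e23, if_neg (by omega), h1]
      · simp only [e23]
        rcases eq_or_ne q (x.count P j) with rfl | hne
        · refine ⟨j, if_pos rfl, by omega, hz, fun p hp => ?_⟩
          rw [if_neg (by omega)]
          obtain ⟨t, h3, h4, -⟩ := hl p (by omega)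
          rw [h3]; exact_mod_cast h4
        · obtain ⟨t, h3, h4, h5, h6⟩ := hl q (by omega)
          refine ⟨t, by rw [if_neg (by omega), h3], by omega, h5, fun p hp => ?_⟩
          rw [if_neg (by omega)]
          exact h6 p hp
    · rw [key] at hz
      rw [hsucc.2 hz]
      refine (Runs.skip ⟨h0, h1, h22, fun q hq => ?_⟩ : Runs _ _ _ 1 _).mono (by norm_num)
        fun _ _ h => h
      obtain ⟨t, h3, h4, h5⟩ := hl q hq
      exact ⟨t, h3, by omega, h5⟩
  · rintro m' - ⟨h1, -⟩; exact h1

theorem encodeProg_runs (h : Setup π x m) {cnt : ℕ} (hcnt : cnt ≤ x.n * x.n * x.n)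
    (h22 : m 22 0 = cnt) {v : ℕ → ℕ} (hv : ∀ f < cnt + 2, m 23 f = v f) :
    Runs (π.H x) encodeProg m
      (1 + ((3 * x.len * 3 + 2) + (1 + ((cnt + 2) * (3 * x.len) * 3 + 2)))) (fun m' =>
      ∀ p < (cnt + 2) * (3 * x.len),
        m' 1 p = (v (p / (3 * x.len)) / 2 ^ (3 * x.len - 1 - p % (3 * x.len)) % 2 : ℕ)) := by
  set L := 3 * x.len with hL
  have hL0 : 0 < L := by have := x.two_le_len; omega
  have h2s : ∀ l ≤ L, Small x 3 (2 ^ l) := fun l hl => Nat.pow_le_pow_right (by norm_num) hl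
  refine Runs.seq (Runs.store (p := 0) (v := 1) rfl rfl rfl rfl
    (fun _ => by simpa using (Small.lit (x := x) (c := 1)).abs_le_H π) ?_)
  have hs := h.set (a := 33) 0 1 (by decide)
  refine Runs.seq ((Runs.forLoop (i := 12) (v := 15) (N := L) (T := 1) (fun j m' =>
      ∀ l ≤ j, m' 33 l = (2 ^ l : ℕ)) (by decide) hs.L ?_ (fun _ _ _ h => h) ?_).frame.mono le_rfl ?_)
  · intro l hl
    obtain rfl : l = 0 := by omega
    exact Memory.set_self _ _ _ _
  · intro j hj m' hfr hi h1
    refine Runs.store (p := j + 1) (v := (2 ^ (j + 1) : ℕ)) rfl rfl ?_ ?_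
      (fun _ => (h2s (j + 1) hj).abs_le_H π) ?_
    · rw [eval_add, eval_V, hi]; rfl
    · rw [eval_mul, eval_two, eval_read, eval_V, hi, Int.toNat_natCast, h1 j le_rfl, pow_succ']
      norm_cast
    · intro l hl
      rw [Memory.set_apply]
      rcases eq_or_ne l (j + 1) with rfl | hne
      · rw [if_pos ⟨rfl, rfl⟩]
      · rw [if_neg (fun h => hne h.2), h1 l (by omega)]
  rintro m1 - ⟨⟨h33, -⟩, hf1⟩
  have hs1 : Setup π x m1 := hs.frame fun a ha => hf1 a ((by decide : ∀ a ∈ setupArrays, a ∉ _) a ha)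
  have e22 : m1 22 0 = cnt := by rw [hf1 22 (by decide)]; exact h22
  have e23 : m1 23 = m 23 := by rw [hf1 23 (by decide)]; rfl
  have hNs : Small x 6 ((cnt + 2) * L) := by
    refine Small.mul (a := 4) (b := 2) (((Small.n3 x).of_le hcnt).add
      (Small.mono (.lit (c := 2)) (by norm_num))) ((Small.lit (c := 3)).mul (.len x))
  refine Runs.seq (Runs.assign rfl (v := ((cnt + 2) * L : ℕ)) ?_ (hNs.abs_le_H π) ?_)
  · rw [eval_mul, eval_add, eval_V, eval_V, eval_two, e22, hs1.L]; norm_cast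
  have hs2 := hs1.set (a := 14) 0 ((cnt + 2) * L : ℕ) (by decide)
  refine (Runs.forLoop (i := 12) (v := 14) (N := (cnt + 2) * L) (T := 1) (fun j m' =>
      ∀ p < j, m' 1 p = (v (p / L) / 2 ^ (L - 1 - p % L) % 2 : ℕ)) (by decide) rfl ?_
      (fun _ _ _ h => h) ?_).mono le_rfl ?_
  · intro p hp; omega
  · intro j hj m' hfr hi h1
    have hs3 : Setup π x m' := hs2.frame fun a ha =>
      hfr a ((by decide : ∀ a ∈ setupArrays, a ≠ 12) a ha)
        ((by decide : ∀ a ∈ setupArrays, a ∉ _) a ha)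
    have e33 : ∀ l ≤ L, m' 33 l = (2 ^ l : ℕ) := by
      rw [hfr 33 (by decide) (by decide)]; exact h33
    have e23' : m' 23 = m 23 := by rw [hfr 23 (by decide) (by decide)]; exact e23
    have hr := Nat.mod_lt j hL0
    have hq : j / L < cnt + 2 := Nat.div_lt_of_lt_mul (by rwa [mul_comm])
    have d1 : (V 12 / V 15 : Expr).eval m' = (j / L : ℕ) := by
      rw [eval_div, eval_V, eval_V, hi, hs3.L]; norm_cast
    have d2 : (V 15 - 1 - V 12 % V 15 : Expr).eval m' = (L - 1 - j % L : ℕ) := by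
      rw [eval_sub, eval_sub, eval_mod, eval_V, eval_V, hi, hs3.L, eval_one]
      rw [Nat.cast_sub (by omega), Nat.cast_sub (by omega)]
      norm_cast
    refine Runs.store (p := j) (v := (v (j / L) / 2 ^ (L - 1 - j % L) % 2 : ℕ)) rfl rfl hi ?_
      (fun _ => ?_) ?_
    · rw [eval_mod, eval_div, eval_read, eval_read, d1, d2, Int.toNat_natCast, Int.toNat_natCast,
        e23', hv _ hq, e33 _ (by omega), eval_two]
      norm_cast
    · exact (Small.of_le (Small.lit (x := x) (c := 2)) (Nat.mod_lt _ (by norm_num)).le).abs_le_H π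
    · intro p hp
      rw [Memory.set_apply]
      rcases eq_or_ne p j with rfl | hne
      · rw [if_pos ⟨rfl, rfl⟩]
      · rw [if_neg (fun h => hne h.2), h1 p (by omega)]
  · rintro m' - ⟨h1, -⟩; exact h1

end

/-- The first `l` bits, read from the most significant one, represent `v / 2 ^ (L - l)`. -/
theorem field_eq_of_bits {b : Message} {o L v : ℕ} (hv : v < 2 ^ L)
    (hb : ∀ l < L, b (o + l) = decide (v / 2 ^ (L - 1 - l) % 2 ≠ 0)) : field b o L = v := by
  have key : ∀ l ≤ L, field b o l = v / 2 ^ (L - l) := by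
    intro l
    induction l with
    | zero => intro _; rw [Nat.sub_zero, Nat.div_eq_of_lt hv]; rfl
    | succ l ih =>
      intro hl
      have e : L - l = L - (l + 1) + 1 := by omega
      rw [field, ih (by omega), hb l (by omega), show L - 1 - l = L - (l + 1) by omega, e, pow_succ,
        ← Nat.div_div_eq_div_mul]
      set u := v / 2 ^ (L - (l + 1))
      have h1 := Nat.div_add_mod u 2
      rcases Nat.mod_two_eq_zero_or_one u with h2 | h2
      · simp only [h2, ne_eq, not_true_eq_false, decide_false, Bool.false_eq_true, if_false]; omega
      · simp only [h2, ne_eq, one_ne_zero, not_false_eq_true, decide_true, if_true]; omega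
  rw [key L le_rfl, Nat.sub_self, pow_zero, Nat.div_one]

end PsdProof

end

noncomputable section

namespace PsdProof

local infixr:60 " ;; " => Prog.seq

/-! ### The honest prover's message is accepted. -/

namespace WeightedGraph
variable (x : WeightedGraph)

theorem first_le : x.first ≤ x.n * x.n * x.n := by
  classical
  unfold first
  split_ifs with h
  · exact (Nat.find_spec h).1.le
  · exact le_rfl

theorem not_zero_of_lt_first {t : ℕ} (ht : t < x.first) : ¬ x.Zero t := by
  classical
  intro hz
  have hn := ht.trans_le x.first_le
  unfold first at ht
  rw [dif_pos ⟨t, hn, hz⟩] at ht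
  exact Nat.find_min _ ht ⟨hn, hz⟩

theorem first_spec (h : ∃ T, T < x.n * x.n * x.n ∧ x.Zero T) :
    x.first < x.n * x.n * x.n ∧ x.Zero x.first := by
  classical
  unfold first
  rw [dif_pos h]
  exact Nat.find_spec h

end WeightedGraph

section
variable (π : Params) {x : WeightedGraph} {m : Memory}

/-- The number of steps of `proverProg`. -/
def proverSteps (x : WeightedGraph) : ℕ :=
  preludeSteps π x + ((1 + (1 + (x.n * x.n * x.n * 5 + 2))) + (1 + (greedySteps π x +
    ((1 + (1 + (1 + (x.n * x.n * x.n * 5 + 2)))) + (1 + ((3 * x.len * 3 + 2) +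
      (1 + ((x.n * x.n * x.n + 2) * (3 * x.len) * 3 + 2))))))))

/-- The time bound is needed on every input, the acceptance only if there is a solution. Without
one, the same program runs with the default code `n ^ 3`, below which there is still no zero
triangle. -/
theorem proverProg_runs (hg : 0 < π.g) (hC : (16 * π.g) ^ (2 * π.g) ≤ π.C) (h : Holds x m)
    (h30 : ∀ p, m 30 p = 0) :
    Runs (π.H x) (proverProg π) m (proverSteps π x) (fun m' =>
      (∃ T, T < x.n * x.n * x.n ∧ x.Zero T) → Accepts π x fun p => decide (m' 1 p ≠ 0)) := by
  refine Runs.seq ((prelude_runs π h).frame.mono le_rfl ?_)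
  rintro m1 - ⟨h1, hf1⟩
  rw [prelude_writes] at hf1
  refine Runs.seq ((findFirst_runs π h1.toHolds).frame.mono le_rfl ?_)
  rintro m2 - ⟨h16, hf2⟩
  have h2 : Setup π x m2 := h1.frame fun a ha =>
    hf2 a ((by decide : ∀ a ∈ setupArrays, a ∉ findFirst.writes) a ha)
  refine Runs.seq ((baseProg_runs π h2.toHolds x.first_le h16).mono le_rfl ?_)
  rintro _ - rfl
  set N := x.base x.first with hN
  have hN1 : N ≤ x.first := x.base_le _
  have hNle : N ≤ x.n * x.n * x.n := hN1.trans x.first_le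
  have hz : ∀ t < N, ¬ x.Zero t := fun t ht => x.not_zero_of_lt_first (ht.trans_le hN1)
  have h3 : Setup π x (m2.set 21 0 N) := h2.set 0 _ (by decide)
  refine Runs.seq ((greedy_runs π hg hC h3 hNle hz rfl ?_).frame.mono le_rfl ?_)
  · intro p
    rw [Memory.set_ne _ (by decide), hf2 30 (by decide), hf1 30 (by decide), h30]
  rintro m4 - ⟨⟨P, h18, hP0, hPQ, hsp, hbig⟩, hf4⟩
  have h4 : Setup π x m4 := h3.frame fun a ha =>
    hf4 a ((by decide : ∀ a ∈ setupArrays, a ∉ greedy.writes) a ha)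
  refine Runs.seq ((listProg_runs π h4.toHolds x.first_le hNle hP0 hPQ ?_ h18 ?_).frame.mono
    (by gcongr) ?_)
  · rw [hf4 16 (by decide), Memory.set_ne _ (by decide), h16]
  · rw [hf4 21 (by decide)]; rfl
  rintro m5 - ⟨⟨h230, h231, h22, hl⟩, hf5⟩
  have h5 : Setup π x m5 := h4.frame fun a ha =>
    hf5 a ((by decide : ∀ a ∈ setupArrays, a ∉ listProg.writes) a ha)
  set cnt := x.count P N with hcnt
  have hcle : cnt ≤ x.n * x.n * x.n := (x.count_le _ _).trans hNle
  have hv : ∀ f < cnt + 2, m5 23 f = ((m5 23 f).toNat : ℕ) := by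
    intro f hf
    match f with
    | 0 => rw [h230]; rfl
    | 1 => rw [h231]; rfl
    | q + 2 =>
      obtain ⟨t, ht, -⟩ := hl q (by omega)
      rw [ht]; rfl
  refine (encodeProg_runs π h5 hcle h22 hv).mono (by gcongr) ?_
  rintro m6 - hbits hex
  obtain ⟨hlt, hzero⟩ := x.first_spec hex
  set b : Message := fun p => decide (m6 1 p ≠ 0) with hb
  have hL0 : 0 < 3 * x.len := by have := x.two_le_len; omega
  have hfield : ∀ f < cnt + 2, (m5 23 f).toNat < 2 ^ (3 * x.len) →
      x.fieldAt b f = (m5 23 f).toNat := by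
    intro f hf hlt
    refine field_eq_of_bits hlt fun l hl => ?_
    have h1 : f * (3 * x.len) + l < (cnt + 2) * (3 * x.len) := mul_add_lt hf hl
    simp only [hb]
    rw [hbits _ h1, mul_add_div_of_lt hl, mul_add_mod_of_lt hl]
    norm_cast
  have hn3 : x.n * x.n * x.n ≤ 2 ^ (3 * x.len) := Small.n3 x
  have f0 : x.fieldAt b 0 = x.first := by
    rw [hfield 0 (by omega) (by rw [h230]; exact hlt.trans_le hn3), h230]; rfl
  have f1 : x.fieldAt b 1 = P := by
    rw [hfield 1 (by omega), h231]; · rfl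
    rw [h231]
    -- The modulus fits into a field because `Q ≤ 2 ^ len`, whereas fields have `3 * len` bits.
    refine lt_of_le_of_lt (hPQ.trans (π.Q_le x)) (Nat.pow_lt_pow_right (by norm_num) ?_)
    omega
  have fq : ∀ q < cnt, ∀ t : ℕ, t < N → m5 23 (q + 2) = t → x.fieldAt b (q + 2) = t := by
    intro q hq t ht he
    rw [hfield (q + 2) (by omega) (by rw [he]; exact (ht.trans_le hNle).trans_le hn3), he]; rfl
  constructor
  · rw [f0]; exact hlt
  · rw [f1]; exact hP0
  · rw [f1]; exact hPQ
  · rw [f0]; exact hzero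
  · rw [f0]; exact fun t _ ht => x.not_zero_of_lt_first ht
  · rw [f0, f1]; exact hsp.guard hbig
  · rw [f0, f1]
    intro q hq
    change q < cnt at hq
    obtain ⟨t, h6, h7, h8, h9⟩ := hl q hq
    have ht := fq q hq t h7 h6
    refine ⟨fun p hp => ?_, ?_, ?_, ?_⟩
    · obtain ⟨u, h10, h11, -⟩ := hl p (by omega)
      have h12 := h9 p hp
      rw [h10] at h12
      simp only [ht, fq p (by omega) u h11 h10]
      exact_mod_cast h12
    · simp only [ht]; exact h7
    · simp only [ht]; exact h8
    -- Below the base there is no zero triangle, so every triangle counted is a false positive.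
    · simp only [ht]; exact fun h0 => hz t h7 ⟨h8.1, h0⟩

end

end PsdProof

end

noncomputable section

namespace PsdProof

/-! ### Asymptotic bounds -/

/-- The function `F` is `Õ(n ^ a)`. -/
def Soft (a : ℝ) (F : WeightedGraph → ℕ) : Prop :=
  ∃ (C : ℝ) (k : ℕ), 0 ≤ C ∧ ∀ x, (F x : ℝ) ≤ softBound C k a x.n x.maxWeight

/-- The logarithm may be smaller than `1` but exceeds `1 / 2`, so each additional power costs a
factor `2`. -/
theorem softBound_le {C C' : ℝ} {k k' : ℕ} {a b : ℝ} (hC : 0 ≤ C) (hk : k ≤ k') (hab : a ≤ b)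
    (hC' : C * 2 ^ (k' - k) ≤ C') (n M : ℕ) : softBound C k a n M ≤ softBound C' k' b n M := by
  unfold softBound
  have h1 := one_half_lt_log n M
  set l := Real.log ((n : ℝ) + M + 2)
  have h2 : l ^ k ≤ 2 ^ (k' - k) * l ^ k' := by
    obtain ⟨j, rfl⟩ := Nat.exists_eq_add_of_le hk
    rw [Nat.add_sub_cancel_left, pow_add]
    have h3 : (1 : ℝ) ≤ (2 * l) ^ j := one_le_pow₀ (by linarith)
    have h4 : 0 ≤ l ^ k := pow_nonneg (by linarith) _
    rw [mul_pow] at h3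
    nlinarith
  have h3 : ((n : ℝ) + 1) ^ a ≤ ((n : ℝ) + 1) ^ b :=
    Real.rpow_le_rpow_of_exponent_le (by linarith [n.cast_nonneg (α := ℝ)]) hab
  have h4 : (0 : ℝ) ≤ ((n : ℝ) + 1) ^ a := by positivity
  have h5 : 0 ≤ l ^ k' := pow_nonneg (by linarith) _
  have h6 : 0 ≤ l ^ k := pow_nonneg (by linarith) _
  have h7 : 0 ≤ C' := le_trans (by positivity) hC'
  calc C * ((n : ℝ) + 1) ^ a * l ^ k ≤ C * ((n : ℝ) + 1) ^ a * (2 ^ (k' - k) * l ^ k') := by gcongr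
    _ = (C * 2 ^ (k' - k)) * ((n : ℝ) + 1) ^ a * l ^ k' := by ring
    _ ≤ C' * ((n : ℝ) + 1) ^ b * l ^ k' := by gcongr

namespace Soft
variable {a b : ℝ} {F G : WeightedGraph → ℕ}

theorem common (hF : Soft a F) (hG : Soft b G) : ∃ (C : ℝ) (k : ℕ), 0 ≤ C ∧
    (∀ x, (F x : ℝ) ≤ softBound C k a x.n x.maxWeight) ∧
    ∀ x, (G x : ℝ) ≤ softBound C k b x.n x.maxWeight := by
  obtain ⟨C, k, h0, h1⟩ := hF
  obtain ⟨C', k', h0', h1'⟩ := hG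
  refine ⟨C * 2 ^ (max k k' - k) + C' * 2 ^ (max k k' - k'), max k k', by positivity,
    fun x => (h1 x).trans (softBound_le h0 (le_max_left _ _) le_rfl ?_ _ _),
    fun x => (h1' x).trans (softBound_le h0' (le_max_right _ _) le_rfl ?_ _ _)⟩
  · have : 0 ≤ C' * 2 ^ (max k k' - k') := by positivity
    linarith
  · have : 0 ≤ C * 2 ^ (max k k' - k) := by positivity
    linarith

theorem mono (hF : Soft a F) (hab : a ≤ b) : Soft b F := by
  obtain ⟨C, k, h0, h1⟩ := hF
  exact ⟨C, k, h0, fun x => (h1 x).trans (softBound_le h0 le_rfl hab (by simp) _ _)⟩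

theorem of_le (hF : Soft a F) (h : ∀ x, G x ≤ F x) : Soft a G := by
  obtain ⟨C, k, h0, h1⟩ := hF
  exact ⟨C, k, h0, fun x => le_trans (by exact_mod_cast h x) (h1 x)⟩

theorem add (hF : Soft a F) (hG : Soft a G) : Soft a fun x => F x + G x := by
  obtain ⟨C, k, h0, h1, h2⟩ := hF.common hG
  refine ⟨C + C, k, by positivity, fun x => ?_⟩
  have h1 := h1 x
  have h2 := h2 x
  unfold softBound at h1 h2 ⊢
  push_cast
  linarith

theorem mul' (hF : Soft a F) (hG : Soft b G) : Soft (a + b) fun x => F x * G x := by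
  obtain ⟨C, k, h0, h1⟩ := hF
  obtain ⟨C', k', h0', h1'⟩ := hG
  refine ⟨C * C', k + k', by positivity, fun x => ?_⟩
  push_cast
  refine (mul_le_mul (h1 x) (h1' x) (by positivity) (le_trans (by positivity) (h1 x))).trans_eq ?_
  unfold softBound
  rw [Real.rpow_add (by positivity), pow_add]
  ring

theorem mul {c : ℝ} (hF : Soft a F) (hG : Soft b G) (h : a + b ≤ c) : Soft c fun x => F x * G x :=
  (hF.mul' hG).mono h

theorem const (c : ℕ) (ha : 0 ≤ a := by norm_num) : Soft a fun _ => c := by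
  refine Soft.mono (a := 0) ⟨c, 0, by positivity, fun x => ?_⟩ ha
  simp [softBound]

theorem const_mul (c : ℕ) (hF : Soft a F) : Soft a fun x => c * F x :=
  (const c (a := 0)).mul hF (by rw [zero_add])

theorem mul_const (hF : Soft a F) (c : ℕ) : Soft a fun x => F x * c :=
  hF.mul (const c (a := 0)) (by rw [add_zero])

theorem pow (hF : Soft 0 F) (j : ℕ) : Soft 0 fun x => F x ^ j := by
  induction j with
  | zero => simpa using Soft.const 1
  | succ j ih => simpa only [pow_succ] using ih.mul hF (by norm_num)

theorem of_rpow {c a : ℝ} (hc : 0 ≤ c) (h : ∀ x, (F x : ℝ) ≤ c * ((x.n : ℝ) + 1) ^ a) : Soft a F :=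
  ⟨c, 0, hc, fun x => (h x).trans_eq (by simp [softBound])⟩

theorem n : Soft 1 fun x => x.n :=
  of_rpow (c := 1) (by norm_num) fun x => by rw [Real.rpow_one]; linarith

theorem n2 : Soft 2 fun x => x.n * x.n := n.mul n (by norm_num)
theorem n3 : Soft 3 fun x => x.n * x.n * x.n := n2.mul n (by norm_num)

theorem len : Soft 0 fun x => x.len := by
  -- The constant is `2 * 5 + 4`, from the bound of the sum of squares by a fifth power.
  refine ⟨14, 1, by norm_num, fun x => ?_⟩
  have hW : ∀ p, (x.W p).natAbs ≤ x.maxWeight := by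
    intro p
    have h := abs_rowMajor_le (A := x.weightMatrix) (M := x.maxWeight) (fun i j =>
      Finset.le_sup (f := fun p : Fin x.n × Fin x.n => (x.weightMatrix p.1 p.2).natAbs)
        (Finset.mem_univ (i, j))) p
    rw [Int.abs_eq_natAbs] at h
    exact_mod_cast h
  have h1 : x.sumSq ≤ (x.n + x.maxWeight + 2) ^ 5 := by
    have h2 : ∑ p ∈ Finset.range (x.n * x.n), (x.W p).natAbs ^ 2 ≤
        x.n * x.n * x.maxWeight ^ 2 := by
      refine (Finset.sum_le_card_nsmul _ _ (x.maxWeight ^ 2) fun p _ =>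
        Nat.pow_le_pow_left (hW p) 2).trans_eq (by simp)
    set y := x.n + x.maxWeight + 2 with hy
    have h3 : x.n * x.n * x.maxWeight ^ 2 ≤ y ^ 4 := by
      calc x.n * x.n * x.maxWeight ^ 2 ≤ y * y * y ^ 2 := by gcongr <;> omega
        _ = y ^ 4 := by ring
    have h4 : x.n + 2 ≤ y ^ 4 := by
      calc x.n + 2 ≤ y := by omega
        _ = y ^ 1 := (pow_one _).symm
        _ ≤ y ^ 4 := Nat.pow_le_pow_right (by omega) (by norm_num)
    have h5 : 2 * y ^ 4 ≤ y ^ 5 := by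
      rw [pow_succ y 4, mul_comm]; exact Nat.mul_le_mul_left _ (by omega)
    unfold WeightedGraph.sumSq
    omega
  have h2 := size_le_log h1
  simp only [softBound, Real.rpow_zero, mul_one, pow_one]
  unfold WeightedGraph.len
  push_cast at h2 ⊢
  linarith

section params
variable (π : Params)

theorem k : Soft 0 fun x => π.k x := len.of_le π.k_le

theorem B : Soft 0 fun x => π.B x := (len.pow _).const_mul _

theorem size_H : Soft 0 fun x => (π.H x).size := by
  simp only [Params.size_H]
  exact (len.const_mul _).add (const 1)

theorem Q_le_rpow (x : WeightedGraph) :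
    (π.Q x : ℝ) ≤ 2 * ((x.n : ℝ) + 1) ^ ((π.r : ℝ) / π.s) := by
  have hs : (0 : ℝ) < π.s := by exact_mod_cast π.s_pos
  have h1 : (1 : ℝ) ≤ ((x.n : ℝ) + 1) ^ ((π.r : ℝ) / π.s) :=
    Real.one_le_rpow (by linarith [x.n.cast_nonneg (α := ℝ)]) (by positivity)
  rcases Nat.eq_zero_or_pos (π.k x) with h0 | h0
  · unfold Params.Q; rw [h0]; push_cast; linarith
  · obtain ⟨j, hj⟩ := Nat.exists_eq_succ_of_ne_zero h0.ne'
    have h2 := π.lt_k x (j := j) (by omega)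
    have h3 : ((2 : ℝ) ^ j) ≤ ((x.n : ℝ) + 1) ^ ((π.r : ℝ) / π.s) := by
      rw [← pow_le_pow_iff_left₀ (by positivity) (by positivity) π.s_pos.ne',
        ← Real.rpow_natCast (((x.n : ℝ) + 1) ^ ((π.r : ℝ) / π.s)), ← Real.rpow_mul (by positivity),
        div_mul_cancel₀ _ hs.ne', Real.rpow_natCast]
      calc ((2 : ℝ) ^ j) ^ π.s ≤ (x.n : ℝ) ^ π.r := by exact_mod_cast h2
        _ ≤ _ := by gcongr; linarith
    unfold Params.Q
    rw [hj, pow_succ]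
    push_cast
    linarith

theorem Q : Soft ((π.r : ℝ) / π.s) fun x => π.Q x := of_rpow (by norm_num) (Q_le_rpow π)

/-- `3 ^ 5 = 243 ≤ 256 = 2 ^ 8`, so `3 ^ k ≤ Q ^ (8 / 5)`. An exponent definitely below `2` is what
leaves slack in the final balance. -/
theorem D : Soft (1.6 * ((π.r : ℝ) / π.s)) fun x => π.D x := by
  refine of_rpow (c := 2 ^ (1.6 : ℝ)) (by positivity) fun x => ?_
  have h1 : (π.D x : ℝ) ≤ (π.Q x : ℝ) ^ (1.6 : ℝ) := by
    rw [← pow_le_pow_iff_left₀ (n := 5) (by positivity) (by positivity) (by norm_num),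
      ← Real.rpow_natCast ((π.Q x : ℝ) ^ (1.6 : ℝ)), ← Real.rpow_mul (by positivity),
      show (1.6 : ℝ) * (5 : ℕ) = (8 : ℕ) by norm_num, Real.rpow_natCast]
    have : π.D x ^ 5 ≤ π.Q x ^ 8 := by
      unfold Params.D Params.Q
      rw [← pow_mul, ← pow_mul, mul_comm, mul_comm _ 8, pow_mul, pow_mul]
      exact Nat.pow_le_pow_left (by norm_num) _
    exact_mod_cast this
  refine h1.trans ?_
  calc (π.Q x : ℝ) ^ (1.6 : ℝ) ≤ (2 * ((x.n : ℝ) + 1) ^ ((π.r : ℝ) / π.s)) ^ (1.6 : ℝ) :=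
        Real.rpow_le_rpow (by positivity) (Q_le_rpow π x) (by norm_num)
    _ = _ := by
        rw [Real.mul_rpow (by norm_num) (by positivity), ← Real.rpow_mul (by positivity), mul_comm (1.6 : ℝ)]

theorem intCost_D : Soft 0 fun x => intCost (π.D x) := by
  refine (len.const_mul 2).add (const 2) |>.of_le fun x => ?_
  unfold intCost
  rw [Int.natAbs_natCast]
  have : (π.D x).size ≤ (2 ^ (2 * x.len)).size := Nat.size_le_size (π.D_le x)
  rw [Nat.size_pow] at this
  omega

end params
end Soft

/-- The maximal number of false positives that the verifier accepts. -/
def Params.cmax (π : Params) (x : WeightedGraph) : ℕ :=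
  Nat.findGreatest (fun y => y ^ π.g * π.Q x ^ (π.g - 1) ≤
    x.n ^ (3 * π.g) * (π.B x + 1) ^ (π.g - 1)) (x.n * x.n * x.n)

/-- Solve the guard for the count and use `Q ≥ n ^ (r / s)`; the powers of `B + 1` are
polylogarithmic. -/
theorem Soft.cmax (π : Params) (hg : 0 < π.g) :
    Soft (3 - (π.r : ℝ) / π.s * (1 - 1 / π.g)) π.cmax := by
  set ρ := (π.r : ℝ) / π.s with hρ
  have hs : (0 : ℝ) < π.s := by exact_mod_cast π.s_pos
  have hg' : (0 : ℝ) < π.g := by exact_mod_cast hg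
  have hg1 : (1 : ℝ) ≤ π.g := by exact_mod_cast hg
  have hρ0 : 0 ≤ ρ := by positivity
  have hρ1 : ρ ≤ 1 := by rw [hρ, div_le_one hs]; exact_mod_cast π.r_le
  have hγ : 0 ≤ 1 - 1 / (π.g : ℝ) := by rw [sub_nonneg, div_le_one hg']; exact hg1
  have hγ1 : 1 - 1 / (π.g : ℝ) ≤ 1 := by
    have : 0 ≤ 1 / (π.g : ℝ) := by positivity
    linarith
  set e := 3 - ρ * (1 - 1 / π.g) with he
  have he0 : 0 ≤ e := by nlinarith
  obtain ⟨C, k, hC, hB⟩ := (Soft.B π).add (Soft.const 1)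
  refine ⟨C, k, hC, fun x => ?_⟩
  have hspec : π.cmax x ^ π.g * π.Q x ^ (π.g - 1) ≤
      x.n ^ (3 * π.g) * (π.B x + 1) ^ (π.g - 1) :=
    Nat.findGreatest_spec (P := fun y => y ^ π.g * π.Q x ^ (π.g - 1) ≤
      x.n ^ (3 * π.g) * (π.B x + 1) ^ (π.g - 1)) (Nat.zero_le _) (by simp [hg.ne'])
  have hle : π.cmax x ≤ x.n * x.n * x.n := Nat.findGreatest_le _
  have key : (π.cmax x : ℝ) ≤ (π.B x + 1 : ℕ) * ((x.n : ℝ) + 1) ^ e := by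
    -- The argument divides by a power of `n`, so the empty graph is treated separately.
    rcases Nat.eq_zero_or_pos x.n with h0 | h0
    · rw [h0] at hle
      have : π.cmax x = 0 := by omega
      rw [this]; push_cast; positivity
    have hn : (0 : ℝ) < x.n := by exact_mod_cast h0
    have hQ : (x.n : ℝ) ^ ρ ≤ π.Q x := by
      rw [← pow_le_pow_iff_left₀ (by positivity) (by positivity) π.s_pos.ne',
        ← Real.rpow_natCast ((x.n : ℝ) ^ ρ), ← Real.rpow_mul hn.le, hρ,
        div_mul_cancel₀ _ hs.ne', Real.rpow_natCast]
      exact_mod_cast (π.k_spec x).le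
    have h1 : (π.cmax x : ℝ) ≤ (π.B x + 1 : ℕ) * (x.n : ℝ) ^ e := by
      rw [← pow_le_pow_iff_left₀ (by positivity) (by positivity) hg.ne']
      have h2 : (0 : ℝ) < ((x.n : ℝ) ^ ρ) ^ (π.g - 1) := by positivity
      refine le_of_mul_le_mul_right ?_ h2
      have h3 : ((x.n : ℝ) ^ e) ^ π.g * ((x.n : ℝ) ^ ρ) ^ (π.g - 1) = (x.n : ℝ) ^ (3 * π.g) := by
        rw [← Real.rpow_natCast, ← Real.rpow_natCast ((x.n : ℝ) ^ ρ), ← Real.rpow_mul hn.le,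
          ← Real.rpow_mul hn.le, ← Real.rpow_add hn, ← Real.rpow_natCast, Nat.cast_sub hg]
        congr 1
        rw [he]
        push_cast
        field_simp
        ring
      have hBpos : (1 : ℝ) ≤ (π.B x + 1 : ℕ) := by push_cast; linarith [(π.B x).cast_nonneg (α := ℝ)]
      calc (π.cmax x : ℝ) ^ π.g * ((x.n : ℝ) ^ ρ) ^ (π.g - 1)
          ≤ (π.cmax x : ℝ) ^ π.g * (π.Q x : ℝ) ^ (π.g - 1) := by gcongr
        _ ≤ (x.n : ℝ) ^ (3 * π.g) * ((π.B x + 1 : ℕ) : ℝ) ^ (π.g - 1) := by exact_mod_cast hspec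
        _ ≤ (x.n : ℝ) ^ (3 * π.g) * ((π.B x + 1 : ℕ) : ℝ) ^ π.g := by
            gcongr
            omega
        _ = _ := by rw [mul_pow, ← h3]; ring
    refine h1.trans ?_
    gcongr
    linarith
  refine key.trans ?_
  have h2 := hB x
  simp only [softBound, Real.rpow_zero, mul_one] at h2 ⊢
  calc ((π.B x + 1 : ℕ) : ℝ) * ((x.n : ℝ) + 1) ^ e
      ≤ (C * Real.log ((x.n : ℝ) + x.maxWeight + 2) ^ k) * ((x.n : ℝ) + 1) ^ e := by gcongr
    _ = _ := by ring

/-- Fast matrix multiplication for matrices with entries in `{-1, 0, 1}`. -/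
theorem exists_multiplies {τ : ℝ} (h : MatMulInTime τ) :
    ∃ (c : Prog) (f : ℕ → ℕ), Multiplies c f ∧ Soft τ fun x => f x.n := by
  obtain ⟨c, C, k, hc, h⟩ := h
  refine ⟨c, fun n => ⌊softBound C k τ n 1⌋₊, ⟨hc, fun n A B hA hB => ?_⟩, ?_⟩
  · obtain ⟨s, t, h1, h2, h3⟩ := h n 1 A B hA hB
    exact ⟨s, t, h1, Nat.le_floor h2, h3⟩
  -- The entries are bounded by `1` whatever the weights are, and `log (n + 3) ≤ 2 * log (n + M +
  -- 2)`.
  · refine ⟨|C| * 2 ^ k, k, by positivity, fun x => ?_⟩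
    set n := x.n
    set M := x.maxWeight
    have hn := n.cast_nonneg (α := ℝ)
    have hM := M.cast_nonneg (α := ℝ)
    have hl1 := one_half_lt_log n 1
    have hl : Real.log ((n : ℝ) + (1 : ℕ) + 2) ≤ 2 * Real.log ((n : ℝ) + M + 2) := by
      rw [show (2 : ℝ) * Real.log ((n : ℝ) + M + 2) = Real.log (((n : ℝ) + M + 2) ^ 2) by
        rw [Real.log_pow]; norm_num]
      refine Real.log_le_log (by positivity) ?_
      push_cast
      nlinarith
    have h1 : softBound C k τ n 1 ≤ |C| * 2 ^ k * ((n : ℝ) + 1) ^ τ *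
        Real.log ((n : ℝ) + M + 2) ^ k := by
      unfold softBound
      calc C * ((n : ℝ) + 1) ^ τ * Real.log ((n : ℝ) + (1 : ℕ) + 2) ^ k
          ≤ |C| * ((n : ℝ) + 1) ^ τ * (2 * Real.log ((n : ℝ) + M + 2)) ^ k := by
            have : 0 ≤ Real.log ((n : ℝ) + (1 : ℕ) + 2) := le_trans (by norm_num) hl1.le
            gcongr
            exact le_abs_self C
        _ = _ := by ring
    have h2 := one_half_lt_log n M
    have h3 : 0 ≤ |C| * 2 ^ k * ((n : ℝ) + 1) ^ τ * Real.log ((n : ℝ) + M + 2) ^ k := by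
      have : 0 ≤ Real.log ((n : ℝ) + M + 2) := by linarith
      positivity
    calc ((⌊softBound C k τ n 1⌋₊ : ℕ) : ℝ) ≤
        (⌊|C| * 2 ^ k * ((n : ℝ) + 1) ^ τ * Real.log ((n : ℝ) + M + 2) ^ k⌋₊ : ℕ) := by
          exact_mod_cast Nat.floor_le_floor h1
      _ ≤ _ := Nat.floor_le h3

/-- A rational exponent strictly above `δ` tolerates the loss `1 - 1 / g` once `g` is large, and
staying below `1.2 * δ` keeps the number of matrix products in budget. -/
theorem exists_params {δ : ℝ} (h0 : 0 < δ) (h1 : δ ≤ 1 / 3) :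
    ∃ π : Params, 0 < π.g ∧ (16 * π.g) ^ (2 * π.g) ≤ π.C ∧
      (π.r : ℝ) / π.s < 1.2 * δ ∧ δ ≤ (π.r : ℝ) / π.s * (1 - 1 / π.g) := by
  obtain ⟨q, hq1, hq2⟩ := exists_rat_btwn (show δ < 1.2 * δ by linarith)
  have hqpos : (0 : ℝ) < q := h0.trans hq1
  have hq0 : 0 < q := by exact_mod_cast hqpos
  obtain ⟨g, hg⟩ := exists_nat_gt ((q : ℝ) / (q - δ))
  have hd : 0 < (q : ℝ) - δ := by linarith
  have hgpos : (0 : ℝ) < g := lt_trans (by positivity) hg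
  have hgn : 0 < g := by exact_mod_cast hgpos
  have hden : (0 : ℝ) < q.den := by exact_mod_cast q.den_pos
  have hnum : ((q.num.toNat : ℕ) : ℝ) = q.num := by
    have : ((q.num.toNat : ℕ) : ℤ) = q.num := Int.toNat_of_nonneg (Rat.num_nonneg.2 hq0.le)
    exact_mod_cast this
  have hval : ((q.num.toNat : ℕ) : ℝ) / q.den = q := by
    rw [hnum]; exact_mod_cast Rat.num_div_den q
  have hle : q.num.toNat ≤ q.den := by
    have h2 : ((q.num.toNat : ℕ) : ℝ) / q.den ≤ 1 := by rw [hval]; linarith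
    rw [div_le_one hden] at h2
    exact_mod_cast h2
  refine ⟨⟨(16 * g) ^ (2 * g), g, q.num.toNat, q.den, q.den_pos, hle, by positivity⟩, hgn, le_rfl,
    ?_, ?_⟩
  · simp only [hval]; exact hq2
  · simp only [hval]
    rw [div_lt_iff₀ hd] at hg
    have h3 : (q : ℝ) / g ≤ q - δ := by rw [div_le_iff₀ hgpos]; linarith
    have h4 : (q : ℝ) * (1 - 1 / g) = q - q / g := by ring
    linarith

theorem Params.le_cmax {π : Params} {x : WeightedGraph} {y : ℕ} (hy : y ≤ x.n * x.n * x.n)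
    (h : y ^ π.g * π.Q x ^ (π.g - 1) ≤ x.n ^ (3 * π.g) * (π.B x + 1) ^ (π.g - 1)) : y ≤ π.cmax x :=
  Nat.le_findGreatest hy h

end PsdProof

end

noncomputable section

namespace PsdProof

local infixr:60 " ;; " => Prog.seq

namespace Soft
variable (π : Params)

theorem preludeSteps : Soft 2 (preludeSteps π) := by
  have c : ∀ j : ℕ, Soft 2 fun _ => j := fun j => Soft.const j
  have hl : Soft 2 fun x => x.len * (2 + 1) := (len.mul_const _).mono (by norm_num)
  have hk : Soft 2 fun x => π.k x * (3 + 1) := ((k π).mul_const _).mono (by norm_num)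
  exact ((c 1).add ((c 1).add ((n2.mul_const 3).add (c 2)))).add
    (((c 1).add (hl.add (c 1))).add ((c 1).add
      (((c 1).add ((c 1).add ((c 1).add (hk.add (c 1))))).add (c 1))))

theorem greedySteps : Soft 3 (greedySteps π) := by
  have c : ∀ j : ℕ, Soft 3 fun _ => j := fun j => Soft.const j
  have hB : Soft 3 fun x => π.B x * 5 := ((B π).mul_const _).mono (by norm_num)
  have hn : Soft 3 fun x => x.n * x.n * x.n * π.B x * 4 :=
    (n3.mul (B π) (by norm_num)).mul_const _
  exact (c 1).add ((c 1).add (((k π).mul (b := 3) ((((hn.add (c 2)).add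
    (((c 1).add (hB.add (c 2))).add (c 1))).add (c 1)).add (c 2)) (by norm_num)).add (c 2)))

theorem proverSteps : Soft 3 (proverSteps π) := by
  have c : ∀ j : ℕ, Soft 3 fun _ => j := fun j => Soft.const j
  have hn : Soft 3 fun x => x.n * x.n * x.n * 5 := n3.mul_const _
  have hL : Soft 0 fun x => 3 * x.len := len.const_mul _
  have hL' : Soft 3 fun x => 3 * x.len * 3 := (hL.mul_const _).mono (by norm_num)
  have hb : Soft 3 fun x => (x.n * x.n * x.n + 2) * (3 * x.len) * 3 :=
    ((n3.add (c 2)).mul hL (by norm_num)).mul_const _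
  exact ((preludeSteps π).mono (by norm_num)).add (((c 1).add ((c 1).add (hn.add (c 2)))).add
    ((c 1).add ((greedySteps π).add (((c 1).add ((c 1).add ((c 1).add (hn.add (c 2))))).add
      ((c 1).add ((hL'.add (c 2)).add ((c 1).add (hb.add (c 2)))))))))

/-- The hypotheses on `e` cover, in this order, the searches over `n * n` triples or pairs, the
coefficient tables, the writing and summing of matrices, the matrix products, and the list. -/
theorem verifierSteps (hg : 0 < π.g) {c : Prog} {f : ℕ → ℕ} {τ e : ℝ} (hf : Soft τ fun x => f x.n)
    (hτ : 0 ≤ τ) (he : 2 ≤ e) (h1 : 2.6 * ((π.r : ℝ) / π.s) ≤ e)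
    (h2 : 2 + 1.6 * ((π.r : ℝ) / π.s) ≤ e) (h3 : τ + 1.6 * ((π.r : ℝ) / π.s) ≤ e)
    (h4 : 3 - (π.r : ℝ) / π.s * (1 - 1 / π.g) ≤ e) :
    Soft e fun x => verifierSteps π c f x (π.cmax x) := by
  have k : ∀ j : ℕ, Soft e fun _ => j := fun j => Soft.const j (by linarith)
  have hL : Soft 0 fun x => 3 * x.len := len.const_mul _
  have hL' : Soft e fun x => 2 * (3 * x.len) * 3 :=
    ((hL.const_mul _).mul_const _).mono (by linarith)
  have hcm : Soft e π.cmax := (cmax π hg).mono h4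
  have hcm' : Soft e fun x => (π.cmax x + 2) * (3 * x.len) * 3 :=
    ((hcm.add (k 2)).mul hL (by linarith)).mul_const _
  have hcall : Soft e fun x => callSteps π c f x := by
    have h5 : Soft τ fun x => 1 + c.overhead * (2 * intCost (π.D x)) * f x.n + 2 :=
      ((const 1 hτ).add ((((intCost_D π).const_mul 2).const_mul c.overhead).mul hf
        (by linarith))).add (const 2 hτ)
    exact ((D π).mul h5 (by linarith)).add (k 2)
  have hDQ : Soft e fun x => π.D x * π.Q x * 10 := ((D π).mul (Q π) (by linarith)).mul_const _
  have hnD : ∀ j : ℕ, Soft e fun x => x.n * x.n * π.D x * j := fun j =>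
    (n2.mul (D π) h2).mul_const _
  have hcount : Soft e fun x => countSteps π c f x :=
    ((k 1).add ((k 1).add ((k 1).add ((k 1).add (hDQ.add (k 2)))))).add
      (((k 1).add ((hnD 6).add (k 2))).add (hcall.add ((k 1).add ((k 1).add ((hnD 4).add (k 2))))))
  have hmain : Soft e fun x => verifierMainSteps π c f x (π.cmax x) :=
    (k 1).add ((k 1).add (((k 1).add (((n2.mul_const 4).mono he).add (k 2))).add (hcount.add
      ((((k 1).add (((k 1).add (hcm'.add (k 2))).add ((k 1).add ((hcm.mul_const 8).add (k 2))))).add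
        (k 1)).add ((k 4).add (k 1))))))
  exact ((preludeSteps π).mono he).add (((k 1).add (((k 1).add (hL'.add (k 2))).add
    ((k 1).add (k 1)))).add (((hmain.add (k 1)).add (k 1)).add (k 1)))

/-- From steps to time. -/
theorem time {F : WeightedGraph → ℕ} {a : ℝ} (hF : Soft a F) (ha : 0 ≤ a) (w : ℕ) :
    Soft a fun x => 1 + F x * (w * ((π.H x).size + 1)) :=
  (const 1 ha).add (hF.mul (((size_H π).add (const 1)).const_mul w) (by rw [add_zero]))

end Soft

/-! ### The initial memory -/

theorem WeightedGraph.holds_receive (x : WeightedGraph) (r : ℕ → Bool) (b : Message) :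
    Holds x ((⟨x.encode, r⟩ : State).receive b).mem := ⟨rfl, rfl, rfl⟩

theorem WeightedGraph.receive_eq_zero (x : WeightedGraph) (r : ℕ → Bool) (b : Message) {a : ℕ}
    (ha : a ∉ [0, 3, 4, 5]) (p : ℕ) : ((⟨x.encode, r⟩ : State).receive b).mem a p = 0 := by
  simp only [List.mem_cons, List.not_mem_nil, or_false, not_or] at ha
  change Function.update x.encode inbox _ a p = 0
  rw [Function.update_of_ne (by exact ha.1)]
  unfold encode
  split <;> simp_all

theorem WeightedGraph.bdd_receive (π : Params) (x : WeightedGraph) (r : ℕ → Bool) (b : Message) :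
    Bdd (π.H x) ((⟨x.encode, r⟩ : State).receive b).mem := by
  have hS : (x.sumSq : ℤ) ≤ π.H x := by
    have : Small x 1 x.sumSq := by unfold Small; rw [one_mul]; exact x.sumSq_lt.le
    exact_mod_cast this.le_H π
  have h1 : (1 : ℤ) ≤ π.H x := by
    exact_mod_cast (Small.lit (x := x) (c := 1)).le_H π
  intro a _ p
  by_cases ha : a ∈ [0, 3, 4, 5]
  · simp only [List.mem_cons, List.not_mem_nil, or_false] at ha
    rcases ha with rfl | rfl | rfl | rfl
    · change |if b p then (1 : ℤ) else 0| ≤ _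
      split_ifs <;> simp [h1.trans']
    · change |scalar x.n p| ≤ _
      unfold scalar
      split_ifs
      · exact (Small.n x).abs_le_H π
      · simp
    · exact (x.abs_A_le p).trans h1
    · exact (x.abs_W_le_sumSq p).trans hS
  · rw [x.receive_eq_zero r b ha]; simp

/-! ### Solutions -/

namespace WeightedGraph
variable (x : WeightedGraph)

/-- The triple with the code `T`. -/
def triple (T : ℕ) : ℕ ×ₗ ℕ ×ₗ ℕ :=
  toLex (T / x.n / x.n, toLex (T / x.n % x.n, T % x.n))

theorem A_apply (i j : Fin x.n) [Decidable (x.graph.Adj i j)] :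
    x.A ((i : ℕ) * x.n + j) = if x.graph.Adj i j then 1 else 0 := by
  rw [A, rowMajor_apply, adjMatrix, Matrix.of_apply]
  congr

theorem W_apply {i j : Fin x.n} (h : x.graph.Adj i j) :
    x.W ((i : ℕ) * x.n + j) = x.weight s(i, j) := by
  rw [W, rowMajor_apply, weightMatrix, Matrix.of_apply, if_pos h]

theorem zero_iff (i j k : Fin x.n) :
    x.Zero (((i : ℕ) * x.n + j) * x.n + k) ↔ x.IsZeroTriangle i j k := by
  classical
  unfold Zero IsZeroTriangle tri wt
  rw [mul_add_div_of_lt k.2, mul_add_mod_of_lt k.2, mul_add_div_of_lt j.2, mul_add_mod_of_lt j.2,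
    A_apply, A_apply, A_apply]
  by_cases h1 : x.graph.Adj i j <;> by_cases h2 : x.graph.Adj i k <;>
    by_cases h3 : x.graph.Adj j k <;> simp [h1, h2, h3, W_apply]

theorem rel_iff (y : ℕ ×ₗ ℕ ×ₗ ℕ) : zeroWeightTriangle.Rel x y ↔
    ∃ T, T < x.n * x.n * x.n ∧ x.Zero T ∧ y = x.triple T := by
  constructor
  · rintro ⟨i, j, k, rfl, h⟩
    refine ⟨((i : ℕ) * x.n + j) * x.n + k, mul_add_lt (mul_add_lt i.2 j.2) k.2,
      (x.zero_iff i j k).2 h, ?_⟩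
    unfold triple
    rw [mul_add_div_of_lt k.2, mul_add_mod_of_lt k.2, mul_add_div_of_lt j.2, mul_add_mod_of_lt j.2]
  · rintro ⟨T, hT, hz, rfl⟩
    have h0 : 0 < x.n := Nat.pos_of_ne_zero (by intro h; simp [h] at hT)
    refine ⟨⟨T / x.n / x.n, ?_⟩, ⟨T / x.n % x.n, Nat.mod_lt _ h0⟩, ⟨T % x.n, Nat.mod_lt _ h0⟩, rfl, ?_⟩
    · rw [Nat.div_div_eq_div_mul]
      exact Nat.div_lt_of_lt_mul (by rwa [mul_assoc, mul_comm] at hT ⊢)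
    · rw [← zero_iff]
      simpa only [Nat.div_add_mod'] using hz

/-- The code is positional notation in base `n`, so numerical order is lexicographic order; hence
the first code gives the least solution. -/
theorem triple_mono {T T' : ℕ} (h : T ≤ T') : x.triple T ≤ x.triple T' := by
  have key : ∀ {a b : ℕ}, a ≤ b → a / x.n < b / x.n ∨ a / x.n = b / x.n ∧ a % x.n ≤ b % x.n := by
    intro a b hab
    rcases (Nat.div_le_div_right (c := x.n) hab).lt_or_eq with h1 | h1
    · exact .inl h1
    · refine .inr ⟨h1, ?_⟩
      have h2 := Nat.div_add_mod' a x.n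
      have h3 := Nat.div_add_mod' b x.n
      rw [h1] at h2
      omega
  unfold triple
  rw [Prod.Lex.toLex_le_toLex, Prod.Lex.toLex_le_toLex]
  rcases key h with h1 | ⟨h1, h2⟩
  · rcases key h1.le with h3 | ⟨h3, h4⟩
    · exact .inl h3
    · refine .inr ⟨h3, .inl (lt_of_le_of_ne h4 fun h5 => ?_)⟩
      have h6 := Nat.div_add_mod' (T / x.n) x.n
      have h7 := Nat.div_add_mod' (T' / x.n) x.n
      have h8 : T / x.n % x.n = T' / x.n % x.n := h5
      rw [h3, h8] at h6
      omega
  · exact .inr ⟨by simp only [h1], .inr ⟨by simp only [h1], h2⟩⟩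

theorem exists_rel_iff : (∃ y, zeroWeightTriangle.Rel x y) ↔
    ∃ T, T < x.n * x.n * x.n ∧ x.Zero T := by
  constructor
  · rintro ⟨y, hy⟩
    obtain ⟨T, h1, h2, -⟩ := (x.rel_iff y).1 hy
    exact ⟨T, h1, h2⟩
  · rintro ⟨T, h1, h2⟩
    exact ⟨_, (x.rel_iff _).2 ⟨T, h1, h2, rfl⟩⟩

theorem isLeast_triple_first (h : ∃ y, zeroWeightTriangle.Rel x y) :
    IsLeast {y : ℕ ×ₗ ℕ ×ₗ ℕ | zeroWeightTriangle.Rel x y} (x.triple x.first) := by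
  obtain ⟨h1, h2⟩ := x.first_spec (x.exists_rel_iff.1 h)
  refine ⟨(x.rel_iff _).2 ⟨_, h1, h2, rfl⟩, fun y hy => ?_⟩
  obtain ⟨T, h3, h4, rfl⟩ := (x.rel_iff y).1 hy
  exact x.triple_mono (not_lt.1 fun h5 => x.not_zero_of_lt_first h5 h4)

end WeightedGraph

theorem Verdict.decode {x : WeightedGraph} {T : ℕ} {p : Prop} {m : Memory} (h : Verdict x T p m) :
    (p ∧ zeroWeightTriangle.decode (m result) = some (x.triple T)) ∨
      (¬ p ∧ zeroWeightTriangle.decode (m result) = none) := by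
  rcases h with ⟨hp, h0, h1, h2, h3⟩ | ⟨hp, h0⟩
  · refine .inl ⟨hp, ?_⟩
    change (if m 2 0 = 0 then none else some (toLex ((m 2 1).toNat, toLex ((m 2 2).toNat, (m 2 3).toNat)))) = _
    rw [if_neg (by omega), h1, h2, h3]
    rfl
  · exact .inr ⟨hp, if_pos h0⟩

/-! ### Protocols of `NP` type -/

/-- The protocol in which the prover runs `p` once, and then the verifier runs `v`. -/
def npProtocol (v p : Prog) : Protocol where
  rounds := 1
  verifier i := if i = 0 then .skip else v
  prover _ := p

theorem outputs_npProtocol_iff {v p : Prog} {σ : Strategy} {x : WeightedGraph} {r : ℕ → Bool}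
    {y : Option (ℕ ×ₗ ℕ ×ₗ ℕ)} : Outputs zeroWeightTriangle (npProtocol v p) σ x r y ↔
      ∃ s t, Exec v ((⟨x.encode, r⟩ : State).receive (σ [(⟨x.encode, r⟩ : State).message])) s t ∧
        zeroWeightTriangle.decode (s.mem result) = y := by
  constructor
  · rintro ⟨l, s, t, hrun, hy⟩
    change VerifierRun _ _ _ (0 + 1) _ _ _ at hrun
    cases hrun with
    | round h1 h2 =>
      cases h1 with
      | start h3 =>
        cases h3
        exact ⟨_, _, h2, hy⟩
  · rintro ⟨s, t, h, hy⟩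
    exact ⟨_, s, _, .round (.start (.skip _)) h, hy⟩

/-- What has to be checked for a protocol of `NP` type. -/
theorem isPseudoDeterministicProof_npProtocol {v p : Prog} {tV tP : WeightedGraph → ℝ}
    (hv : ∀ (x : WeightedGraph) (r : ℕ → Bool) (b : Message), ∃ s t,
      Exec v ((⟨x.encode, r⟩ : State).receive b) s t ∧ ((1 + t : ℕ) : ℝ) ≤ tV x ∧
      ((∃ y, zeroWeightTriangle.Rel x y) ∧
        zeroWeightTriangle.decode (s.mem result) = some (x.triple x.first) ∨
        zeroWeightTriangle.decode (s.mem result) = none))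
    (hp : ∀ (x : WeightedGraph) (r : ℕ → Bool) (b : Message), ∃ s t,
      Exec p ((⟨x.encode, r⟩ : State).receive b) s t ∧ (t : ℝ) ≤ tP x ∧
      ((∃ y, zeroWeightTriangle.Rel x y) → ∀ r', ∃ s' t',
        Exec v ((⟨x.encode, r'⟩ : State).receive s.message) s' t' ∧
        zeroWeightTriangle.decode (s'.mem result) = some (x.triple x.first))) :
    IsPseudoDeterministicProof zeroWeightTriangle (npProtocol v p) (fun x => x.triple x.first)
      tV tP where
  canonical x h := (x.isLeast_triple_first h).1
  completeness x h := by
    have huniv : {q : (ℕ → Bool) × (ℕ → Bool) | ∃ σ : Strategy,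
        (npProtocol v p).Plays ⟨zeroWeightTriangle.encode x, q.2⟩ σ ∧
        Outputs zeroWeightTriangle (npProtocol v p) σ x q.1 (some (x.triple x.first))} =
        Set.univ := by
      -- The honest prover succeeds for all coin tosses, so the probability is one.
      refine Set.eq_univ_of_forall fun q => ?_
      choose s t h1 _ h3 using hp x q.2
      refine ⟨fun l => match l with
        | b :: _ => (s b).message
        | [] => fun _ => false, ?_, ?_⟩
      · rintro l hl hl1
        match l, hl, hl1 with
        | [b], _, _ => exact ⟨s b, 0 + t b, .round .start (h1 b), rfl⟩
      · exact outputs_npProtocol_iff.2 (h3 _ h q.1)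
    unfold coinMeasure
    rw [huniv, measure_univ]
    exact ENNReal.div_le_of_le_mul (by norm_num)
  soundness x h σ := by
    have huniv : {r | Outputs zeroWeightTriangle (npProtocol v p) σ x r (some (x.triple x.first)) ∨
        Outputs zeroWeightTriangle (npProtocol v p) σ x r none} = Set.univ := by
      refine Set.eq_univ_of_forall fun r => ?_
      obtain ⟨s, t, h1, -, h2⟩ := hv x r (σ [(⟨x.encode, r⟩ : State).message])
      rcases h2 with ⟨-, h2⟩ | h2
      · exact .inl (outputs_npProtocol_iff.2 ⟨s, t, h1, h2⟩)
      · exact .inr (outputs_npProtocol_iff.2 ⟨s, t, h1, h2⟩)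
    unfold coinMeasure
    rw [huniv, measure_univ]
    exact ENNReal.div_le_of_le_mul (by norm_num)
  standard_soundness x h σ := by
    have hempty : {r | ∃ y, y ≠ none ∧ Outputs zeroWeightTriangle (npProtocol v p) σ x r y} = ∅ := by
      refine Set.eq_empty_of_forall_notMem ?_
      rintro r ⟨y, hy, ho⟩
      obtain ⟨s, t, h1, h2⟩ := outputs_npProtocol_iff.1 ho
      obtain ⟨s', t', h3, -, h4⟩ := hv x r (σ [(⟨x.encode, r⟩ : State).message])
      -- The run that produced the output is the run whose output is known.
      obtain ⟨rfl, -⟩ := h1.det h3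
      rcases h4 with ⟨h4, -⟩ | h4
      · exact h h4
      · exact hy (h2.symm.trans h4)
    rw [hempty, measure_empty]
    exact bot_le
  verifier_time x r σ := by
    obtain ⟨s, t, h1, h2, -⟩ := hv x r (σ [(⟨x.encode, r⟩ : State).message])
    exact ⟨_, s, 1 + t, .round (.start (.skip _)) h1, h2⟩
  prover_time x r l hl := by
    match l, hl with
    | [], _ =>
      obtain ⟨s, t, -, h2, -⟩ := hp x r fun _ => false
      exact ⟨_, 0, .start, le_trans (Nat.cast_le.2 (Nat.zero_le t)) h2⟩
    | [b], _ =>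
      obtain ⟨s, t, h1, h2, -⟩ := hp x r b
      exact ⟨s, 0 + t, .round .start h1, by rwa [Nat.zero_add]⟩

end PsdProof

end

noncomputable section

namespace PsdProof

local infixr:60 " ;; " => Prog.seq

/-! ### The two protocols -/

theorem deterministic_lift {c : Prog} (hc : c.Deterministic) : c.lift.Deterministic := by
  induction c with
  | skip => exact hc
  | write a i e => exact hc
  | flip a i => exact hc
  | seq c d ih1 ih2 => exact ⟨ih1 hc.1, ih2 hc.2⟩
  | ite e c d ih1 ih2 => exact ⟨ih1 hc.1, ih2 hc.2⟩
  | _ e c ih => exact ih hc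

theorem deterministic_verifierProg (π : Params) {c : Prog} (hc : c.Deterministic) :
    (verifierProg π c).Deterministic := by
  have := deterministic_lift hc
  simp [verifierProg, prelude, sumSqProg, lenProg, powersProg, header, decode, verifierMain,
    baseProg, bruteProg, countProg, tables, tableStep, fillInputs, callAll, accumulate, listCheck,
    checkEntry, outputProg, forLoop, Prog.Deterministic, this]

/-- The verifier that needs no proof. -/
def bruteVerifier : Prog :=
  findFirst ;; .ite (V 3 * V 3 * V 3 - V 16) outputProg .skip

theorem bruteVerifier_runs (π : Params) {x : WeightedGraph} {m : Memory} (h : Holds x m)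
    (h2 : m 2 0 = 0) : Runs (π.H x) bruteVerifier m (x.n * x.n * x.n * 5 + 9)
      (Verdict x x.first (x.first < x.n * x.n * x.n)) := by
  refine (Runs.seq (T := 1 + (1 + (x.n * x.n * x.n * 5 + 2))) (T' := 4 + 1)
    ((findFirst_runs π h).frame.mono le_rfl ?_)).mono (by omega) fun _ _ h => h
  rintro m1 - ⟨h16, hf⟩
  have h1 : Holds x m1 := h.frame fun a ha => hf a ((by decide : ∀ a ∈ [3, 4, 5], a ∉ _) a ha)
  have ht : 0 < (V 3 * V 3 * V 3 - V 16 : Expr).eval m1 ↔ x.first < x.n * x.n * x.n := by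
    simp only [eval_sub, eval_mul, eval_V, h1.n, h16, sub_pos]
    norm_cast
  refine Runs.ite rfl (fun hz => ?_) (fun hz => ?_)
  · rw [ht] at hz
    exact (outputProg_runs π h1 hz h16).mono le_rfl fun _ _ h => .inl ⟨hz, h⟩
  · rw [ht] at hz
    refine (Runs.skip (.inr ⟨hz, ?_⟩) : Runs _ _ _ 1 _).mono (by norm_num) fun _ _ h => h
    rw [hf 2 (by decide), h2]

/-- For `ω = 3`, where both time bounds are cubic: the verifier ignores the message and searches all
triples. -/
theorem exists_brute_protocol : ∃ (v p : Prog) (C : ℝ) (k : ℕ), v.Deterministic ∧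
    IsPseudoDeterministicProof zeroWeightTriangle (npProtocol v p) (fun x => x.triple x.first)
      (fun x => softBound C k 3 x.n x.maxWeight) (fun x => softBound C k 3 x.n x.maxWeight) := by
  -- Any parameters do, as they only enter through the size bound `H`.
  let π : Params := ⟨1, 1, 0, 1, one_pos, zero_le_one, one_pos⟩
  have hV : Soft 3 fun x => 1 + (x.n * x.n * x.n * 5 + 9) * (bruteVerifier.wt * ((π.H x).size + 1)) :=
    Soft.time π ((Soft.n3.mul_const 5).add (Soft.const 9)) (by norm_num) _
  obtain ⟨C, k, -, h1, h2⟩ := hV.common (Soft.const 1 : Soft 3 fun _ => 1)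
  have run : ∀ (x : WeightedGraph) (r : ℕ → Bool) (b : Message), ∃ s t,
      Exec bruteVerifier ((⟨x.encode, r⟩ : State).receive b) s t ∧
      ((1 + t : ℕ) : ℝ) ≤ softBound C k 3 x.n x.maxWeight ∧
      (x.first < x.n * x.n * x.n ∧
        zeroWeightTriangle.decode (s.mem result) = some (x.triple x.first) ∨
        ¬ x.first < x.n * x.n * x.n ∧ zeroWeightTriangle.decode (s.mem result) = none) := by
    intro x r b
    obtain ⟨m, t, h3, h4, -, h5⟩ := bruteVerifier_runs π (x.holds_receive r b)
      (x.receive_eq_zero r b (by decide) 0) (x.bdd_receive π r b) r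
    refine ⟨_, t, h3, le_trans ?_ (h1 x), h5.decode⟩
    exact_mod_cast Nat.add_le_add_left h4 1
  refine ⟨bruteVerifier, .skip, C, k, by simp [bruteVerifier, findFirst, outputProg, forLoop,
    Prog.Deterministic], isPseudoDeterministicProof_npProtocol (fun x r b => ?_) fun x r b => ?_⟩
  · obtain ⟨s, t, h3, h4, h5⟩ := run x r b
    refine ⟨s, t, h3, h4, h5.imp (fun h => ⟨?_, h.2⟩) fun h => h.2⟩
    rw [x.exists_rel_iff]
    by_contra hne
    have : x.first = x.n * x.n * x.n := by
      classical
      unfold WeightedGraph.first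
      rw [dif_neg hne]
    omega
  · refine ⟨_, 1, .skip _, by exact_mod_cast h2 x, fun h r' => ?_⟩
    obtain ⟨s, t, h3, -, h5⟩ := run x r' ((⟨x.encode, r⟩ : State).receive b).message
    rcases h5 with h5 | h5
    · exact ⟨s, t, h3, h5.2⟩
    · exact absurd (x.first_spec (x.exists_rel_iff.1 h)).1 h5.1

/-- With `δ = 1 - ω / 3 > 0` the target is `2 + ω / 3 = 3 - δ = ω + 2 * δ`: the first form bounds
the list, the second the matrix products. -/
theorem exists_fast_protocol (hω : omega < 3) : ∃ (v p : Prog) (C : ℝ) (k : ℕ), v.Deterministic ∧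
    IsPseudoDeterministicProof zeroWeightTriangle (npProtocol v p) (fun x => x.triple x.first)
      (fun x => softBound C k (2 + omega / 3) x.n x.maxWeight)
      (fun x => softBound C k 3 x.n x.maxWeight) := by
  have hω2 := two_le_omega
  obtain ⟨δ, hδ⟩ : ∃ δ, δ = 1 - omega / 3 := ⟨_, rfl⟩
  have hδ0 : 0 < δ := by linarith
  have hδ1 : δ ≤ 1 / 3 := by linarith
  -- The matrix products need `1.6 * 1.2 * δ + 0.08 * δ = 2 * δ`, which is exactly the room above
  -- `ω`.
  obtain ⟨τ, hτ, hτ1⟩ := exists_matMulInTime_lt (ε := 0.08 * δ) (by positivity)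
  have hτ2 := two_le_of_matMulInTime hτ
  obtain ⟨π, hg, hC, hρ, hργ⟩ := exists_params hδ0 hδ1
  obtain ⟨c, f, hc, hf⟩ := exists_multiplies hτ
  have hV := Soft.verifierSteps π hg (c := c) (e := 2 + omega / 3) hf (by linarith) (by linarith)
    (by linarith) (by linarith) (by linarith) (by linarith)
  obtain ⟨C, k, -, h1, h2⟩ := (Soft.time π hV (by linarith) (verifierProg π c).wt).common
    (Soft.time π (Soft.proverSteps π) (by norm_num) (proverProg π).wt)
  have run : ∀ (x : WeightedGraph) (r : ℕ → Bool) (b : Message), ∃ s t,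
      Exec (verifierProg π c) ((⟨x.encode, r⟩ : State).receive b) s t ∧
      ((1 + t : ℕ) : ℝ) ≤ softBound C k (2 + omega / 3) x.n x.maxWeight ∧
      (Accepts π x b ∧ zeroWeightTriangle.decode (s.mem result) = some (x.triple x.first) ∨
        ¬ Accepts π x b ∧ zeroWeightTriangle.decode (s.mem result) = none) := by
    intro x r b
    obtain ⟨m, t, h3, h4, -, h5⟩ := verifierProg_runs π (x.holds_receive r b) hc (b := b)
      (fun _ => rfl) (fun a ha => x.receive_eq_zero r b ha) (cmax := π.cmax x)
      (fun y hy h => π.le_cmax hy h) (x.bdd_receive π r b) r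
    refine ⟨_, t, h3, le_trans ?_ (h1 x), h5.decode.imp (fun h => ⟨h.1, ?_⟩) id⟩
    · exact_mod_cast Nat.add_le_add_left h4 1
    · rw [← h.1.eq_first]; exact h.2
  refine ⟨verifierProg π c, proverProg π, C, k, deterministic_verifierProg π hc.1,
    isPseudoDeterministicProof_npProtocol (fun x r b => ?_) fun x r b => ?_⟩
  · obtain ⟨s, t, h3, h4, h5⟩ := run x r b
    refine ⟨s, t, h3, h4, h5.imp (fun h => ⟨?_, h.2⟩) fun h => h.2⟩
    exact x.exists_rel_iff.2 ⟨_, h.1.lt, h.1.zero⟩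
  · obtain ⟨m, t, h3, h4, -, h5⟩ := proverProg_runs π hg hC (x.holds_receive r b)
      (x.receive_eq_zero r b (by decide)) (x.bdd_receive π r b) r
    refine ⟨_, t, h3, le_trans ?_ (h2 x), fun h r' => ?_⟩
    · exact_mod_cast h4.trans (Nat.le_add_left _ 1)
    · obtain ⟨s, t', h6, -, h7⟩ := run x r' (State.message ⟨m, r⟩)
      rcases h7 with h7 | h7
      · exact ⟨s, t', h6, h7.2⟩
      · exact absurd (h5 (x.exists_rel_iff.1 h)) h7.1

theorem isNP_npProtocol {v p : Prog} (hv : v.Deterministic) : (npProtocol v p).IsNP := by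
  refine ⟨rfl, rfl, fun i => ?_⟩
  unfold npProtocol
  dsimp only
  split_ifs
  · trivial
  · exact hv

end PsdProof

end

open PsdProof
theorem mainTheorem6 :
    ∃ (Q : Protocol) (c : WeightedGraph → ℕ ×ₗ ℕ ×ₗ ℕ) (C : ℝ) (k : ℕ),
      (∀ x : WeightedGraph, (∃ y, zeroWeightTriangle.Rel x y) →
        IsLeast {y : ℕ ×ₗ ℕ ×ₗ ℕ | zeroWeightTriangle.Rel x y} (c x)) ∧
      Q.IsNP ∧
      IsPseudoDeterministicProof zeroWeightTriangle Q c
        (fun x : WeightedGraph => softBound C k (2 + omega / 3) x.n x.maxWeight)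
        (fun x : WeightedGraph => softBound C k 3 x.n x.maxWeight) := by
  have key : ∃ (v p : Prog) (C : ℝ) (k : ℕ), v.Deterministic ∧
      IsPseudoDeterministicProof zeroWeightTriangle (npProtocol v p) (fun x => x.triple x.first)
        (fun x => softBound C k (2 + omega / 3) x.n x.maxWeight)
        (fun x => softBound C k 3 x.n x.maxWeight) := by
    -- The fast protocol needs `δ > 0` to absorb that `ω` is only an infimum.
    rcases lt_or_ge omega 3 with h | h
    · exact exists_fast_protocol h
    · have h3 : omega = 3 := le_antisymm
        (csInf_le ⟨2, fun _ h => two_le_of_matMulInTime h⟩ matMulInTime_three) h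
      rw [h3, show (2 : ℝ) + 3 / 3 = 3 by norm_num]
      exact exists_brute_protocol
  obtain ⟨v, p, C, k, hv, hproof⟩ := key
  exact ⟨npProtocol v p, fun x => x.triple x.first, C, k, fun x h => x.isLeast_triple_first h,
    isNP_npProtocol hv, hproof⟩
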